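/- **Notation.** For a polynomial $g(z,w)=\sum a_{l,m}z^lw^m$ over $\mathbb C$ let $P_g\subset\mathbb R^2$ be its Newton polygon, the convex hull of $\{(l,m): a_{l,m}\ne 0\}$. For a covector $\eta\in\mathbb R^{2*}$ let $P_g^\eta$ be the face of $P_g$ on which $x\mapsto\langle\eta,x\rangle$ attains its maximum, and let $g^\eta=\sum_{(l,m)\in P_g^\eta}a_{l,m}z^lw^m$ be the truncated polynomial. A side is a one-dimensional face. The polynomial $g$ is non-degenerate with respect to its Newton polygon if for every $\eta\in\mathbb R^{2*}$ one has $dg^\eta(z,w)\neq0$ at every zero $(z,w)\in(\mathbb C\setminus\{0\})^2$ of $g^\eta$. Write $D_{c,r}=\{z\in\mathbb C:|z-c|<r\}$, $D^*_{0,r}=D_{0,r}\setminus\{0\}$, and let $|\cdot|$ be the Euclidean norm on $\mathbb C^2$. **Theorem.** Let $f(z,w)=\sum a_{l,m}z^lw^m$ be a complex polynomial and $\xi_0\in\mathbb C$, such that $f-\xi_0$ is non-degenerate with respect to its Newton polygon $P=P_{f-\xi_0}$, $\dim P=2$, and (i) with each of its points $(u,v)$ the polygon $P$ contains the rectangle $\mathrm{conv}\{(0,0),(u,0),(0,v),(u,v)\}$.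 For a side $\Gamma$ of $P$ that lies on neither coordinate axis let $n_\Gamma+1$ be the number of lattice points on $\Gamma$ and $(\alpha,\beta)=(\alpha_\Gamma,\beta_\Gamma)$ its primitive integer outer normal vector. Then there are $\varepsilon>0$ and $R>0$ and, for each such $\Gamma$, maps $J_{\Gamma,n}$ and constants $\varkappa_{\Gamma,n}$, $1\le n\le n_\Gamma$, with the following properties. 1) Each $J_{\Gamma,n}:D_{\xi_0,\varepsilon}\times D^*_{0,\varepsilon}\to(\mathbb C\setminus\{0\})^2$ is a holomorphic embedding, and $$f\circ J_{\Gamma,n}(\xi,u)=\xi,\qquad J_{\Gamma,n}^*(dz\wedge dw)=\varkappa_{\Gamma,n}\,u^{(u_0-1)\alpha+(v_0-1)\beta-1}\,d\xi\wedge du$$ for any lattice point $(u_0,v_0)\in\Gamma$ (the exponent does not depend on its choice); moreover $|J_{\Gamma,n}(\xi,u)|\to\infty$ as $u\to0$, uniformly in $\xi\in D_{\xi_0,\varepsilon}$. The constants are: * $\varkappa_{\Gamma,n}=1$ if $(1,1)\notin\Gamma$; * $\varkappa_{\Gamma,(3\pm1)/2}=\pm(a_{1,1}^2-4a_{2,0}a_{0,2})^{-1/2}$,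 for a suitable choice of the (non-zero) square root, if $(1,1)\in\Gamma$ and $\Gamma$ is not parallel to a coordinate axis (then $n_\Gamma\le2$; if $n_\Gamma=1$ only the lower sign occurs); * if $(1,1)\in\Gamma$ and $\Gamma$ is vertical, so that $f^{(\alpha,\beta)}=z\,p(w)$, then $\varkappa_{\Gamma,n}=1/p'(w_n)$, where $w_n$ is the second coordinate of $\hat J_{\Gamma,n}(\xi,0)$, with $\hat J_{\Gamma,n}$ as in 3); if $(1,1)\in\Gamma$ and $\Gamma$ is horizontal, so that $f^{(\alpha,\beta)}=w\,q(z)$, then $\varkappa_{\Gamma,n}=-1/q'(z_n)$, where $z_n$ is the first coordinate of $\hat J_{\Gamma,n}(\xi,0)$. 2) The images of all these embeddings (for the same side and different $n$, or for different sides) are pairwise disjoint, and their union contains $\{(z,w): |f(z,w)-\xi_0|<\varepsilon,\ |(z,w)|\ge R\}$. 3) Each map $(\xi,u)\mapsto\bigl(u^{\alpha}\,\mathrm{Pr}_z J_{\Gamma,n}(\xi,u),\,u^{\beta}\,\mathrm{Pr}_w J_{\Gamma,n}(\xi,u)\bigr)$ extends to a holomorphic map $\hat J_{\Gamma,n}:D_{\xi_0,\varepsilon}\times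 D_{0,\varepsilon}\to(\mathbb C\setminus\{0\})^2$ with $f^{(\alpha,\beta)}(\hat J_{\Gamma,n}(\xi,0))=0$. For each $\Gamma$ there are exactly $n_\Gamma$ such embeddings up to a change of the coordinate $u$ near $u=0$: if $0<\varepsilon'\le\varepsilon$ and $J'$ is any map on $D_{\xi_0,\varepsilon'}\times D^*_{0,\varepsilon'}$ that has the properties listed in 1) and 3) for $\Gamma$, with $\varepsilon'$ in place of $\varepsilon$ and any constant $\varkappa'\in\mathbb C$, then there is exactly one $n$ such that $J'(D_{\xi_0,\varepsilon'}\times D^*_{0,\delta})\subseteq J_{\Gamma,n}(D_{\xi_0,\varepsilon}\times D^*_{0,\varepsilon})$ for some $\delta\in(0,\varepsilon']$. -/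

import Mathlib

open Metric

noncomputable section

/-- The exponent vector of a monomial `z ^ l * w ^ m`, as a point `(l, m)` of the real plane. -/
def expPoint (m : Fin 2 →₀ ℕ) : ℝ × ℝ := ((m 0 : ℝ), (m 1 : ℝ))

/-- The Newton polygon of a polynomial in `z` (variable `0`) and `w` (variable `1`). -/
def newtonPolygon (f : MvPolynomial (Fin 2) ℂ) : Set (ℝ × ℝ) :=
  convexHull ℝ (expPoint '' (f.support : Set (Fin 2 →₀ ℕ)))

/-- The dimension of the smallest affine subspace that contains `S`. -/
def affineDim (S : Set (ℝ × ℝ)) : ℕ := Module.finrank ℝ (vectorSpan ℝ S)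

/-- The value of the covector `η` on the vector `x`. -/
def pairing (η x : ℝ × ℝ) : ℝ := η.1 * x.1 + η.2 * x.2

/-- The face of `P` on which the covector `η` attains its maximum. -/
def face (P : Set (ℝ × ℝ)) (η : ℝ × ℝ) : Set (ℝ × ℝ) :=
  {x ∈ P | ∀ y ∈ P, pairing η y ≤ pairing η x}

open Classical in
/-- The truncation of `f` to the face of its Newton polygon that belongs to the covector `η`. -/
def truncation (f : MvPolynomial (Fin 2) ℂ) (η : ℝ × ℝ) : MvPolynomial (Fin 2) ℂ :=
  ∑ m ∈ f.support with expPoint m ∈ face (newtonPolygon f) η,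
    MvPolynomial.monomial m (f.coeff m)

/-- The value `f (z, w)` at `p = (z, w)`. -/
def evalAt (f : MvPolynomial (Fin 2) ℂ) (p : ℂ × ℂ) : ℂ := MvPolynomial.eval ![p.1, p.2] f

/-- Non-degeneracy of `f` with respect to its Newton polygon: for every covector, the differential
of the truncation does not vanish at the zeros of the truncation in the torus. -/
def IsNewtonNondegenerate (f : MvPolynomial (Fin 2) ℂ) : Prop :=
  ∀ (η : ℝ × ℝ) (p : ℂ × ℂ), p.1 ≠ 0 → p.2 ≠ 0 → evalAt (truncation f η) p = 0 →
    evalAt (MvPolynomial.pderiv 0 (truncation f η)) p ≠ 0 ∨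
      evalAt (MvPolynomial.pderiv 1 (truncation f η)) p ≠ 0

/-- With each of its points `(u, v)`, the set `P` contains the rectangle with vertices
`(0, 0)`, `(u, 0)`, `(0, v)`, `(u, v)`. -/
def ContainsRectangles (P : Set (ℝ × ℝ)) : Prop :=
  ∀ u v : ℝ, (u, v) ∈ P → convexHull ℝ {((0 : ℝ), (0 : ℝ)), (u, 0), (0, v), (u, v)} ⊆ P

/-- `Γ` is a side of `P`, that is, a one-dimensional face. -/
def IsSide (P Γ : Set (ℝ × ℝ)) : Prop :=
  (∃ η : ℝ × ℝ, Γ = face P η) ∧ affineDim Γ = 1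

/-- `Γ` is a side of `P` that lies on neither of the coordinate axes. -/
def IsOuterSide (P Γ : Set (ℝ × ℝ)) : Prop :=
  IsSide P Γ ∧ ¬ Γ ⊆ {x | x.1 = 0} ∧ ¬ Γ ⊆ {x | x.2 = 0}

/-- `(α, β)` is a primitive integer outer normal vector of the side `Γ` of `P`. -/
def IsPrimitiveOuterNormal (P Γ : Set (ℝ × ℝ)) (α β : ℤ) : Prop :=
  IsCoprime α β ∧ Γ = face P ((α : ℝ), (β : ℝ))

/-- The number of lattice points on `Γ`, minus one. -/
def latticeLength (Γ : Set (ℝ × ℝ)) : ℕ :=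
  {q : ℤ × ℤ | ((q.1 : ℝ), (q.2 : ℝ)) ∈ Γ}.ncard - 1

/-- The Euclidean norm of `ℂ²`. -/
def normC2 (p : ℂ × ℂ) : ℝ := Real.sqrt (‖p.1‖ ^ 2 + ‖p.2‖ ^ 2)

/-- The torus `(ℂ ∖ {0})²`. -/
def torus : Set (ℂ × ℂ) := {p | p.1 ≠ 0 ∧ p.2 ≠ 0}

/-- The product of the disc of radius `ε` about `ξ₀` and the punctured disc of radius `δ`
about `0`. -/
def puncturedBidisc (ξ₀ : ℂ) (ε δ : ℝ) : Set (ℂ × ℂ) := ball ξ₀ ε ×ˢ (ball (0 : ℂ) δ \ {0})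

/-- `F` is a holomorphic embedding of the open set `U ⊆ ℂ²` into `ℂ²`: a holomorphic immersion
that is a homeomorphism onto its image. -/
def IsHolomorphicEmbedding (F : ℂ × ℂ → ℂ × ℂ) (U : Set (ℂ × ℂ)) : Prop :=
  DifferentiableOn ℂ F U ∧ (∀ p ∈ U, Function.Injective (fderiv ℂ F p)) ∧
    Topology.IsEmbedding (U.domRestrict F)

/-- The 2-form `dx ∧ dy` of `ℂ²` with coordinates `(x, y)`, on a pair of tangent vectors. -/
def stdForm (a b : ℂ × ℂ) : ℂ := a.1 * b.2 - a.2 * b.1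

/-- The pullback `F^* (dz ∧ dw)` at the point `p`, on a pair of tangent vectors. -/
def pullbackStdForm (F : ℂ × ℂ → ℂ × ℂ) (p a b : ℂ × ℂ) : ℂ :=
  stdForm (fderiv ℂ F p a) (fderiv ℂ F p b)

/-- `J` (with the extended rescaled map `Jhat`) is a normalizing embedding that belongs to the
side `Γ` with primitive outer normal `(α, β)`. Points of the source are `(ξ, u)`. -/
structure IsNormalizingEmbedding (f : MvPolynomial (Fin 2) ℂ) (ξ₀ : ℂ) (Γ : Set (ℝ × ℝ))
    (α β : ℤ) (ε : ℝ) (κ : ℂ) (J Jhat : ℂ × ℂ → ℂ × ℂ) : Prop where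
  embedding : IsHolomorphicEmbedding J (puncturedBidisc ξ₀ ε ε)
  mapsTo_torus : Set.MapsTo J (puncturedBidisc ξ₀ ε ε) torus
  eval_eq : ∀ p ∈ puncturedBidisc ξ₀ ε ε, evalAt f (J p) = p.1
  pullback_eq : ∀ u₀ v₀ : ℤ, ((u₀ : ℝ), (v₀ : ℝ)) ∈ Γ →
    ∀ p ∈ puncturedBidisc ξ₀ ε ε, ∀ a b : ℂ × ℂ,
      pullbackStdForm J p a b = κ * p.2 ^ ((u₀ - 1) * α + (v₀ - 1) * β - 1) * stdForm a b
  tendsto_infty : ∀ M : ℝ, ∃ δ > 0, ∀ p ∈ puncturedBidisc ξ₀ ε ε, ‖p.2‖ < δ → M < normC2 (J p)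
  hat_holomorphic : DifferentiableOn ℂ Jhat (ball ξ₀ ε ×ˢ ball (0 : ℂ) ε)
  hat_mapsTo_torus : Set.MapsTo Jhat (ball ξ₀ ε ×ˢ ball (0 : ℂ) ε) torus
  hat_eq : ∀ p ∈ puncturedBidisc ξ₀ ε ε, Jhat p = (p.2 ^ α * (J p).1, p.2 ^ β * (J p).2)
  hat_zero : ∀ ξ ∈ ball ξ₀ ε, evalAt (truncation f ((α : ℝ), (β : ℝ))) (Jhat (ξ, 0)) = 0

/-- The exponent vector `(l, m)`. -/
def expo (l m : ℕ) : Fin 2 →₀ ℕ := Finsupp.single 0 l + Finsupp.single 1 m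

/-- The value of the constants `κ n` of the embeddings that belong to the side `Γ` with primitive
outer normal `(α, β)`. -/
structure IsNormalizingConstant (f : MvPolynomial (Fin 2) ℂ) (ξ₀ : ℂ) (Γ : Set (ℝ × ℝ))
    (α β : ℤ) (ε : ℝ) (κ : Fin (latticeLength Γ) → ℂ)
    (Jhat : Fin (latticeLength Γ) → ℂ × ℂ → ℂ × ℂ) : Prop where
  eq_one : ((1 : ℝ), (1 : ℝ)) ∉ Γ → ∀ n, κ n = 1
  /- `Γ` is oblique: opposite values of the inverse square root of the discriminant. -/
  oblique : ((1 : ℝ), (1 : ℝ)) ∈ Γ → α ≠ 0 → β ≠ 0 →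
    ∃ s : ℂ, s ≠ 0 ∧
      s ^ 2 = f.coeff (expo 1 1) ^ 2 - 4 * f.coeff (expo 2 0) * f.coeff (expo 0 2) ∧
      ∀ n, κ n = if (n : ℕ) = 0 then -s⁻¹ else s⁻¹
  /- `Γ` is vertical: the truncation is `z * p w`, and `κ n = 1 / p' (w n)`. -/
  vertical : ((1 : ℝ), (1 : ℝ)) ∈ Γ → β = 0 → ∀ n, ∀ ξ ∈ ball ξ₀ ε,
    κ n * evalAt (MvPolynomial.pderiv 1 (truncation f ((α : ℝ), (β : ℝ))))
      (1, (Jhat n (ξ, 0)).2) = 1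
  /- `Γ` is horizontal: the truncation is `w * q z`, and `κ n = -1 / q' (z n)`. -/
  horizontal : ((1 : ℝ), (1 : ℝ)) ∈ Γ → α = 0 → ∀ n, ∀ ξ ∈ ball ξ₀ ε,
    κ n * evalAt (MvPolynomial.pderiv 0 (truncation f ((α : ℝ), (β : ℝ))))
      ((Jhat n (ξ, 0)).1, 1) = -1

end

noncomputable section

open Filter Topology

/-! Put g = f − ξ₀. Complete the primitive normal (α, β) of an outer side Γ to a unimodular matrix,
αb − βa = 1, and use the torus chart z = t^(−α) s^a, w = t^(−β) s^b. Then g = t^(−m) F(t, s), where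
m > 0 is the value of (α, β) on Γ and F (`chartPoly`) has no negative powers of t. Up to a power of
s, F(0, s) is a polynomial of degree n_Γ with non-zero roots, and non-degeneracy makes them simple
(`IsSideChart.fderiv_ne_zero`, `IsSideChart.exists_roots`). The level set g = η becomes F(t, s) =
t^m η, which the implicit function theorem solves near each root c by s = S(η, t) with S(η, 0) = c.
Each root gives one embedding.

On such a branch dz ∧ dw = t^e A dη ∧ dt with e = m − α − β − 1 and A = s^(a+b−1) / F_s. It remains
to find u = t U with κ u^e du = t^e A dt for fixed η (`exists_normal_coordinate`). For e ≥ 0 an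
Euler equation does this with κ = 1. For e = −1, that is (1, 1) ∈ Γ, the residue A(η, 0) does not
depend on η because S(η, 0) = c, and it is κ. For e < −1 a residue depending on η could obstruct the
normal form, but then m < α + β, which forces f to be linear in one of the variables and A to be
constant (`IsSideChart.residue_const`).

Branches of one side are disjoint because s stays near different roots. For two sides, the
coordinate s' of one is t^d s^j in the chart of the other, with d the non-zero determinant of the
normals; since s and s' stay in annuli, t cannot be small
(`IsBranchSystem.eventually_branchMap_ne`).

The images cover because, where g is small, two monomials of g are comparable and dominate the rest
(`exists_dominant_pair`). Far from the origin the covector (log ‖z‖, log ‖w‖) is then close to a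
large multiple of an integral normal, and the two exponents lie on an outer side
(`exists_outerSide_of_dominant`). In its chart s lies in a fixed annulus and t is small, so s is
near a root and the point lies on a branch.

For uniqueness, the part of a competing embedding near u = 0 is connected and lies in the disjoint
open images already found, hence in one of them; its growth rates in u determine the side
(`IsNormalizingEmbedding.weight_eq_zero`). -/

/-! ### Euler equations and normal coordinates for relative one-forms -/

/-- The linear map `(x, t) ↦ (x, τ t)`. -/
def scaleSnd (τ : ℝ) : ℂ × ℂ →L[ℂ] ℂ × ℂ :=
  (ContinuousLinearMap.inl ℂ ℂ ℂ).comp (ContinuousLinearMap.fst ℂ ℂ ℂ) +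
    (τ : ℂ) • (ContinuousLinearMap.inr ℂ ℂ ℂ).comp (ContinuousLinearMap.snd ℂ ℂ ℂ)

theorem scaleSnd_apply (τ : ℝ) (p : ℂ × ℂ) : scaleSnd τ p = (p.1, τ * p.2) := by
  simp [scaleSnd]

theorem norm_scaleSnd_apply_le {τ : ℝ} (hτ : τ ∈ Set.Icc (0 : ℝ) 1) (p : ℂ × ℂ) :
    ‖scaleSnd τ p‖ ≤ ‖p‖ := by
  rw [scaleSnd_apply, Prod.norm_def, Prod.norm_def]
  refine max_le_max le_rfl ?_
  rw [norm_mul, Complex.norm_real, Real.norm_of_nonneg hτ.1]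
  exact mul_le_of_le_one_left (norm_nonneg _) hτ.2

theorem continuous_scaleSnd : Continuous scaleSnd := by
  unfold scaleSnd
  fun_prop

theorem continuous_scaleSnd_apply : Continuous fun q : ℝ × (ℂ × ℂ) => scaleSnd q.1 q.2 := by
  simp only [scaleSnd_apply]
  fun_prop

/-- The Euler-type equation `(n + 1) B + t ∂B/∂t = A` has a `C¹` solution near the origin. -/
theorem exists_euler_solution (n : ℕ) {A : ℂ × ℂ → ℂ} (hA : ContDiffAt ℂ 1 A 0) :
    ∃ B : ℂ × ℂ → ℂ, ContDiffAt ℂ 1 B 0 ∧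
      ∀ᶠ p in 𝓝 (0 : ℂ × ℂ), (n + 1) * B p + p.2 * fderiv ℂ B p (0, 1) = A p := by
  obtain ⟨r, hr, hball⟩ := Metric.eventually_nhds_iff_ball.1 (hA.eventually (by simp))
  have hdiff : ∀ p ∈ ball (0 : ℂ × ℂ) r, DifferentiableAt ℂ A p := fun p hp =>
    (hball p hp).differentiableAt (by simp)
  have hcont : ∀ p ∈ ball (0 : ℂ × ℂ) r, ContinuousAt (fderiv ℂ A) p := fun p hp =>
    ((hball p hp).fderiv_right (m := 0) (by simp)).continuousAt
  have hmem : ∀ τ ∈ Set.Icc (0 : ℝ) 1, ∀ s ≤ r, ∀ p ∈ ball (0 : ℂ × ℂ) s,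
      scaleSnd τ p ∈ ball (0 : ℂ × ℂ) s := by
    intro τ hτ s _ p hp
    rw [mem_ball_zero_iff] at hp ⊢
    exact (norm_scaleSnd_apply_le hτ p).trans_lt hp
  -- The solution is B(x, t) = ∫₀¹ τ^n A(x, τt) dτ: averaging divides the coefficient of t^k by n +
  -- k + 1. `F'` is the derivative of the integrand in (x, t).
  let F : ℂ × ℂ → ℝ → ℂ := fun p τ => (τ : ℂ) ^ n * A (scaleSnd τ p)
  let F' : ℂ × ℂ → ℝ → (ℂ × ℂ →L[ℂ] ℂ) := fun p τ =>
    ((τ : ℂ) ^ n) • ((fderiv ℂ A (scaleSnd τ p)).comp (scaleSnd τ))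
  have hFc : ∀ p ∈ ball (0 : ℂ × ℂ) r, ContinuousOn (F p) (Set.Icc 0 1) := by
    intro p hp τ hτ
    have h1 : ContinuousAt A (scaleSnd τ p) := (hdiff _ (hmem τ hτ r le_rfl p hp)).continuousAt
    have h2 : ContinuousAt (fun τ => scaleSnd τ p) τ :=
      (continuous_scaleSnd_apply.comp (continuous_id.prodMk continuous_const)).continuousAt
    have h3 : ContinuousAt (fun τ => A (scaleSnd τ p)) τ := ContinuousAt.comp h1 h2
    exact ((Continuous.continuousAt (by fun_prop)).mul h3).continuousWithinAt
  have hF'c2 : ∀ p ∈ ball (0 : ℂ × ℂ) r, ∀ τ ∈ Set.Icc (0 : ℝ) 1,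
      ContinuousAt (fun q : (ℂ × ℂ) × ℝ => F' q.1 q.2) (p, τ) := by
    intro p hp τ hτ
    have h1 : ContinuousAt (fderiv ℂ A) (scaleSnd τ p) := hcont _ (hmem τ hτ r le_rfl p hp)
    have h2 : ContinuousAt (fun q : (ℂ × ℂ) × ℝ => scaleSnd q.2 q.1) (p, τ) :=
      (continuous_scaleSnd_apply.comp (continuous_snd.prodMk continuous_fst)).continuousAt
    have h3 : ContinuousAt (fun q : (ℂ × ℂ) × ℝ => fderiv ℂ A (scaleSnd q.2 q.1)) (p, τ) :=
      ContinuousAt.comp (f := fun q : (ℂ × ℂ) × ℝ => scaleSnd q.2 q.1) (x := (p, τ)) h1 h2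
    have h4 : ContinuousAt (fun q : (ℂ × ℂ) × ℝ => scaleSnd q.2) (p, τ) :=
      (continuous_scaleSnd.comp continuous_snd).continuousAt
    have h5 : ContinuousAt (fun q : (ℂ × ℂ) × ℝ => (q.2 : ℂ) ^ n) (p, τ) :=
      Continuous.continuousAt (by fun_prop)
    exact h5.smul (h3.clm_comp h4)
  have hF'c : ∀ p ∈ ball (0 : ℂ × ℂ) r, ContinuousOn (F' p) (Set.Icc 0 1) := by
    intro p hp τ hτ
    have h2 : ContinuousAt (fun τ : ℝ => (p, τ)) τ := Continuous.continuousAt (by fun_prop)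
    exact (ContinuousAt.comp (f := fun τ : ℝ => (p, τ)) (x := τ)
      (hF'c2 p hp τ hτ) h2).continuousWithinAt
  have hsub : Set.uIoc (0 : ℝ) 1 ⊆ Set.Icc 0 1 := by
    rw [Set.uIoc_of_le zero_le_one]; exact Set.Ioc_subset_Icc_self
  have hbound : ∀ r₁ < r, ∃ C : ℝ, ∀ τ ∈ Set.Icc (0 : ℝ) 1, ∀ p ∈ ball (0 : ℂ × ℂ) r₁,
      ‖F' p τ‖ ≤ C := by
    intro r₁ hr₁
    have hK : IsCompact (closedBall (0 : ℂ × ℂ) r₁ ×ˢ Set.Icc (0 : ℝ) 1) :=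
      (isCompact_closedBall _ _).prod isCompact_Icc
    obtain ⟨C, hC⟩ := hK.exists_bound_of_continuousOn
      (f := fun q : (ℂ × ℂ) × ℝ => F' q.1 q.2) (by
        rintro ⟨p, τ⟩ ⟨hp, hτ⟩
        exact (hF'c2 p (closedBall_subset_ball hr₁ hp) τ hτ).continuousWithinAt)
    exact ⟨C, fun τ hτ p hp => hC (p, τ) ⟨ball_subset_closedBall hp, hτ⟩⟩
  have hderiv : ∀ p ∈ ball (0 : ℂ × ℂ) r,
      HasFDerivAt (fun p => ∫ τ in (0 : ℝ)..1, F p τ) (∫ τ in (0 : ℝ)..1, F' p τ) p := by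
    intro p hp
    obtain ⟨r₁, hpr₁, hr₁⟩ := exists_between (mem_ball_zero_iff.1 hp)
    obtain ⟨C, hC⟩ := hbound r₁ hr₁
    have hnb : ball (0 : ℂ × ℂ) r₁ ∈ 𝓝 p := isOpen_ball.mem_nhds (mem_ball_zero_iff.2 hpr₁)
    refine intervalIntegral.hasFDerivAt_integral_of_dominated_of_fderiv_le (bound := fun _ => C)
      hnb ?_ ?_ ?_ ?_ ?_ ?_
    · filter_upwards [isOpen_ball.mem_nhds hp] with q hq
      exact ((hFc q hq).mono hsub).aestronglyMeasurable measurableSet_uIoc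
    · exact ContinuousOn.intervalIntegrable (by
        rw [Set.uIcc_of_le zero_le_one]; exact hFc p hp)
    · exact ((hF'c p hp).mono hsub).aestronglyMeasurable measurableSet_uIoc
    · exact Eventually.of_forall fun τ hτ q hq => hC τ (hsub hτ) q hq
    · exact intervalIntegrable_const
    · refine Eventually.of_forall fun τ hτ q hq => ?_
      have h1 := (hdiff _ (hmem τ (hsub hτ) r le_rfl q
        (ball_subset_ball hr₁.le hq))).hasFDerivAt.comp q (scaleSnd τ).hasFDerivAt
      exact h1.const_smul ((τ : ℂ) ^ n)
  have hcd : ∀ p ∈ ball (0 : ℂ × ℂ) r,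
      ContinuousAt (fun p => ∫ τ in (0 : ℝ)..1, F' p τ) p := by
    intro p hp
    obtain ⟨r₁, hpr₁, hr₁⟩ := exists_between (mem_ball_zero_iff.1 hp)
    obtain ⟨C, hC⟩ := hbound r₁ hr₁
    have hnb : ball (0 : ℂ × ℂ) r₁ ∈ 𝓝 p := isOpen_ball.mem_nhds (mem_ball_zero_iff.2 hpr₁)
    refine intervalIntegral.continuousAt_of_dominated_interval (bound := fun _ => C) ?_ ?_ ?_ ?_
    · filter_upwards [isOpen_ball.mem_nhds hp] with q hq
      exact ((hF'c q hq).mono hsub).aestronglyMeasurable measurableSet_uIoc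
    · filter_upwards [hnb] with q hq
      exact Eventually.of_forall fun τ hτ => hC τ (hsub hτ) q hq
    · exact intervalIntegrable_const
    · refine Eventually.of_forall fun τ hτ => ?_
      have h2 : ContinuousAt (fun q : ℂ × ℂ => (q, τ)) p := Continuous.continuousAt (by fun_prop)
      exact ContinuousAt.comp (f := fun q : ℂ × ℂ => (q, τ)) (x := p)
        (hF'c2 p hp τ (hsub hτ)) h2
  refine ⟨fun p => ∫ τ in (0 : ℝ)..1, F p τ, ?_, ?_⟩
  · exact contDiffAt_one_iff.2 ⟨_, ball 0 r, ball_mem_nhds _ hr,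
      fun p hp => (hcd p hp).continuousWithinAt, hderiv⟩
  · filter_upwards [ball_mem_nhds _ hr] with p hp
    rw [(hderiv p hp).fderiv]
    have hint : IntervalIntegrable (F' p) MeasureTheory.volume 0 1 :=
      ContinuousOn.intervalIntegrable (by rw [Set.uIcc_of_le zero_le_one]; exact hF'c p hp)
    have hint0 : IntervalIntegrable (F p) MeasureTheory.volume 0 1 :=
      ContinuousOn.intervalIntegrable (by rw [Set.uIcc_of_le zero_le_one]; exact hFc p hp)
    have hint1 : IntervalIntegrable (fun τ => F' p τ (0, 1)) MeasureTheory.volume 0 1 :=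
      ContinuousOn.intervalIntegrable (by
        rw [Set.uIcc_of_le zero_le_one]; exact (hF'c p hp).clm_apply continuousOn_const)
    rw [ContinuousLinearMap.intervalIntegral_apply hint, ← intervalIntegral.integral_const_mul,
      ← intervalIntegral.integral_const_mul, ← intervalIntegral.integral_add
        (hint0.const_mul _) (hint1.const_mul _)]
    -- The integrand of (n + 1) B + t ∂B/∂t is the total τ-derivative of τ^(n+1) A(x, τt), so the
    -- integral is the boundary value A(x, t).
    have hft : ∀ τ ∈ Set.uIcc (0 : ℝ) 1, HasDerivAt (fun τ : ℝ => (τ : ℂ) ^ (n + 1) *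
        A (scaleSnd τ p)) ((n + 1) * F p τ + p.2 * F' p τ (0, 1)) τ := by
      intro τ hτ
      rw [Set.uIcc_of_le zero_le_one] at hτ
      have h1 : HasDerivAt (fun τ : ℝ => (τ : ℂ) ^ (n + 1)) ((n + 1 : ℕ) * (τ : ℂ) ^ n) τ := by
        have := (hasDerivAt_pow (n + 1) (τ : ℂ)).comp_ofReal
        simpa using this
      have h2 : HasDerivAt (fun τ : ℝ => scaleSnd τ p) ((0, p.2) : ℂ × ℂ) τ := by
        simp only [scaleSnd_apply]
        refine (hasDerivAt_const τ p.1).prodMk ?_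
        have := ((hasDerivAt_id (τ : ℂ)).comp_ofReal).mul_const p.2
        simpa using this
      have h3 := ((hdiff _ (hmem τ hτ r le_rfl p hp)).hasFDerivAt.restrictScalars
        ℝ).comp_hasDerivAt τ h2
      have h4 := h1.mul h3
      refine h4.congr_deriv ?_
      have h5 : ((0, p.2) : ℂ × ℂ) = p.2 • ((0, 1) : ℂ × ℂ) := by simp
      have h6 : scaleSnd τ ((0, 1) : ℂ × ℂ) = (τ : ℂ) • ((0, 1) : ℂ × ℂ) := by
        simp [scaleSnd_apply]
      simp only [F, F', smul_apply, ContinuousLinearMap.comp_apply, h6,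
        ContinuousLinearMap.coe_restrictScalars', h5, map_smul, smul_eq_mul]
      push_cast
      simp only [Function.comp]
      ring
    rw [intervalIntegral.integral_eq_sub_of_hasDerivAt hft
      ((hint0.const_mul _).add (hint1.const_mul _))]
    simp [scaleSnd_apply]

/-- This is the case e = −1, where u = t exp E should give A(0) du/u = A dt/t. Since A − A(0)
vanishes on t = 0, it equals t B₁ with B₁ an average of ∂A/∂t; a second average B of B₁ / A(0)
satisfies ∂(tB)/∂t = B₁ / A(0), and E = tB. -/
theorem exists_log_euler_solution {A : ℂ × ℂ → ℂ} (hA : AnalyticAt ℂ A 0) (hA0 : A 0 ≠ 0)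
    (hconst : ∀ᶠ p in 𝓝 (0 : ℂ × ℂ), A (p.1, 0) = A 0) :
    ∃ E : ℂ × ℂ → ℂ, ContDiffAt ℂ 1 E 0 ∧
      ∀ᶠ p in 𝓝 (0 : ℂ × ℂ), A 0 * (1 + p.2 * fderiv ℂ E p (0, 1)) = A p := by
  have hAt : AnalyticAt ℂ (fun p => fderiv ℂ A p (0, 1)) 0 :=
    (ContinuousLinearMap.analyticAt (ContinuousLinearMap.apply ℂ ℂ ((0, 1) : ℂ × ℂ)) _).comp
      hA.fderiv
  obtain ⟨B₁, hB₁, hB₁e⟩ := exists_euler_solution 0 hAt.contDiffAt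
  obtain ⟨B, hB, hBe⟩ := exists_euler_solution 0 (hB₁.div_const (A 0))
  refine ⟨fun p => p.2 * B p, contDiffAt_snd.mul hB, ?_⟩
  -- On each line x = const, s B₁ − A has zero derivative by the Euler equation for B₁.
  have hdiv : ∀ᶠ p in 𝓝 (0 : ℂ × ℂ), p.2 * B₁ p = A p - A (p.1, 0) := by
    have hev := (hA.eventually_analyticAt.and (hB₁.eventually (by simp))).and hB₁e
    obtain ⟨r, hr, hball⟩ := Metric.eventually_nhds_iff_ball.1 hev
    filter_upwards [ball_mem_nhds _ hr] with p hp
    have hp' : ‖p.1‖ < r ∧ ‖p.2‖ < r := by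
      rw [mem_ball_zero_iff, Prod.norm_def, max_lt_iff] at hp; exact hp
    have hmem : ∀ s ∈ ball (0 : ℂ) r, ((p.1, s) : ℂ × ℂ) ∈ ball (0 : ℂ × ℂ) r := by
      intro s hs
      rw [mem_ball_zero_iff] at hs ⊢
      rw [Prod.norm_def, max_lt_iff]; exact ⟨hp'.1, hs⟩
    have hd : ∀ s ∈ ball (0 : ℂ) r,
        HasDerivAt (fun s => s * B₁ (p.1, s) - A (p.1, s)) 0 s := by
      intro s hs
      obtain ⟨⟨h1, h2⟩, h3⟩ := hball _ (hmem s hs)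
      have hline : HasDerivAt (fun s : ℂ => ((p.1, s) : ℂ × ℂ)) (0, 1) s :=
        (hasDerivAt_const s p.1).prodMk (hasDerivAt_id s)
      have h4 := h1.differentiableAt.hasFDerivAt.comp_hasDerivAt s hline
      have h5 := (h2.differentiableAt (by simp)).hasFDerivAt.comp_hasDerivAt s hline
      refine (((hasDerivAt_id s).mul h5).sub h4).congr_deriv ?_
      simp only [Nat.cast_zero, zero_add, one_mul] at h3
      simp only [id, Function.comp, one_mul]
      rw [← h3]; ring
    have hc := isOpen_ball.is_const_of_deriv_eq_zero (convex_ball (0 : ℂ) r).isPreconnected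
      (f := fun s => s * B₁ (p.1, s) - A (p.1, s))
      (fun s hs => (hd s hs).differentiableAt.differentiableWithinAt)
      (fun s hs => (hd s hs).deriv) (mem_ball_zero_iff.2 hp'.2) (mem_ball_self hr)
    simp only [zero_mul, zero_sub] at hc
    linear_combination hc
  filter_upwards [hdiv, hBe, hconst, hB.eventually (by simp)] with p h1 h2 h3 h4
  have h5 : HasFDerivAt (fun p : ℂ × ℂ => p.2 * B p)
      (p.2 • fderiv ℂ B p + B p • ContinuousLinearMap.snd ℂ ℂ ℂ) p :=
    hasFDerivAt_snd.mul (h4.differentiableAt (by simp)).hasFDerivAt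
  rw [h5.fderiv]
  simp only [Nat.cast_zero, zero_add, one_mul] at h2
  simp only [add_apply, smul_apply, smul_eq_mul,
    ContinuousLinearMap.coe_snd', mul_one]
  have h6 : p.2 * fderiv ℂ B p (0, 1) + B p = B₁ p / A 0 := by rw [← h2]; ring
  rw [h6]
  field_simp
  rw [h3] at h1
  linear_combination h1

/-- A coordinate `t U` in which the relative form `t ^ e A dt` becomes `κ u ^ e du`. -/
theorem exists_normal_coordinate {A : ℂ × ℂ → ℂ} (hA : AnalyticAt ℂ A 0) (hA0 : A 0 ≠ 0) (e : ℤ)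
    (he : 0 ≤ e ∨ (e = -1 ∧ ∀ᶠ p in 𝓝 (0 : ℂ × ℂ), A (p.1, 0) = A 0) ∨
      (e ≠ -1 ∧ ∀ᶠ p in 𝓝 (0 : ℂ × ℂ), A p = A 0)) :
    ∃ κ : ℂ, κ ≠ 0 ∧ (e ≠ -1 → κ = 1) ∧ (e = -1 → κ = A 0) ∧
      ∃ U : ℂ × ℂ → ℂ, ContDiffAt ℂ 1 U 0 ∧ U 0 ≠ 0 ∧
        ∀ᶠ p in 𝓝 (0 : ℂ × ℂ), κ * U p ^ e * (U p + p.2 * fderiv ℂ U p (0, 1)) = A p := by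
  rcases he with he | ⟨he, hconst⟩ | ⟨he, hconst⟩
  -- A primitive of t^e A is t^(e+1) B, so U must be an (e + 1)-st root of (e + 1) B. Dividing by
  -- A(0) moves the value at the origin to 1, where the principal logarithm is holomorphic; ρ
  -- restores the factor.
  · lift e to ℕ using he
    refine ⟨1, one_ne_zero, fun _ => rfl, fun h => absurd h (by lia), ?_⟩
    obtain ⟨B, hB, hBe⟩ := exists_euler_solution e hA.contDiffAt
    have hn : (e : ℂ) + 1 ≠ 0 := by exact_mod_cast e.succ_ne_zero
    have hB0 : (e + 1) * B 0 = A 0 := by simpa using hBe.self_of_nhds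
    obtain ⟨ρ, hρ⟩ := IsAlgClosed.exists_pow_nat_eq (A 0) e.succ_pos
    have hρ0 : ρ ≠ 0 := by
      rintro rfl
      exact hA0 (by rw [← hρ]; simp)
    have hW : ContDiffAt ℂ 1 (fun p => (e + 1) * B p / A 0) 0 :=
      (contDiffAt_const.mul hB).div_const _
    have hW0 : (e + 1) * B 0 / A 0 = 1 := by rw [hB0]; exact div_self hA0
    have hlog : ContDiffAt ℂ 1 (fun p => Complex.log ((e + 1) * B p / A 0)) 0 :=
      ContDiffAt.comp (g := Complex.log) (0 : ℂ × ℂ)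
      (Complex.contDiffAt_log (by rw [hW0]; exact Complex.one_mem_slitPlane)) hW
    let U : ℂ × ℂ → ℂ := fun p => ρ * Complex.exp (Complex.log ((e + 1) * B p / A 0) / (e + 1))
    have hU : ContDiffAt ℂ 1 U 0 := contDiffAt_const.mul (hlog.div_const _).cexp
    have hUpow : ∀ᶠ p in 𝓝 (0 : ℂ × ℂ), U p ^ (e + 1) = (e + 1) * B p := by
      filter_upwards [hW.continuousAt.eventually_ne (y := 0) (by rw [hW0]; exact one_ne_zero)]
        with p hp
      simp only [U]
      rw [mul_pow, hρ, ← Complex.exp_nat_mul]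
      push_cast
      rw [mul_div_cancel₀ _ hn, Complex.exp_log hp, mul_div_cancel₀ _ hA0]
    refine ⟨U, hU, mul_ne_zero hρ0 (Complex.exp_ne_zero _), ?_⟩
    filter_upwards [hBe, hUpow, hUpow.eventually_nhds, hB.eventually (by simp),
      hU.eventually (by simp)] with p h1 h2 h3 h4 h5
    have h6 : HasFDerivAt (fun p => U p ^ (e + 1))
        (((e + 1 : ℕ) * U p ^ e) • fderiv ℂ U p) p := by
      simpa using (h5.differentiableAt (by simp)).hasFDerivAt.pow (e + 1)
    have h7 : HasFDerivAt (fun p => ((e : ℂ) + 1) * B p) (((e : ℂ) + 1) • fderiv ℂ B p) p :=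
      (h4.differentiableAt (by simp)).hasFDerivAt.const_mul _
    have h8 := DFunLike.congr_fun (h6.unique (h7.congr_of_eventuallyEq h3)) ((0, 1) : ℂ × ℂ)
    simp only [smul_apply, smul_eq_mul] at h8
    push_cast at h8
    rw [zpow_natCast, one_mul, mul_add, ← pow_succ, h2, ← h1]
    have h9 := mul_left_cancel₀ hn ((mul_assoc _ _ _).symm.trans h8)
    linear_combination p.2 * h9
  · subst he
    obtain ⟨E, hE, hEe⟩ := exists_log_euler_solution hA hA0 hconst
    refine ⟨A 0, hA0, fun h => absurd rfl h, fun _ => rfl, fun p => Complex.exp (E p), hE.cexp,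
      Complex.exp_ne_zero _, ?_⟩
    filter_upwards [hEe, hE.eventually (by simp)] with p h1 h2
    rw [(h2.differentiableAt (by simp)).hasFDerivAt.cexp.fderiv]
    simp only [smul_apply, smul_eq_mul]
    rw [← h1, zpow_neg_one]
    have := Complex.exp_ne_zero (E p)
    field_simp
  -- For constant A, a constant U with U^(e+1) = A(0) suffices. The exponent may be negative, hence
  -- the two cases for the root.
  · have he' : e + 1 ≠ 0 := fun h => he (by lia)
    have hroot : ∃ ρ : ℂ, ρ ^ (e + 1) = A 0 := by
      rcases lt_or_gt_of_ne he' with h | h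
      · obtain ⟨ρ, hρ⟩ := IsAlgClosed.exists_pow_nat_eq (A 0)⁻¹ (n := (-(e + 1)).toNat) (by lia)
        refine ⟨ρ, ?_⟩
        rw [← neg_neg (e + 1), zpow_neg, ← Int.toNat_of_nonneg (a := -(e + 1)) (by lia),
          zpow_natCast, hρ, inv_inv]
      · obtain ⟨ρ, hρ⟩ := IsAlgClosed.exists_pow_nat_eq (A 0) (n := (e + 1).toNat) (by lia)
        refine ⟨ρ, ?_⟩
        rw [← Int.toNat_of_nonneg (a := e + 1) (by lia), zpow_natCast, hρ]
    obtain ⟨ρ, hρ⟩ := hroot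
    have hρ0 : ρ ≠ 0 := by
      rintro rfl
      exact hA0 (by rw [← hρ, zero_zpow _ he'])
    refine ⟨1, one_ne_zero, fun _ => rfl, fun h => absurd h he, fun _ => ρ, contDiffAt_const,
      hρ0, ?_⟩
    filter_upwards [hconst] with p hp
    simp [hp, ← hρ, zpow_add_one₀ hρ0]

/-! ### Normal branches of F(t, s) = t^m η -/

/-- The implicit function theorem for a scalar equation, with local uniqueness. -/
theorem exists_implicit_function {Φ : (ℂ × ℂ) × ℂ → ℂ} {y₀ : ℂ} {n : WithTop ℕ∞} (hn : n ≠ 0)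
    (hΦ : ContDiffAt ℂ n Φ (0, y₀)) (h0 : Φ (0, y₀) = 0)
    (h1 : fderiv ℂ Φ (0, y₀) (0, 1) ≠ 0) :
    ∃ S : ℂ × ℂ → ℂ, ContDiffAt ℂ n S 0 ∧ S 0 = y₀ ∧ (∀ᶠ x in 𝓝 (0 : ℂ × ℂ), Φ (x, S x) = 0) ∧
      ∀ᶠ q in 𝓝 ((0 : ℂ × ℂ), y₀), Φ q = 0 → q.2 = S q.1 := by
  have hinv : (fderiv ℂ Φ (0, y₀) ∘L .inr ℂ (ℂ × ℂ) ℂ).IsInvertible := by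
    refine ⟨ContinuousLinearEquiv.unitsEquivAut ℂ (Units.mk0 _ h1), ?_⟩
    ext
    simp
  refine ⟨hΦ.implicitFunction hn hinv, hΦ.contDiffAt_implicitFunction hn hinv,
    hΦ.implicitFunction_apply_self hn hinv, ?_, ?_⟩
  · simpa [h0] using hΦ.eventually_apply_implicitFunction hn hinv
  · filter_upwards [hΦ.eventually_apply_eq_iff_implicitFunction hn hinv] with q hq h
    exact (hq.1 (h.trans h0.symm)).symm

/-- A branch `t = u υ (η, u)`, `s = σ (η, u)` of the curves `F (t, s) = t ^ m η` through `(0, c)`,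
in which `t ^ (e - m) s ^ k dt ∧ ds` becomes `- κ u ^ e dη ∧ du`. -/
structure NormalBranch (F : ℂ × ℂ → ℂ) (c : ℂ) (m : ℕ) (k e : ℤ) (κ : ℂ) (ε₀ : ℝ)
    (υ σ : ℂ × ℂ → ℂ) : Prop where
  contDiffAt_left : ∀ p ∈ ball (0 : ℂ × ℂ) ε₀, ContDiffAt ℂ 1 υ p
  contDiffAt_right : ∀ p ∈ ball (0 : ℂ × ℂ) ε₀, ContDiffAt ℂ 1 σ p
  left_ne_zero : ∀ p ∈ ball (0 : ℂ × ℂ) ε₀, υ p ≠ 0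
  right_ne_zero : ∀ p ∈ ball (0 : ℂ × ℂ) ε₀, σ p ≠ 0
  right_zero : ∀ p ∈ ball (0 : ℂ × ℂ) ε₀, σ (p.1, 0) = c
  equation : ∀ p ∈ ball (0 : ℂ × ℂ) ε₀, F (p.2 * υ p, σ p) = (p.2 * υ p) ^ m * p.1
  jacobian : ∀ p ∈ ball (0 : ℂ × ℂ) ε₀, p.2 ≠ 0 →
    (p.2 * υ p) ^ (e - m) * σ p ^ k *
      (fderiv ℂ (fun p => p.2 * υ p) p (1, 0) * fderiv ℂ σ p (0, 1) -
        fderiv ℂ (fun p => p.2 * υ p) p (0, 1) * fderiv ℂ σ p (1, 0)) = -(κ * p.2 ^ e)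
  inj : ∀ p ∈ ball (0 : ℂ × ℂ) ε₀, ∀ q ∈ ball (0 : ℂ × ℂ) ε₀, p.1 = q.1 →
    p.2 * υ p = q.2 * υ q → p = q
  cover : ∀ ε, 0 < ε → ε ≤ ε₀ → ∃ ρ > 0, ∀ η ∈ ball (0 : ℂ) ε, ∀ t s : ℂ, t ≠ 0 → ‖t‖ < ρ →
    ‖s - c‖ < ρ → F (t, s) = t ^ m * η →
      ∃ u ∈ ball (0 : ℂ) ε, u ≠ 0 ∧ u * υ (η, u) = t ∧ σ (η, u) = s

theorem NormalBranch.mono {F : ℂ × ℂ → ℂ} {c : ℂ} {m : ℕ} {k e : ℤ} {κ : ℂ} {ε₀ ε₁ : ℝ}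
    {υ σ : ℂ × ℂ → ℂ} (h : NormalBranch F c m k e κ ε₀ υ σ) (hε : ε₁ ≤ ε₀) :
    NormalBranch F c m k e κ ε₁ υ σ where
  contDiffAt_left p hp := h.contDiffAt_left p (ball_subset_ball hε hp)
  contDiffAt_right p hp := h.contDiffAt_right p (ball_subset_ball hε hp)
  left_ne_zero p hp := h.left_ne_zero p (ball_subset_ball hε hp)
  right_ne_zero p hp := h.right_ne_zero p (ball_subset_ball hε hp)
  right_zero p hp := h.right_zero p (ball_subset_ball hε hp)
  equation p hp := h.equation p (ball_subset_ball hε hp)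
  jacobian p hp := h.jacobian p (ball_subset_ball hε hp)
  inj p hp q hq := h.inj p (ball_subset_ball hε hp) q (ball_subset_ball hε hq)
  cover ε h0 h1 := h.cover ε h0 (h1.trans hε)

theorem mk_mem_ball_zero {x y : ℂ} {r : ℝ} :
    ((x, y) : ℂ × ℂ) ∈ ball (0 : ℂ × ℂ) r ↔ ‖x‖ < r ∧ ‖y‖ < r := by
  rw [mem_ball_zero_iff, Prod.norm_def, max_lt_iff]

/-- The solution `s = S (η, t)` of `F (t, s) = t ^ m η`. -/
theorem exists_root_branch {F : ℂ × ℂ → ℂ} {c : ℂ} {m : ℕ} (hm : m ≠ 0)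
    (hF : AnalyticAt ℂ F (0, c)) (h0 : F (0, c) = 0) (h1 : fderiv ℂ F (0, c) (0, 1) ≠ 0) :
    ∃ S : ℂ × ℂ → ℂ, AnalyticAt ℂ S 0 ∧ S 0 = c ∧ (∀ᶠ p in 𝓝 (0 : ℂ × ℂ), S (p.1, 0) = c) ∧
      (∀ᶠ p in 𝓝 (0 : ℂ × ℂ), F (p.2, S p) = p.2 ^ m * p.1) ∧
      (∀ᶠ q in 𝓝 ((0 : ℂ × ℂ), c), F (q.1.2, q.2) = q.1.2 ^ m * q.1.1 → q.2 = S q.1) := by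
  let Φ : (ℂ × ℂ) × ℂ → ℂ := fun q => F (q.1.2, q.2) - q.1.2 ^ m * q.1.1
  have h11 : AnalyticAt ℂ (fun q : (ℂ × ℂ) × ℂ => q.1.1) ((0 : ℂ × ℂ), c) :=
    AnalyticAt.comp (g := Prod.fst) (f := Prod.fst) analyticAt_fst analyticAt_fst
  have h12 : AnalyticAt ℂ (fun q : (ℂ × ℂ) × ℂ => q.1.2) ((0 : ℂ × ℂ), c) :=
    AnalyticAt.comp (g := Prod.snd) (f := Prod.fst) analyticAt_snd analyticAt_fst
  have hproj : AnalyticAt ℂ (fun q : (ℂ × ℂ) × ℂ => (q.1.2, q.2)) (0, c) := h12.prod analyticAt_snd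
  have hΦ : AnalyticAt ℂ Φ (0, c) :=
    (AnalyticAt.comp (g := F) (f := fun q : (ℂ × ℂ) × ℂ => (q.1.2, q.2)) hF hproj).sub
      ((h12.pow m).mul h11)
  -- On t = 0 the perturbation t^m η vanishes because m ≠ 0, so Φ and F have the same s-derivative.
  have hd : fderiv ℂ Φ (0, c) (0, 1) = fderiv ℂ F (0, c) (0, 1) := by
    have hline : HasDerivAt (fun y : ℂ => (((0 : ℂ × ℂ), y) : (ℂ × ℂ) × ℂ)) (0, 1) c :=
      (hasDerivAt_const c _).prodMk (hasDerivAt_id c)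
    have hline' : HasDerivAt (fun y : ℂ => ((0, y) : ℂ × ℂ)) (0, 1) c :=
      (hasDerivAt_const c _).prodMk (hasDerivAt_id c)
    have h2 := hΦ.differentiableAt.hasFDerivAt.comp_hasDerivAt c hline
    have h3 := hF.differentiableAt.hasFDerivAt.comp_hasDerivAt c hline'
    refine h2.unique (h3.congr_of_eventuallyEq (Eventually.of_forall fun y => ?_))
    simp [Φ, hm]
  obtain ⟨S, hS, hS0, hSe, hSu⟩ := exists_implicit_function (n := ⊤) WithTop.top_ne_zero
    hΦ.contDiffAt (by simp [Φ, h0, hm]) (by rw [hd]; exact h1)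
  refine ⟨S, analyticWithinAt_univ.1
    (contDiffWithinAt_omega_iff_analyticWithinAt.1 (contDiffWithinAt_univ.2 hS)), hS0, ?_, ?_, ?_⟩
  -- At t = 0 the value c solves the equation for every η, and local uniqueness identifies it with
  -- S.
  · have ht : Tendsto (fun p : ℂ × ℂ => (((p.1, 0) : ℂ × ℂ), c)) (𝓝 0) (𝓝 ((0 : ℂ × ℂ), c)) := by
      have : Continuous fun p : ℂ × ℂ => (((p.1, 0) : ℂ × ℂ), c) := by fun_prop
      exact this.tendsto 0
    filter_upwards [ht.eventually hSu] with p hp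
    exact (hp (by simp [Φ, h0, hm])).symm
  · filter_upwards [hSe] with p hp
    exact sub_eq_zero.1 hp
  · filter_upwards [hSu] with q hq h
    exact hq (sub_eq_zero.2 h)

/-- The solution `t = T (η, u)` of `t U (η, t) = u`. -/
theorem exists_inverse_coordinate {U : ℂ × ℂ → ℂ} (hU : ContDiffAt ℂ 1 U 0) (hU0 : U 0 ≠ 0) :
    ∃ T : ℂ × ℂ → ℂ, ContDiffAt ℂ 1 T 0 ∧ T 0 = 0 ∧
      (∀ᶠ p in 𝓝 (0 : ℂ × ℂ), T (p.1, 0) = 0) ∧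
      (∀ᶠ p in 𝓝 (0 : ℂ × ℂ), T p * U (p.1, T p) = p.2) ∧
      (∀ᶠ q in 𝓝 ((0 : ℂ × ℂ), (0 : ℂ)), q.2 * U (q.1.1, q.2) = q.1.2 → q.2 = T q.1) := by
  let Φ : (ℂ × ℂ) × ℂ → ℂ := fun q => q.2 * U (q.1.1, q.2) - q.1.2
  have hproj : ContDiffAt ℂ 1 (fun q : (ℂ × ℂ) × ℂ => (q.1.1, q.2)) (0, 0) := by fun_prop
  have hUc : ContDiffAt ℂ 1 (fun q : (ℂ × ℂ) × ℂ => U (q.1.1, q.2)) (0, 0) :=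
    ContDiffAt.comp (g := U) (f := fun q : (ℂ × ℂ) × ℂ => (q.1.1, q.2)) _ hU hproj
  have hΦ : ContDiffAt ℂ 1 Φ (0, 0) := (contDiffAt_snd.mul hUc).sub (by fun_prop)
  have hd : fderiv ℂ Φ (0, 0) (0, 1) = U 0 := by
    have hline : HasDerivAt (fun y : ℂ => (((0 : ℂ × ℂ), y) : (ℂ × ℂ) × ℂ)) (0, 1) 0 :=
      (hasDerivAt_const _ _).prodMk (hasDerivAt_id _)
    have h2 := (hΦ.differentiableAt (by simp)).hasFDerivAt.comp_hasDerivAt 0 hline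
    have h4 := (hUc.differentiableAt (by simp)).hasFDerivAt.comp_hasDerivAt 0 hline
    have h3 := (hasDerivAt_id (0 : ℂ)).mul h4
    refine (h2.unique (h3.congr_of_eventuallyEq (Eventually.of_forall fun y => ?_))).trans ?_
    · simp [Φ]
    · simp
      rfl
  obtain ⟨T, hT, hT0, hTe, hTu⟩ := exists_implicit_function (n := 1) (by simp) hΦ (by simp [Φ])
    (by rw [hd]; exact hU0)
  refine ⟨T, hT, hT0, ?_, ?_, ?_⟩
  · have ht : Tendsto (fun p : ℂ × ℂ => (((p.1, 0) : ℂ × ℂ), (0 : ℂ))) (𝓝 0)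
        (𝓝 ((0 : ℂ × ℂ), 0)) := by
      have : Continuous fun p : ℂ × ℂ => (((p.1, 0) : ℂ × ℂ), (0 : ℂ)) := by fun_prop
      exact this.tendsto 0
    filter_upwards [ht.eventually hTu] with p hp
    exact (hp (by simp [Φ])).symm
  · filter_upwards [hTe] with p hp
    exact sub_eq_zero.1 hp
  · filter_upwards [hTu] with q hq h
    exact hq (sub_eq_zero.2 h)

/-- Differentiating F(t, S) = t^m η in η gives F_s S_η = t^m, so on the branch t^(e−m) s^k dt ∧ ds =
−t^e A dη ∧ dt with A = S^k / F_s; a normal coordinate for A finishes. If e = −1, A is constant on t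
= 0 because S = c there. The second alternative of `he` serves only e < −1, where it makes A
constant. -/
theorem exists_normalBranch {F : ℂ × ℂ → ℂ} {c : ℂ} {m : ℕ} (hm : m ≠ 0)
    (hF : ∀ p : ℂ × ℂ, p.2 ≠ 0 → AnalyticAt ℂ F p) (hc : c ≠ 0) (h0 : F (0, c) = 0)
    (h1 : fderiv ℂ F (0, c) (0, 1) ≠ 0) (k e : ℤ)
    (he : -1 ≤ e ∨ ∃ C : ℂ, ∀ p : ℂ × ℂ, p.2 ≠ 0 → p.2 ^ k = C * fderiv ℂ F p (0, 1)) :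
    ∃ κ : ℂ, κ ≠ 0 ∧ (e ≠ -1 → κ = 1) ∧ (e = -1 → κ = c ^ k / fderiv ℂ F (0, c) (0, 1)) ∧
      ∃ ε₀ > 0, ∃ υ σ : ℂ × ℂ → ℂ, NormalBranch F c m k e κ ε₀ υ σ := by
  obtain ⟨S, hS, hS0, hSc, hSe, hSu⟩ := exists_root_branch hm (hF _ hc) h0 h1
  let Fs : ℂ × ℂ → ℂ := fun p => fderiv ℂ F p (0, 1)
  have hFs : ∀ p : ℂ × ℂ, p.2 ≠ 0 → AnalyticAt ℂ Fs p := fun p hp =>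
    (ContinuousLinearMap.analyticAt (ContinuousLinearMap.apply ℂ ℂ ((0, 1) : ℂ × ℂ)) _).comp
      (hF p hp).fderiv
  have hgr : AnalyticAt ℂ (fun p : ℂ × ℂ => (p.2, S p)) 0 := analyticAt_snd.prod hS
  have hgr0 : ((0 : ℂ × ℂ).2, S 0) = ((0, c) : ℂ × ℂ) := by rw [hS0]; rfl
  have hFsS : AnalyticAt ℂ (fun p : ℂ × ℂ => Fs (p.2, S p)) 0 :=
    AnalyticAt.comp (g := Fs) (f := fun p : ℂ × ℂ => (p.2, S p)) (by rw [hgr0]; exact hFs _ hc) hgr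
  have hFs0 : Fs ((0 : ℂ × ℂ).2, S 0) ≠ 0 := by rw [hgr0]; exact h1
  let A : ℂ × ℂ → ℂ := fun p => S p ^ k / Fs (p.2, S p)
  have hA : AnalyticAt ℂ A 0 := (hS.zpow (by rw [hS0]; exact hc)).div hFsS hFs0
  have hA0 : A 0 = c ^ k / Fs (0, c) := by simp only [A, hS0]; rfl
  have hSne : ∀ᶠ p in 𝓝 (0 : ℂ × ℂ), S p ≠ 0 :=
    hS.continuousAt.eventually_ne (by rw [hS0]; exact hc)
  have hFsne : ∀ᶠ p in 𝓝 (0 : ℂ × ℂ), Fs (p.2, S p) ≠ 0 :=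
    hFsS.continuousAt.eventually_ne hFs0
  obtain ⟨κ, hκ, hκ1, hκe, U, hU, hU0, hUe⟩ := exists_normal_coordinate hA
    (by rw [hA0]; exact div_ne_zero (zpow_ne_zero _ hc) h1) e (by
      by_cases h2 : 0 ≤ e
      · exact Or.inl h2
      by_cases h3 : e = -1
      · refine Or.inr (Or.inl ⟨h3, ?_⟩)
        filter_upwards [hSc] with p hp
        rw [hA0]
        simp only [A, hp]
      · refine Or.inr (Or.inr ⟨h3, ?_⟩)
        obtain ⟨C, hC⟩ := he.resolve_left (by lia)
        have h4 : A 0 = C := by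
          rw [hA0, hC (0, c) hc]
          exact mul_div_cancel_right₀ _ h1
        filter_upwards [hSne, hFsne] with p hp hp'
        rw [h4]
        simp only [A]
        rw [hC (p.2, S p) hp]
        exact mul_div_cancel_right₀ _ hp')
  refine ⟨κ, hκ, hκ1, fun h => (hκe h).trans hA0, ?_⟩
  obtain ⟨T, hT, hT0, hTz, hTe, hTu⟩ := exists_inverse_coordinate hU hU0
  have hG : ContDiffAt ℂ 1 (fun p : ℂ × ℂ => (p.1, T p)) 0 := contDiffAt_fst.prodMk hT
  have hG0 : ((0 : ℂ × ℂ).1, T 0) = (0 : ℂ × ℂ) := by rw [hT0]; rfl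
  have hGt : Tendsto (fun p : ℂ × ℂ => (p.1, T p)) (𝓝 0) (𝓝 0) := by
    have := hG.continuousAt.tendsto
    rwa [hG0] at this
  have hSF : ∀ᶠ x in 𝓝 (0 : ℂ × ℂ), S x ≠ 0 ∧ Fs (x.2, S x) ≠ 0 ∧ ContDiffAt ℂ 1 S x ∧
      ContDiffAt ℂ 1 U x ∧ U x ≠ 0 ∧ (∀ᶠ y in 𝓝 x, F (y.2, S y) = y.2 ^ m * y.1) ∧
      κ * U x ^ e * (U x + x.2 * fderiv ℂ U x (0, 1)) = A x ∧ ‖U x‖ < ‖U 0‖ + 1 := by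
    filter_upwards [hSne, hFsne, hS.contDiffAt.eventually (n := 1) (by simp),
      hU.eventually (by simp), hU.continuousAt.eventually_ne hU0, hSe.eventually_nhds, hUe,
      hU.continuousAt.norm.eventually_lt_const (lt_add_one _)] with x a1 a2 a3 a4 a5 a6 a7 a8
    exact ⟨a1, a2, a3, a4, a5, a6, a7, a8⟩
  obtain ⟨r₁, hr₁, hb₁⟩ := Metric.eventually_nhds_iff_ball.1
    (((hGt.eventually hSF).and hSF).and ((hT.eventually (by simp)).and (hTe.and (hTz.and hSc))))
  obtain ⟨r₂, hr₂, hb₂⟩ := Metric.eventually_nhds_iff_ball.1 hSu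
  obtain ⟨r₃, hr₃, hb₃⟩ := Metric.eventually_nhds_iff_ball.1 hTu
  refine ⟨min r₁ (min r₂ r₃), lt_min hr₁ (lt_min hr₂ hr₃), fun p => (U (p.1, T p))⁻¹,
    fun p => S (p.1, T p), ?_⟩
  have hball : ∀ p ∈ ball (0 : ℂ × ℂ) (min r₁ (min r₂ r₃)), p ∈ ball (0 : ℂ × ℂ) r₁ := fun p hp =>
    ball_subset_ball (min_le_left _ _) hp
  have hTυ : ∀ p ∈ ball (0 : ℂ × ℂ) r₁, p.2 * (U (p.1, T p))⁻¹ = T p := by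
    intro p hp
    obtain ⟨⟨⟨_, _, _, _, a5, _⟩, _⟩, _, b2, _⟩ := hb₁ p hp
    rw [← b2]; exact mul_inv_cancel_right₀ a5 _
  have hGd : ∀ p ∈ ball (0 : ℂ × ℂ) r₁, ContDiffAt ℂ 1 (fun p : ℂ × ℂ => (p.1, T p)) p :=
    fun p hp => contDiffAt_fst.prodMk (hb₁ p hp).2.1
  refine ⟨fun p hp => ?_, fun p hp => ?_, fun p hp => ?_, fun p hp => ?_, fun p hp => ?_,
    fun p hp => ?_, fun p hp hp2 => ?_, fun p hp q hq h2 h3 => ?_, fun ε hε hεr => ?_⟩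
  · obtain ⟨⟨⟨_, _, _, a4, a5, _⟩, _⟩, _⟩ := hb₁ p (hball p hp)
    exact (ContDiffAt.comp (g := U) (f := fun p : ℂ × ℂ => (p.1, T p)) p a4
      (hGd p (hball p hp))).inv a5
  · obtain ⟨⟨⟨_, _, a3, _⟩, _⟩, _⟩ := hb₁ p (hball p hp)
    exact ContDiffAt.comp (g := S) (f := fun p : ℂ × ℂ => (p.1, T p)) p a3 (hGd p (hball p hp))
  · exact inv_ne_zero (hb₁ p (hball p hp)).1.1.2.2.2.2.1
  · exact (hb₁ p (hball p hp)).1.1.1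
  · obtain ⟨_, _, _, b3, b4⟩ := hb₁ p (hball p hp)
    simp only [b3, b4]
  · obtain ⟨⟨⟨_, _, _, _, _, a6, _⟩, _⟩, _⟩ := hb₁ p (hball p hp)
    simp only [hTυ p (hball p hp)]
    exact a6.self_of_nhds
  · have hp1 := hball p hp
    obtain ⟨⟨⟨a1, a2, a3, a4, a5, a6, a7, _⟩, _⟩, b1, b2, _⟩ := hb₁ p hp1
    have hnear : ∀ᶠ q in 𝓝 p, q ∈ ball (0 : ℂ × ℂ) r₁ := isOpen_ball.mem_nhds hp1
    have hTeq : (fun p : ℂ × ℂ => p.2 * (U (p.1, T p))⁻¹) =ᶠ[𝓝 p] T := by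
      filter_upwards [hnear] with q hq using hTυ q hq
    rw [hTeq.fderiv_eq, hTυ p hp1]
    set x : ℂ × ℂ := (p.1, T p) with hx
    have hTd : HasFDerivAt T (fderiv ℂ T p) p := (b1.differentiableAt (by simp)).hasFDerivAt
    have hGd' : HasFDerivAt (fun p : ℂ × ℂ => (p.1, T p))
        ((ContinuousLinearMap.fst ℂ ℂ ℂ).prod (fderiv ℂ T p)) p := hasFDerivAt_fst.prodMk hTd
    have hSd : HasFDerivAt S (fderiv ℂ S x) x := (a3.differentiableAt (by simp)).hasFDerivAt
    have hUd : HasFDerivAt U (fderiv ℂ U x) x := (a4.differentiableAt (by simp)).hasFDerivAt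
    have hσ : HasFDerivAt (fun p => S (p.1, T p)) ((fderiv ℂ S x).comp
        ((ContinuousLinearMap.fst ℂ ℂ ℂ).prod (fderiv ℂ T p))) p :=
      HasFDerivAt.comp (g := S) (f := fun p : ℂ × ℂ => (p.1, T p)) p hSd hGd'
    have hUG : HasFDerivAt (fun p => U (p.1, T p)) ((fderiv ℂ U x).comp
        ((ContinuousLinearMap.fst ℂ ℂ ℂ).prod (fderiv ℂ T p))) p :=
      HasFDerivAt.comp (g := U) (f := fun p : ℂ × ℂ => (p.1, T p)) p hUd hGd'
    have hlin : ∀ (L : ℂ × ℂ →L[ℂ] ℂ) (y z : ℂ), L (y, z) = y * L (1, 0) + z * L (0, 1) := by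
      intro L y z
      have : ((y, z) : ℂ × ℂ) = y • (1, 0) + z • (0, 1) := by simp
      rw [this, map_add, map_smul, map_smul, smul_eq_mul, smul_eq_mul]
    -- differentiating `T U = u` in the direction of `u`
    have hTU : fderiv ℂ T p (0, 1) * (U x + T p * fderiv ℂ U x (0, 1)) = 1 := by
      have h2 := (hTd.mul hUG).congr_of_eventuallyEq (f₁ := fun q : ℂ × ℂ => q.2) (by
        filter_upwards [hnear] with q hq using (hb₁ q hq).2.2.1.symm)
      have h3 := DFunLike.congr_fun (h2.unique hasFDerivAt_snd) ((0, 1) : ℂ × ℂ)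
      simp only [add_apply, smul_apply, ContinuousLinearMap.comp_apply,
        ContinuousLinearMap.prod_apply, ContinuousLinearMap.coe_fst', smul_eq_mul,
        ContinuousLinearMap.coe_snd'] at h3
      rw [hlin (fderiv ℂ U x)] at h3
      linear_combination h3
    -- differentiating `F (t, S) = t ^ m η` in the direction of `η`
    have hFS : Fs (x.2, S x) * fderiv ℂ S x (1, 0) = x.2 ^ m := by
      have hFd : HasFDerivAt F (fderiv ℂ F (x.2, S x)) (x.2, S x) :=
        (hF _ a1).differentiableAt.hasFDerivAt
      have hgd : HasFDerivAt (fun y : ℂ × ℂ => (y.2, S y))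
          ((ContinuousLinearMap.snd ℂ ℂ ℂ).prod (fderiv ℂ S x)) x := hasFDerivAt_snd.prodMk hSd
      have h2 := HasFDerivAt.comp (g := F) (f := fun y : ℂ × ℂ => (y.2, S y)) x hFd hgd
      have hfst : HasFDerivAt (fun y : ℂ × ℂ => y.1) (ContinuousLinearMap.fst ℂ ℂ ℂ) x :=
        hasFDerivAt_fst
      have hsnd : HasFDerivAt (fun y : ℂ × ℂ => y.2) (ContinuousLinearMap.snd ℂ ℂ ℂ) x :=
        hasFDerivAt_snd
      have h3 := (hsnd.pow m).mul hfst
      have h4 := DFunLike.congr_fun ((h2.congr_of_eventuallyEq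
        (f₁ := fun y : ℂ × ℂ => y.2 ^ m * y.1)
        (a6.mono fun y hy => hy.symm)).unique h3) ((1, 0) : ℂ × ℂ)
      simp only [add_apply, smul_apply, ContinuousLinearMap.comp_apply,
        ContinuousLinearMap.prod_apply, ContinuousLinearMap.coe_fst', smul_eq_mul,
        ContinuousLinearMap.coe_snd', mul_zero, add_zero, mul_one] at h4
      rw [hlin (fderiv ℂ F _)] at h4
      simpa [mul_comm, Fs] using h4
    rw [hσ.fderiv]
    simp only [ContinuousLinearMap.comp_apply, ContinuousLinearMap.prod_apply,
      ContinuousLinearMap.coe_fst']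
    rw [hlin (fderiv ℂ S x) 0 (fderiv ℂ T p (0, 1)), hlin (fderiv ℂ S x) 1 (fderiv ℂ T p (1, 0))]
    have hTne : T p ≠ 0 := by
      intro h
      rw [h, zero_mul] at b2
      exact hp2 b2.symm
    have hS1 : fderiv ℂ S x (1, 0) = T p ^ m / Fs (x.2, S x) := by
      rw [eq_div_iff a2, mul_comm]; exact hFS
    have hA7 : S x ^ k = κ * U x ^ e * (U x + T p * fderiv ℂ U x (0, 1)) * Fs (x.2, S x) := by
      rw [show T p = x.2 from rfl, a7]
      exact (div_mul_cancel₀ _ a2).symm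
    have hu : p.2 ^ e = T p ^ e * U x ^ e := by rw [← b2, mul_zpow]
    -- The terms with ∂S/∂t cancel in the determinant, leaving −T_u S_η. Here S_η = T^m / F_s, and
    -- T_u is the reciprocal of the factor U + T U_t supplied by the normal coordinate.
    rw [hu, hA7, hS1, zpow_sub₀ hTne, zpow_natCast]
    have hTm : T p ^ m ≠ 0 := pow_ne_zero _ hTne
    field_simp
    linear_combination (-T p ^ m) * hTU
  · rw [hTυ p (hball p hp), hTυ q (hball q hq)] at h3
    have h4 := (hb₁ p (hball p hp)).2.2.1
    have h5 := (hb₁ q (hball q hq)).2.2.1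
    exact Prod.ext h2 (by rw [← h4, ← h5, h2, h3])
  · have hM : 0 < ‖U 0‖ + 1 := by positivity
    -- The second bound keeps u = t U(η, t) in the ε-disc, since ‖U‖ < ‖U 0‖ + 1 on the ball in use.
    refine ⟨min ε (ε / (‖U 0‖ + 1)), lt_min hε (div_pos hε hM), ?_⟩
    intro η hη t s ht htρ hsρ hFt
    rw [mem_ball_zero_iff] at hη
    have hεr1 : ε ≤ r₁ := hεr.trans (min_le_left _ _)
    have hεr2 : ε ≤ r₂ := hεr.trans ((min_le_right _ _).trans (min_le_left _ _))
    have hεr3 : ε ≤ r₃ := hεr.trans ((min_le_right _ _).trans (min_le_right _ _))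
    have htε : ‖t‖ < ε := htρ.trans_le (min_le_left _ _)
    have hsε : ‖s - c‖ < ε := hsρ.trans_le (min_le_left _ _)
    have hs : s = S (η, t) := hb₂ ((η, t), s) (by
      rw [mem_ball_iff_norm, Prod.mk_sub_mk, Prod.norm_def, sub_zero, Prod.norm_def]
      exact max_lt (max_lt (hη.trans_le hεr2) (htε.trans_le hεr2)) (hsε.trans_le hεr2)) hFt
    have hηt : ((η, t) : ℂ × ℂ) ∈ ball (0 : ℂ × ℂ) r₁ :=
      mk_mem_ball_zero.2 ⟨hη.trans_le hεr1, htε.trans_le hεr1⟩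
    obtain ⟨⟨_, _, _, _, _, a5, _, _, a8⟩, _⟩ := hb₁ _ hηt
    have hu : ‖t * U (η, t)‖ < ε := by
      rw [norm_mul]
      calc ‖t‖ * ‖U (η, t)‖ ≤ ‖t‖ * (‖U 0‖ + 1) := by gcongr
        _ < ε / (‖U 0‖ + 1) * (‖U 0‖ + 1) := by
          gcongr; exact htρ.trans_le (min_le_right _ _)
        _ = ε := div_mul_cancel₀ _ hM.ne'
    have hTt : t = T (η, t * U (η, t)) := hb₃ ((η, t * U (η, t)), t) (by
      change _ ∈ ball (0 : (ℂ × ℂ) × ℂ) r₃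
      rw [mem_ball_zero_iff, Prod.norm_def,
        Prod.norm_def]
      exact max_lt (max_lt (hη.trans_le hεr3) (hu.trans_le hεr3)) (htε.trans_le hεr3)) rfl
    refine ⟨t * U (η, t), mem_ball_zero_iff.2 hu, mul_ne_zero ht a5, ?_, ?_⟩
    · have := hTυ (η, t * U (η, t)) (mk_mem_ball_zero.2 ⟨hη.trans_le hεr1, hu.trans_le hεr1⟩)
      exact this.trans hTt.symm
    · show S (η, T (η, t * U (η, t))) = s
      rw [← hTt, hs]

/-! ### Monomial charts and the embeddings they produce -/

/-- A `C¹` injective map with nowhere vanishing Jacobian is a holomorphic embedding, and open. -/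
theorem isHolomorphicEmbedding_of_pullback {F : ℂ × ℂ → ℂ × ℂ} {U : Set (ℂ × ℂ)} (hU : IsOpen U)
    (hF : ∀ p ∈ U, ContDiffAt ℂ 1 F p) (hinj : Set.InjOn F U) {D : ℂ × ℂ → ℂ}
    (hD : ∀ p ∈ U, D p ≠ 0)
    (hpull : ∀ p ∈ U, ∀ a b, pullbackStdForm F p a b = D p * stdForm a b) :
    IsHolomorphicEmbedding F U ∧ ∀ V ⊆ U, IsOpen V → IsOpen (F '' V) := by
  have hfinj : ∀ p ∈ U, Function.Injective (fderiv ℂ F p) := by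
    intro p hp
    rw [injective_iff_map_eq_zero]
    intro v hv
    have h1 := hpull p hp v (0, 1)
    have h2 := hpull p hp v (1, 0)
    simp only [pullbackStdForm, hv, stdForm, Prod.fst_zero, Prod.snd_zero, zero_mul, sub_zero,
      mul_one, mul_zero, zero_sub, mul_neg, zero_eq_mul, zero_eq_neg] at h1 h2
    simp only [hD p hp, false_or, mul_eq_zero] at h1 h2
    exact Prod.ext h1 h2
  have hnhds : ∀ p ∈ U, map F (𝓝 p) = 𝓝 (F p) := by
    intro p hp
    have hs := (hF p hp).hasStrictFDerivAt (by simp)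
    refine hs.map_nhds_eq_of_surj ?_
    exact LinearMap.range_eq_top.2 (LinearMap.injective_iff_surjective.1 (hfinj p hp))
  have hopen : ∀ V ⊆ U, IsOpen V → IsOpen (F '' V) := by
    intro V hVU hV
    rw [isOpen_iff_mem_nhds]
    rintro _ ⟨p, hp, rfl⟩
    rw [← hnhds p (hVU hp)]
    exact image_mem_map (hV.mem_nhds hp)
  have hcont : ContinuousOn F U := fun p hp => (hF p hp).continuousAt.continuousWithinAt
  refine ⟨⟨fun p hp => ((hF p hp).differentiableAt (by simp)).differentiableWithinAt, hfinj, ?_⟩,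
    hopen⟩
  refine (Topology.IsOpenEmbedding.of_continuous_injective_isOpenMap
    (continuousOn_iff_continuous_domRestrict.1 hcont) (Set.injOn_iff_injective.1 hinj)
    ?_).isEmbedding
  intro V hV
  have : U.domRestrict F '' V = F '' ((↑) '' V) := by
    rw [Set.image_image]; rfl
  rw [this]
  exact hopen _ (Subtype.coe_image_subset _ _) (hU.isOpenMap_subtype_val V hV)

/-- The monomial chart with exponents `(-α, a)` and `(-β, b)`. -/
def monomialChart (α β a b : ℤ) (t s : ℂ) : ℂ × ℂ := (t ^ (-α) * s ^ a, t ^ (-β) * s ^ b)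

theorem monomialChart_mem_torus {α β a b : ℤ} {t s : ℂ} (ht : t ≠ 0) (hs : s ≠ 0) :
    monomialChart α β a b t s ∈ torus :=
  ⟨mul_ne_zero (zpow_ne_zero _ ht) (zpow_ne_zero _ hs),
    mul_ne_zero (zpow_ne_zero _ ht) (zpow_ne_zero _ hs)⟩

theorem monomial_monomialChart {α β a b : ℤ} {t s : ℂ} (ht : t ≠ 0) (hs : s ≠ 0) (i j : ℤ) :
    (monomialChart α β a b t s).1 ^ i * (monomialChart α β a b t s).2 ^ j =
      t ^ (-(α * i + β * j)) * s ^ (a * i + b * j) := by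
  simp only [monomialChart]
  rw [mul_zpow, mul_zpow, ← zpow_mul, ← zpow_mul, ← zpow_mul, ← zpow_mul, zpow_add₀ hs,
    neg_add, zpow_add₀ ht, neg_mul, neg_mul]
  ring

/-- The exponent matrix of the chart has determinant −1, so it is invertible over ℤ, and t and s are
Laurent monomials in z and w. -/
theorem monomialChart_left {α β a b : ℤ} (hdet : α * b - β * a = 1) {t s : ℂ} (ht : t ≠ 0)
    (hs : s ≠ 0) :
    (monomialChart α β a b t s).1 ^ (-b) * (monomialChart α β a b t s).2 ^ a = t := by
  rw [monomial_monomialChart ht hs, show -(α * -b + β * a) = 1 by linarith,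
    show a * -b + b * a = 0 by ring]
  simp

theorem monomialChart_right {α β a b : ℤ} (hdet : α * b - β * a = 1) {t s : ℂ} (ht : t ≠ 0)
    (hs : s ≠ 0) :
    (monomialChart α β a b t s).1 ^ (-β) * (monomialChart α β a b t s).2 ^ α = s := by
  rw [monomial_monomialChart ht hs, show -(α * -β + β * α) = 0 by ring,
    show a * -β + b * α = 1 by linarith]
  simp

theorem monomialChart_inverse {α β a b : ℤ} (hdet : α * b - β * a = 1) {z w : ℂ} (hz : z ≠ 0)
    (hw : w ≠ 0) :
    monomialChart α β a b (z ^ (-b) * w ^ a) (z ^ (-β) * w ^ α) = (z, w) := by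
  have h : ∀ i j k l : ℤ, (z ^ i * w ^ j) ^ k * (z ^ (-β) * w ^ α) ^ l =
      z ^ (i * k + -β * l) * w ^ (j * k + α * l) := by
    intro i j k l
    rw [mul_zpow, mul_zpow, ← zpow_mul, ← zpow_mul, ← zpow_mul, ← zpow_mul, zpow_add₀ hz,
      zpow_add₀ hw]
    ring
  simp only [monomialChart, h]
  rw [show -b * -α + -β * a = 1 by linarith, show a * -α + α * a = 0 by ring,
    show -b * -β + -β * b = 0 by ring, show a * -β + α * b = 1 by linarith]
  simp

/-- The Laurent polynomial `t ^ m g (z, w)` in the coordinates of a monomial chart. -/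
def chartPoly (g : MvPolynomial (Fin 2) ℂ) (α β a b m : ℤ) (p : ℂ × ℂ) : ℂ :=
  ∑ x ∈ g.support, g.coeff x * p.1 ^ (m - (α * x 0 + β * x 1)) * p.2 ^ (a * x 0 + b * x 1)

theorem evalAt_eq_sum (g : MvPolynomial (Fin 2) ℂ) (p : ℂ × ℂ) :
    evalAt g p = ∑ x ∈ g.support, g.coeff x * (p.1 ^ (x 0 : ℤ) * p.2 ^ (x 1 : ℤ)) := by
  rw [evalAt, MvPolynomial.eval_eq']
  simp [Fin.prod_univ_two]

theorem evalAt_monomialChart (g : MvPolynomial (Fin 2) ℂ) {α β a b m : ℤ} {t s : ℂ} (ht : t ≠ 0)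
    (hs : s ≠ 0) :
    evalAt g (monomialChart α β a b t s) = t ^ (-m) * chartPoly g α β a b m (t, s) := by
  rw [evalAt_eq_sum, chartPoly, Finset.mul_sum]
  refine Finset.sum_congr rfl fun x _ => ?_
  have h : t ^ (-m) * t ^ m = 1 := by rw [← zpow_add₀ ht, neg_add_cancel, zpow_zero]
  rw [monomial_monomialChart ht hs, sub_eq_add_neg, zpow_add₀ ht]
  linear_combination (-(g.coeff x * t ^ (-(α * x 0 + β * x 1)) * s ^ (a * x 0 + b * x 1))) * h

/-- The bound on the weights leaves only non-negative powers of t, so the function extends across t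
= 0, the end at infinity. -/
theorem analyticAt_chartPoly {g : MvPolynomial (Fin 2) ℂ} {α β a b m : ℤ}
    (hmax : ∀ x ∈ g.support, α * x 0 + β * x 1 ≤ m) {p : ℂ × ℂ} (hp : p.2 ≠ 0) :
    AnalyticAt ℂ (chartPoly g α β a b m) p := by
  unfold chartPoly
  refine Finset.analyticAt_fun_sum _ fun x hx => ?_
  exact (analyticAt_const.mul (analyticAt_fst.zpow_nonneg (sub_nonneg.2 (hmax x hx)))).mul
    (analyticAt_snd.zpow hp)

/-- The branch of a normal form in a monomial chart. -/
def branchMap (α β a b : ℤ) (υ σ : ℂ × ℂ → ℂ) (p : ℂ × ℂ) : ℂ × ℂ :=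
  monomialChart α β a b (p.2 * υ p) (σ p)

/-- The rescaled branch. -/
def branchHat (α β a b : ℤ) (υ σ : ℂ × ℂ → ℂ) (p : ℂ × ℂ) : ℂ × ℂ :=
  monomialChart α β a b (υ p) (σ p)

theorem hasFDerivAt_zpow_mul_zpow {T σ : ℂ × ℂ → ℂ} {T' σ' : ℂ × ℂ →L[ℂ] ℂ} {p : ℂ × ℂ}
    (hT : HasFDerivAt T T' p) (hσ : HasFDerivAt σ σ' p) (hTp : T p ≠ 0) (hσp : σ p ≠ 0)
    (i j : ℤ) :
    HasFDerivAt (fun q => T q ^ i * σ q ^ j)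
      ((T p ^ i * σ p ^ j) • ((i / T p) • T' + (j / σ p) • σ')) p := by
  have h1 := (hasDerivAt_zpow i (T p) (Or.inl hTp)).comp_hasFDerivAt p hT
  have h2 := (hasDerivAt_zpow j (σ p) (Or.inl hσp)).comp_hasFDerivAt p hσ
  refine (h1.mul h2).congr_fderiv ?_
  ext <;>
  · simp only [ContinuousLinearMap.comp_apply, add_apply, smul_apply, smul_eq_mul,
      Function.comp, zpow_sub_one₀ hTp, zpow_sub_one₀ hσp]
    field_simp
    ring

/-- In logarithmic form dz/z = −α dT/T + a dσ/σ and dw/w = −β dT/T + b dσ/σ. The wedge of the two is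
the determinant −1 times dT/T ∧ dσ/σ, and multiplying by zw gives the powers. -/
theorem pullbackStdForm_monomialChart {α β a b : ℤ} (hdet : α * b - β * a = 1)
    {T σ : ℂ × ℂ → ℂ} {T' σ' : ℂ × ℂ →L[ℂ] ℂ} {p : ℂ × ℂ}
    (hT : HasFDerivAt T T' p) (hσ : HasFDerivAt σ σ' p) (hTp : T p ≠ 0) (hσp : σ p ≠ 0)
    (v w : ℂ × ℂ) :
    pullbackStdForm (fun q => monomialChart α β a b (T q) (σ q)) p v w =
      -(T p ^ (-α - β - 1) * σ p ^ (a + b - 1) *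
        (T' (1, 0) * σ' (0, 1) - T' (0, 1) * σ' (1, 0))) * stdForm v w := by
  have h := (hasFDerivAt_zpow_mul_zpow hT hσ hTp hσp (-α) a).prodMk
    (hasFDerivAt_zpow_mul_zpow hT hσ hTp hσp (-β) b)
  have hlin : ∀ (L : ℂ × ℂ →L[ℂ] ℂ) (v : ℂ × ℂ), L v = v.1 * L (1, 0) + v.2 * L (0, 1) := by
    intro L v
    have : v = v.1 • ((1, 0) : ℂ × ℂ) + v.2 • (0, 1) := by simp
    conv_lhs => rw [this]
    rw [map_add, map_smul, map_smul, smul_eq_mul, smul_eq_mul]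
  have hdet' : (α : ℂ) * b - β * a = 1 := by exact_mod_cast hdet
  unfold pullbackStdForm
  have h' : fderiv ℂ (fun q => monomialChart α β a b (T q) (σ q)) p = _ := h.fderiv
  rw [h']
  simp only [stdForm, ContinuousLinearMap.prod_apply, add_apply, smul_apply, smul_eq_mul]
  rw [hlin T' v, hlin T' w, hlin σ' v, hlin σ' w, zpow_sub_one₀ hTp, zpow_sub_one₀ hσp,
    show -α - β = -α + -β by ring, zpow_add₀ hTp, zpow_add₀ hσp]
  push_cast
  field_simp
  linear_combination (-(v.1 * w.2 - v.2 * w.1)) * (T p * σ p) *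
    (T' (1, 0) * σ' (0, 1) - T' (0, 1) * σ' (1, 0)) * hdet'

theorem contDiffAt_monomialChart (α β a b : ℤ) {T σ : ℂ × ℂ → ℂ} {p : ℂ × ℂ}
    (hT : ContDiffAt ℂ 1 T p) (hσ : ContDiffAt ℂ 1 σ p) (hTp : T p ≠ 0) (hσp : σ p ≠ 0) :
    ContDiffAt ℂ 1 (fun q => monomialChart α β a b (T q) (σ q)) p := by
  have hz : ∀ (n : ℤ) (x : ℂ), x ≠ 0 → ContDiffAt ℂ 1 (fun x : ℂ => x ^ n) x := fun n x hx =>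
    (analyticAt_id.zpow hx).contDiffAt
  exact (((hz _ _ hTp).comp p hT).mul ((hz _ _ hσp).comp p hσ)).prodMk
    (((hz _ _ hTp).comp p hT).mul ((hz _ _ hσp).comp p hσ))

theorem mem_puncturedBidisc {ξ₀ : ℂ} {ε δ : ℝ} {p : ℂ × ℂ} :
    p ∈ puncturedBidisc ξ₀ ε δ ↔ ‖p.1 - ξ₀‖ < ε ∧ ‖p.2‖ < δ ∧ p.2 ≠ 0 := by
  simp only [puncturedBidisc, Set.mem_prod, Set.mem_sdiff, mem_ball_iff_norm, sub_zero,
    Set.mem_singleton_iff]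

theorem isOpen_puncturedBidisc (ξ₀ : ℂ) (ε δ : ℝ) : IsOpen (puncturedBidisc ξ₀ ε δ) :=
  isOpen_ball.prod (isOpen_ball.sdiff isClosed_singleton)

theorem sub_mem_ball_iff {ξ₀ : ℂ} {ε : ℝ} {p : ℂ × ℂ} :
    p - (ξ₀, 0) ∈ ball (0 : ℂ × ℂ) ε ↔ ‖p.1 - ξ₀‖ < ε ∧ ‖p.2‖ < ε := by
  rw [mem_ball_zero_iff, Prod.norm_def, max_lt_iff]; simp

theorem evalAt_sub_C (f : MvPolynomial (Fin 2) ℂ) (ξ₀ : ℂ) (p : ℂ × ℂ) :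
    evalAt (f - MvPolynomial.C ξ₀) p = evalAt f p - ξ₀ := by
  simp [evalAt]

theorem norm_fst_le_normC2 (p : ℂ × ℂ) : ‖p.1‖ ≤ normC2 p :=
  Real.le_sqrt_of_sq_le (by nlinarith [sq_nonneg ‖p.2‖])

theorem norm_snd_le_normC2 (p : ℂ × ℂ) : ‖p.2‖ ≤ normC2 p :=
  Real.le_sqrt_of_sq_le (by nlinarith [sq_nonneg ‖p.1‖])

theorem lt_norm_zpow_mul {M r : ℝ} (hr : 0 < r) {α : ℤ} (hα : 1 ≤ α) {u x : ℂ} (hu : u ≠ 0)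
    (hu' : ‖u‖ < min 1 (r / (|M| + 1))) (hx : r ≤ ‖x‖) : M < ‖u ^ (-α) * x‖ := by
  have hu0 : 0 < ‖u‖ := norm_pos_iff.2 hu
  have hM : 0 < |M| + 1 := by positivity
  have h1 : ‖u‖⁻¹ ≤ ‖u ^ (-α)‖ := by
    rw [norm_zpow, zpow_neg]
    have : ‖u‖ ^ α ≤ ‖u‖ := by
      have := zpow_le_zpow_right_of_le_one₀ hu0 (hu'.le.trans (min_le_left _ _)) hα
      simpa using this
    gcongr
  have h2 : ‖u‖ * (|M| + 1) < r := by
    rw [← lt_div_iff₀ hM]; exact hu'.trans_le (min_le_right _ _)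
  rw [norm_mul]
  calc M ≤ |M| := le_abs_self M
    _ < |M| + 1 := lt_add_one _
    _ < r / ‖u‖ := by rw [lt_div_iff₀ hu0, mul_comm]; exact h2
    _ = ‖u‖⁻¹ * r := by ring
    _ ≤ _ := by gcongr

section Branch

variable {F : ℂ × ℂ → ℂ} {c : ℂ} {m : ℕ} {α β a b k e : ℤ} {κ : ℂ} {ε : ℝ} {υ σ : ℂ × ℂ → ℂ}

theorem NormalBranch.left_coord_ne_zero (h : NormalBranch F c m k e κ ε υ σ) {p : ℂ × ℂ}
    (hp : p ∈ ball (0 : ℂ × ℂ) ε) (hp2 : p.2 ≠ 0) : p.2 * υ p ≠ 0 :=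
  mul_ne_zero hp2 (h.left_ne_zero p hp)

theorem NormalBranch.contDiffAt_branchMap (h : NormalBranch F c m k e κ ε υ σ) {p : ℂ × ℂ}
    (hp : p ∈ ball (0 : ℂ × ℂ) ε) (hp2 : p.2 ≠ 0) :
    ContDiffAt ℂ 1 (branchMap α β a b υ σ) p :=
  contDiffAt_monomialChart α β a b (contDiffAt_snd.mul (h.contDiffAt_left p hp))
    (h.contDiffAt_right p hp) (h.left_coord_ne_zero hp hp2) (h.right_ne_zero p hp)

theorem NormalBranch.contDiffAt_branchHat (h : NormalBranch F c m k e κ ε υ σ) {p : ℂ × ℂ}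
    (hp : p ∈ ball (0 : ℂ × ℂ) ε) : ContDiffAt ℂ 1 (branchHat α β a b υ σ) p :=
  contDiffAt_monomialChart α β a b (h.contDiffAt_left p hp)
    (h.contDiffAt_right p hp) (h.left_ne_zero p hp) (h.right_ne_zero p hp)

theorem NormalBranch.pullback_branchMap (hdet : α * b - β * a = 1)
    (h : NormalBranch F c m (a + b - 1) (m - α - β - 1) κ ε υ σ) {p : ℂ × ℂ}
    (hp : p ∈ ball (0 : ℂ × ℂ) ε) (hp2 : p.2 ≠ 0) (v w : ℂ × ℂ) :
    pullbackStdForm (branchMap α β a b υ σ) p v w =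
      κ * p.2 ^ ((m : ℤ) - α - β - 1) * stdForm v w := by
  have hT : HasFDerivAt (fun p : ℂ × ℂ => p.2 * υ p) (fderiv ℂ (fun p => p.2 * υ p) p) p :=
    ((contDiffAt_snd.mul (h.contDiffAt_left p hp)).differentiableAt (by simp)).hasFDerivAt
  have hσ := ((h.contDiffAt_right p hp).differentiableAt (by simp)).hasFDerivAt
  have h1 := pullbackStdForm_monomialChart hdet hT hσ (h.left_coord_ne_zero hp hp2)
    (h.right_ne_zero p hp) v w
  have h2 := h.jacobian p hp hp2
  rw [show (m : ℤ) - α - β - 1 - m = -α - β - 1 by ring] at h2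
  rw [h2, neg_neg] at h1
  exact h1

theorem branchMap_mem_torus (h : NormalBranch F c m k e κ ε υ σ) {p : ℂ × ℂ}
    (hp : p ∈ ball (0 : ℂ × ℂ) ε) (hp2 : p.2 ≠ 0) : branchMap α β a b υ σ p ∈ torus :=
  monomialChart_mem_torus (h.left_coord_ne_zero hp hp2) (h.right_ne_zero p hp)

theorem evalAt_branchMap {g : MvPolynomial (Fin 2) ℂ}
    (h : NormalBranch (chartPoly g α β a b m) c m k e κ ε υ σ) {p : ℂ × ℂ}
    (hp : p ∈ ball (0 : ℂ × ℂ) ε) (hp2 : p.2 ≠ 0) : evalAt g (branchMap α β a b υ σ p) = p.1 := by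
  rw [branchMap, evalAt_monomialChart g (m := m) (h.left_coord_ne_zero hp hp2)
    (h.right_ne_zero p hp), h.equation p hp, ← zpow_natCast, ← mul_assoc,
    ← zpow_add₀ (h.left_coord_ne_zero hp hp2)]
  simp

/-- Recovers t and s from the image point; both injectivity of a branch and the separation of
branches rest on this. -/
theorem branchMap_coord (hdet : α * b - β * a = 1) (h : NormalBranch F c m k e κ ε υ σ)
    {p : ℂ × ℂ} (hp : p ∈ ball (0 : ℂ × ℂ) ε) (hp2 : p.2 ≠ 0) :
    (branchMap α β a b υ σ p).1 ^ (-b) * (branchMap α β a b υ σ p).2 ^ a = p.2 * υ p ∧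
      (branchMap α β a b υ σ p).1 ^ (-β) * (branchMap α β a b υ σ p).2 ^ α = σ p :=
  ⟨monomialChart_left hdet (h.left_coord_ne_zero hp hp2) (h.right_ne_zero p hp),
    monomialChart_right hdet (h.left_coord_ne_zero hp hp2) (h.right_ne_zero p hp)⟩

/-- Injectivity: ξ is the value of f at the image, and then the chart coordinate t determines u.
Divergence: the branch is the rescaled branch times (u^(−α), u^(−β)), so the lower bound `hlow`
makes it uniform in ξ. -/
theorem isNormalizingEmbedding_branch {f : MvPolynomial (Fin 2) ℂ} {ξ₀ : ℂ} {Γ : Set (ℝ × ℝ)}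
    (hdet : α * b - β * a = 1) (hα : 0 ≤ α) (hβ : 0 ≤ β)
    (hΓ : ∀ u v : ℤ, ((u : ℝ), (v : ℝ)) ∈ Γ → α * u + β * v = m) (hκ : κ ≠ 0)
    (h : NormalBranch (chartPoly (f - MvPolynomial.C ξ₀) α β a b m) c m (a + b - 1)
      (m - α - β - 1) κ ε υ σ)
    (hlow : ∃ r > 0, ∀ p ∈ ball (0 : ℂ × ℂ) ε,
      r ≤ ‖(branchHat α β a b υ σ p).1‖ ∧ r ≤ ‖(branchHat α β a b υ σ p).2‖)
    (hroot : ∀ t : ℂ, t ≠ 0 →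
      evalAt (truncation f ((α : ℝ), (β : ℝ))) (monomialChart α β a b t c) = 0) :
    IsNormalizingEmbedding f ξ₀ Γ α β ε κ (fun p => branchMap α β a b υ σ (p - (ξ₀, 0)))
      (fun p => branchHat α β a b υ σ (p - (ξ₀, 0))) ∧
    ∀ V ⊆ puncturedBidisc ξ₀ ε ε, IsOpen V →
      IsOpen ((fun p => branchMap α β a b υ σ (p - (ξ₀, 0))) '' V) := by
  have hmem : ∀ p ∈ puncturedBidisc ξ₀ ε ε,
      p - (ξ₀, 0) ∈ ball (0 : ℂ × ℂ) ε ∧ (p - (ξ₀, 0)).2 ≠ 0 := by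
    intro p hp
    rw [mem_puncturedBidisc] at hp
    exact ⟨sub_mem_ball_iff.2 ⟨hp.1, hp.2.1⟩, by simpa using hp.2.2⟩
  have hsnd : ∀ p : ℂ × ℂ, (p - (ξ₀, 0)).2 = p.2 := fun p => by simp
  have hsub : ∀ p : ℂ × ℂ, ContDiffAt ℂ 1 (fun p : ℂ × ℂ => p - (ξ₀, 0)) p := fun p =>
    contDiffAt_id.sub contDiffAt_const
  have hJ : ∀ p ∈ puncturedBidisc ξ₀ ε ε,
      ContDiffAt ℂ 1 (fun p => branchMap α β a b υ σ (p - (ξ₀, 0))) p := fun p hp =>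
    ContDiffAt.comp (g := branchMap α β a b υ σ) (f := fun p : ℂ × ℂ => p - (ξ₀, 0)) p
      (h.contDiffAt_branchMap (hmem p hp).1 (hmem p hp).2) (hsub p)
  have heval : ∀ p ∈ puncturedBidisc ξ₀ ε ε,
      evalAt f (branchMap α β a b υ σ (p - (ξ₀, 0))) = p.1 := by
    intro p hp
    have := evalAt_branchMap h (hmem p hp).1 (hmem p hp).2
    rw [evalAt_sub_C] at this
    simpa using this
  have hpull : ∀ p ∈ puncturedBidisc ξ₀ ε ε, ∀ v w,
      pullbackStdForm (fun p => branchMap α β a b υ σ (p - (ξ₀, 0))) p v w =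
        κ * p.2 ^ ((m : ℤ) - α - β - 1) * stdForm v w := by
    intro p hp v w
    have h1 := h.pullback_branchMap hdet (hmem p hp).1 (hmem p hp).2 v w
    rw [hsnd] at h1
    rw [← h1]
    unfold pullbackStdForm
    rw [fderiv_comp_sub]
  have hinj : Set.InjOn (fun p => branchMap α β a b υ σ (p - (ξ₀, 0)))
      (puncturedBidisc ξ₀ ε ε) := by
    intro p hp q hq hpq
    have h1 : p.1 = q.1 := by rw [← heval p hp, ← heval q hq]; exact congrArg _ hpq
    have h2 : (p - (ξ₀, 0)).2 * υ (p - (ξ₀, 0)) = (q - (ξ₀, 0)).2 * υ (q - (ξ₀, 0)) := by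
      rw [← (branchMap_coord hdet h (hmem p hp).1 (hmem p hp).2).1,
        ← (branchMap_coord hdet h (hmem q hq).1 (hmem q hq).2).1]
      simp only at hpq
      rw [hpq]
    exact sub_left_injective (h.inj _ (hmem p hp).1 _ (hmem q hq).1 (by simp [h1]) h2)
  obtain ⟨hemb, hopen⟩ := isHolomorphicEmbedding_of_pullback (isOpen_puncturedBidisc ξ₀ ε ε) hJ
    hinj (D := fun p => κ * p.2 ^ ((m : ℤ) - α - β - 1))
    (fun p hp => mul_ne_zero hκ (zpow_ne_zero _ (mem_puncturedBidisc.1 hp).2.2)) hpull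
  have hhat : ∀ p ∈ puncturedBidisc ξ₀ ε ε, branchHat α β a b υ σ (p - (ξ₀, 0)) =
      (p.2 ^ α * (branchMap α β a b υ σ (p - (ξ₀, 0))).1,
        p.2 ^ β * (branchMap α β a b υ σ (p - (ξ₀, 0))).2) := by
    intro p hp
    have hp2 : p.2 ≠ 0 := (mem_puncturedBidisc.1 hp).2.2
    have hz : ∀ n : ℤ, p.2 ^ n * p.2 ^ (-n) = 1 := fun n => by
      rw [← zpow_add₀ hp2, add_neg_cancel, zpow_zero]
    simp only [branchHat, branchMap, monomialChart, hsnd, mul_zpow]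
    refine Prod.ext ?_ ?_
    · simp only
      rw [← mul_assoc, ← mul_assoc, hz, one_mul]
    · simp only
      rw [← mul_assoc, ← mul_assoc, hz, one_mul]
  refine ⟨⟨hemb, fun p hp => branchMap_mem_torus h (hmem p hp).1 (hmem p hp).2, heval, ?_, ?_,
    ?_, ?_, hhat, ?_⟩, hopen⟩
  · intro u v huv p hp x y
    rw [hpull p hp, ← hΓ u v huv]
    congr 3
    ring
  · intro M
    obtain ⟨r, hr, hlow⟩ := hlow
    refine ⟨min 1 (r / (|M| + 1)), by positivity, fun p hp hu => ?_⟩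
    have hp2 : p.2 ≠ 0 := (mem_puncturedBidisc.1 hp).2.2
    have hlow' := hlow _ (hmem p hp).1
    have hsplit : branchMap α β a b υ σ (p - (ξ₀, 0)) =
        (p.2 ^ (-α) * (branchHat α β a b υ σ (p - (ξ₀, 0))).1,
          p.2 ^ (-β) * (branchHat α β a b υ σ (p - (ξ₀, 0))).2) := by
      simp only [branchHat, branchMap, monomialChart, hsnd, mul_zpow]
      refine Prod.ext ?_ ?_ <;> simp only <;> ring
    show M < normC2 (branchMap α β a b υ σ (p - (ξ₀, 0)))
    -- At least one of α and β is positive because of the determinant; the corresponding coordinate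
    -- diverges.
    rcases hα.eq_or_lt with h0 | h0
    · have hβ1 : 1 ≤ β := by
        rcases hβ.eq_or_lt with h1 | h1
        · rw [← h0, ← h1] at hdet; simp at hdet
        · exact h1
      refine lt_of_lt_of_le ?_ (norm_snd_le_normC2 _)
      rw [hsplit]
      exact lt_norm_zpow_mul hr hβ1 hp2 hu hlow'.2
    · refine lt_of_lt_of_le ?_ (norm_fst_le_normC2 _)
      rw [hsplit]
      exact lt_norm_zpow_mul hr h0 hp2 hu hlow'.1
  · rintro p ⟨hp1, hp2⟩
    have hp : p - (ξ₀, 0) ∈ ball (0 : ℂ × ℂ) ε :=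
      sub_mem_ball_iff.2 ⟨mem_ball_iff_norm.1 hp1, mem_ball_zero_iff.1 hp2⟩
    exact ((ContDiffAt.comp (g := branchHat α β a b υ σ) (f := fun p : ℂ × ℂ => p - (ξ₀, 0)) p
      (h.contDiffAt_branchHat hp) (hsub p)).differentiableAt (by simp)).differentiableWithinAt
  · rintro p ⟨hp1, hp2⟩
    have hp : p - (ξ₀, 0) ∈ ball (0 : ℂ × ℂ) ε :=
      sub_mem_ball_iff.2 ⟨mem_ball_iff_norm.1 hp1, mem_ball_zero_iff.1 hp2⟩
    exact monomialChart_mem_torus (h.left_ne_zero _ hp) (h.right_ne_zero _ hp)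
  · intro ξ hξ
    have hε : 0 < ε := pos_of_mem_ball hξ
    have hp : ((ξ, 0) : ℂ × ℂ) - (ξ₀, 0) ∈ ball (0 : ℂ × ℂ) ε :=
      sub_mem_ball_iff.2 ⟨mem_ball_iff_norm.1 hξ, by simpa using hε⟩
    have h1 := h.right_zero _ hp
    have h2 : ((((ξ, 0) : ℂ × ℂ) - (ξ₀, 0)).1, (0 : ℂ)) = ((ξ, 0) : ℂ × ℂ) - (ξ₀, 0) := by simp
    rw [h2] at h1
    simp only [branchHat, h1]
    exact hroot _ (h.left_ne_zero _ hp)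

end Branch

/-! ### Faces of the Newton polygon and its exponents -/

section Polygon

variable {g : MvPolynomial (Fin 2) ℂ}

theorem pairing_add_left (η ζ x : ℝ × ℝ) : pairing (η + ζ) x = pairing η x + pairing ζ x := by
  simp only [pairing, Prod.fst_add, Prod.snd_add]; ring

theorem pairing_smul_left (r : ℝ) (η x : ℝ × ℝ) : pairing (r • η) x = r * pairing η x := by
  simp only [pairing, Prod.smul_fst, Prod.smul_snd, smul_eq_mul]; ring

theorem expPoint_mem {x : Fin 2 →₀ ℕ} (hx : x ∈ g.support) : expPoint x ∈ newtonPolygon g :=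
  subset_convexHull ℝ _ (Set.mem_image_of_mem _ hx)

theorem pairing_le_of_support {η : ℝ × ℝ} {c : ℝ}
    (h : ∀ x ∈ g.support, pairing η (expPoint x) ≤ c) {y : ℝ × ℝ} (hy : y ∈ newtonPolygon g) :
    pairing η y ≤ c := by
  have hconv : Convex ℝ {y : ℝ × ℝ | pairing η y ≤ c} := by
    intro x hx y hy a b ha hb hab
    simp only [Set.mem_ofPred_eq, pairing, Prod.fst_add, Prod.snd_add, Prod.smul_fst,
      Prod.smul_snd, smul_eq_mul] at *
    calc _ = a * (η.1 * x.1 + η.2 * x.2) + b * (η.1 * y.1 + η.2 * y.2) := by ring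
      _ ≤ a * c + b * c := by gcongr
      _ = c := by rw [← add_mul, hab, one_mul]
  refine convexHull_min ?_ hconv hy
  rintro _ ⟨x, hx, rfl⟩
  exact h x hx

theorem fst_nonneg_of_mem {y : ℝ × ℝ} (hy : y ∈ newtonPolygon g) : 0 ≤ y.1 := by
  have := pairing_le_of_support (g := g) (η := (-1, 0)) (c := 0) (by
    intro x _; simp [pairing, expPoint]) hy
  simpa [pairing] using this

theorem snd_nonneg_of_mem {y : ℝ × ℝ} (hy : y ∈ newtonPolygon g) : 0 ≤ y.2 := by
  have := pairing_le_of_support (g := g) (η := (0, -1)) (c := 0) (by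
    intro x _; simp [pairing, expPoint]) hy
  simpa [pairing] using this

/-- A linear inequality that holds at the vertices on a face holds on the face. -/
theorem pairing_le_of_mem_face {η ζ : ℝ × ℝ} {c : ℝ}
    (h : ∀ x ∈ g.support, expPoint x ∈ face (newtonPolygon g) η → pairing ζ (expPoint x) ≤ c)
    {y : ℝ × ℝ} (hy : y ∈ face (newtonPolygon g) η) : pairing ζ y ≤ c := by
  -- A large multiple of η penalises the exponents off the face. For M large, ζ + Mη is bounded on
  -- the whole support by c plus M times the value of η on the face; evaluating at y cancels the
  -- multiple.
  have hN : ∀ x : Fin 2 →₀ ℕ, ∃ N : ℝ, x ∈ g.support →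
      ∀ N' ≥ N, pairing ζ (expPoint x) - c ≤ N' * (pairing η y - pairing η (expPoint x)) := by
    intro x
    by_cases hx : x ∈ g.support
    · have hle := hy.2 _ (expPoint_mem hx)
      rcases hle.eq_or_lt with heq | hlt
      · refine ⟨0, fun _ N' _ => ?_⟩
        have := h x hx ⟨expPoint_mem hx, fun z hz => heq ▸ hy.2 z hz⟩
        rw [heq, sub_self, mul_zero]
        linarith
      · refine ⟨(pairing ζ (expPoint x) - c) / (pairing η y - pairing η (expPoint x)),
          fun _ N' hN' => ?_⟩
        rwa [ge_iff_le, div_le_iff₀ (sub_pos.2 hlt)] at hN'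
    · exact ⟨0, fun hx' => absurd hx' hx⟩
  choose N hN using hN
  obtain ⟨M, hM⟩ := (g.support.image N).bddAbove
  have := pairing_le_of_support (g := g) (η := ζ + M • η) (c := c + M * pairing η y) (by
    intro x hx
    have := hN x hx M (hM (Finset.mem_coe.2 (Finset.mem_image_of_mem N hx)))
    rw [pairing_add_left, pairing_smul_left]
    linarith) hy.1
  rw [pairing_add_left, pairing_smul_left] at this
  linarith

theorem affineDim_le_one {S : Set (ℝ × ℝ)} {η : ℝ × ℝ} (hη : η ≠ 0) {c : ℝ}
    (h : ∀ x ∈ S, pairing η x = c) : affineDim S ≤ 1 := by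
  let L : ℝ × ℝ →ₗ[ℝ] ℝ :=
    η.1 • LinearMap.fst ℝ ℝ ℝ + η.2 • LinearMap.snd ℝ ℝ ℝ
  have hL : ∀ x, L x = pairing η x := fun x => by simp [L, pairing]
  have hle : vectorSpan ℝ S ≤ LinearMap.ker L := by
    rw [vectorSpan_def, Submodule.span_le]
    rintro _ ⟨x, hx, y, hy, rfl⟩
    change L (x - y) = 0
    rw [map_sub, hL, hL, h x hx, h y hy, sub_self]
  have hsurj : LinearMap.range L = ⊤ := by
    rw [LinearMap.range_eq_top]
    refine LinearMap.surjective fun h0 => hη ?_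
    have h1 := LinearMap.congr_fun h0 (1, 0)
    have h2 := LinearMap.congr_fun h0 (0, 1)
    rw [hL] at h1 h2
    exact Prod.ext (by simpa [pairing] using h1) (by simpa [pairing] using h2)
  have hrank := LinearMap.finrank_range_add_finrank_ker L
  rw [hsurj, finrank_top] at hrank
  simp only [Module.finrank_self, Module.finrank_prod] at hrank
  have := Submodule.finrank_mono hle
  unfold affineDim
  omega

theorem affineDim_pos {S : Set (ℝ × ℝ)} {x y : ℝ × ℝ} (hx : x ∈ S) (hy : y ∈ S) (hxy : x ≠ y) :
    1 ≤ affineDim S := by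
  unfold affineDim
  rw [Nat.one_le_iff_ne_zero, Ne, Submodule.finrank_eq_zero]
  intro h
  have := vsub_mem_vectorSpan ℝ hx hy
  rw [h, Submodule.mem_bot, vsub_eq_sub, sub_eq_zero] at this
  exact hxy this

theorem affineDim_of_subsingleton {S : Set (ℝ × ℝ)} (h : S.Subsingleton) : affineDim S = 0 := by
  unfold affineDim
  rw [vectorSpan_of_subsingleton ℝ h, finrank_bot]

theorem rectangle_left {P : Set (ℝ × ℝ)} (hP : ContainsRectangles P) {y : ℝ × ℝ} (hy : y ∈ P) :
    (0, y.2) ∈ P :=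
  hP y.1 y.2 hy (subset_convexHull ℝ _ (by simp))

theorem rectangle_bottom {P : Set (ℝ × ℝ)} (hP : ContainsRectangles P) {y : ℝ × ℝ} (hy : y ∈ P) :
    (y.1, 0) ∈ P :=
  hP y.1 y.2 hy (subset_convexHull ℝ _ (by simp))

/-- The rectangle condition puts the origin in the polygon. Every other exponent has coordinate sum
at least 1, so without a constant term the covector (−1, −1) would separate the origin from the
polygon. -/
theorem zero_mem_support (hP : ContainsRectangles (newtonPolygon g))
    (hdim : affineDim (newtonPolygon g) = 2) : (0 : Fin 2 →₀ ℕ) ∈ g.support := by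
  have hne : (newtonPolygon g).Nonempty := by
    by_contra h
    rw [Set.not_nonempty_iff_eq_empty] at h
    rw [h, affineDim_of_subsingleton Set.subsingleton_empty] at hdim
    exact absurd hdim (by norm_num)
  obtain ⟨y, hy⟩ := hne
  have h0 : ((0, 0) : ℝ × ℝ) ∈ newtonPolygon g := rectangle_left hP (rectangle_bottom hP hy)
  by_contra h
  have := pairing_le_of_support (g := g) (η := (-1, -1)) (c := -1) (by
    intro x hx
    have hx0 : x 0 + x 1 ≠ 0 := by
      intro h2
      refine h ?_
      have : x = 0 := by
        ext i; fin_cases i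
        · simp; omega
        · simp; omega
      rwa [← this]
    have : (1 : ℝ) ≤ x 0 + x 1 := by exact_mod_cast Nat.one_le_iff_ne_zero.2 hx0
    simp only [pairing, expPoint]
    linarith) h0
  simp [pairing] at this
  linarith

/-- A face is controlled by the exponents on it: linear inequalities that hold at them hold on the
face. With at most one such exponent the face would be a point or empty, of dimension 0. -/
theorem exists_mem_support_of_face {Γ : Set (ℝ × ℝ)} {η : ℝ × ℝ}
    (hΓ : Γ = face (newtonPolygon g) η) (h1 : affineDim Γ = 1) :
    ∃ x ∈ g.support, ∃ y ∈ g.support, expPoint x ∈ Γ ∧ expPoint y ∈ Γ ∧ x ≠ y := by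
  by_contra hcon
  push Not at hcon
  have hsub : Γ.Subsingleton := by
    by_cases hex : ∃ x ∈ g.support, expPoint x ∈ Γ
    · obtain ⟨x, hx, hxΓ⟩ := hex
      have hall : ∀ y ∈ Γ, y = expPoint x := by
        intro y hy
        have key : ∀ ζ, pairing ζ y ≤ pairing ζ (expPoint x) := fun ζ =>
          pairing_le_of_mem_face (by
            intro x' hx' hx'Γ
            rw [hcon x hx x' hx' hxΓ (hΓ ▸ hx'Γ)]) (hΓ ▸ hy)
        have k1 := key (1, 0)
        have k2 := key (-1, 0)
        have k3 := key (0, 1)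
        have k4 := key (0, -1)
        simp only [pairing] at k1 k2 k3 k4
        exact Prod.ext (by linarith) (by linarith)
      intro y hy z hz
      rw [hall y hy, hall z hz]
    · push Not at hex
      intro y hy
      -- With no exponent on the face, the bound 0 ≤ −1 holds vacuously at the exponents, so the
      -- face has no points.
      have := pairing_le_of_mem_face (g := g) (η := η) (ζ := 0) (c := -1) (by
        intro x hx hxΓ
        exact absurd (hΓ ▸ hxΓ) (hex x hx)) (hΓ ▸ hy)
      simp [pairing] at this
      linarith
  rw [affineDim_of_subsingleton hsub] at h1
  exact absurd h1 (by norm_num)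

theorem face_smul (P : Set (ℝ × ℝ)) {r : ℝ} (hr : 0 < r) (η : ℝ × ℝ) :
    face P (r • η) = face P η := by
  ext x
  simp only [face, Set.mem_ofPred_eq, pairing_smul_left]
  refine and_congr_right fun _ => forall₂_congr fun y _ => ?_
  exact mul_le_mul_iff_right₀ hr

end Polygon

/-! ### Unimodular charts adapted to a side -/

/-- An integral affine chart adapted to the outer side `Γ`. -/
structure IsSideChart (g : MvPolynomial (Fin 2) ℂ) (Γ : Set (ℝ × ℝ)) (α β a b : ℤ) (m : ℕ) :
    Prop where
  eq_face : Γ = face (newtonPolygon g) ((α : ℝ), (β : ℝ))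
  left_nonneg : 0 ≤ α
  right_nonneg : 0 ≤ β
  det : α * b - β * a = 1
  height_ne_zero : m ≠ 0
  le_height : ∀ x ∈ g.support, α * x 0 + β * x 1 ≤ m
  mem_iff : ∀ x ∈ g.support, expPoint x ∈ Γ ↔ α * x 0 + β * x 1 = m
  pairing_eq : ∀ y ∈ Γ, pairing ((α : ℝ), (β : ℝ)) y = m
  of_left_eq_one : α = 1 → a = 0 ∧ b = 1
  of_right_eq_one : α ≠ 1 → β = 1 → a = -1 ∧ b = 0

theorem IsSideChart.isCoprime {g : MvPolynomial (Fin 2) ℂ} {Γ : Set (ℝ × ℝ)} {α β a b : ℤ} {m : ℕ}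
    (h : IsSideChart g Γ α β a b m) : IsCoprime α β :=
  ⟨b, -a, by linarith [h.det]⟩

/-- Bézout, with the completion fixed when α = 1 or β = 1: then s = w t^β or s = t^α / z, and the
s-exponent of a monomial is its w-exponent or minus its z-exponent. The explicit computations of the
constants rely on this. -/
theorem exists_unimodular {α β : ℤ} (h : IsCoprime α β) :
    ∃ a b : ℤ, α * b - β * a = 1 ∧ (α = 1 → a = 0 ∧ b = 1) ∧ (α ≠ 1 → β = 1 → a = -1 ∧ b = 0) := by
  by_cases h1 : α = 1
  · exact ⟨0, 1, by simp [h1], fun _ => ⟨rfl, rfl⟩, fun h2 => absurd h1 h2⟩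
  by_cases h2 : β = 1
  · exact ⟨-1, 0, by simp [h2], fun h3 => absurd h3 h1, fun _ _ => ⟨rfl, rfl⟩⟩
  obtain ⟨u, v, huv⟩ := h
  exact ⟨-v, u, by linarith, fun h3 => absurd h3 h1, fun _ h3 => absurd h3 h2⟩

/-- A real covector orthogonal to a non-zero integer vector is a multiple r of the rotated primitive
vector (−q', p'); the sign of r selects the outer normal. -/
theorem exists_primitive_normal {p q : ℤ} (hpq : p ≠ 0 ∨ q ≠ 0) {η : ℝ × ℝ} (hη : η ≠ 0)
    (h : η.1 * p + η.2 * q = 0) :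
    ∃ α β : ℤ, IsCoprime α β ∧ ∃ r : ℝ, 0 < r ∧ η = r • ((α : ℝ), (β : ℝ)) := by
  obtain ⟨G, p', q', hp, hq, hcop⟩ : ∃ G p' q' : ℤ, p = G * p' ∧ q = G * q' ∧
      IsCoprime p' q' := by
    obtain ⟨p', q', hcop, hp, hq⟩ := Int.exists_gcd_one (Int.gcd_pos_iff.2 hpq)
    exact ⟨Int.gcd p q, p', q', hp.trans (mul_comm _ _), hq.trans (mul_comm _ _),
      Int.isCoprime_iff_gcd_eq_one.2 hcop⟩
  have hG : (G : ℝ) ≠ 0 := by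
    have : G ≠ 0 := by
      rintro rfl
      rw [zero_mul] at hp hq
      exact hpq.elim (fun h => h hp) (fun h => h hq)
    exact_mod_cast this
  have h' : η.1 * p' + η.2 * q' = 0 := by
    rw [hp, hq] at h
    push_cast at h
    have : (G : ℝ) * (η.1 * p' + η.2 * q') = 0 := by linear_combination h
    exact (mul_eq_zero.1 this).resolve_left hG
  obtain ⟨x, y, hxy⟩ := hcop
  have hxy' : (x : ℝ) * p' + y * q' = 1 := by exact_mod_cast hxy
  -- `η = r (-q', p')` with `r = x η₂ - y η₁`
  have e1 : η.1 = (x * η.2 - y * η.1) * -q' := by linear_combination (-η.1) * hxy' + x * h'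
  have e2 : η.2 = (x * η.2 - y * η.1) * p' := by linear_combination (-η.2) * hxy' + y * h'
  set r : ℝ := x * η.2 - y * η.1
  have hr : r ≠ 0 := by
    intro h0
    rw [h0, zero_mul] at e1 e2
    exact hη (Prod.ext e1 e2)
  rcases lt_or_gt_of_ne hr with hneg | hpos
  · refine ⟨q', -p', ⟨y, -x, by linarith⟩, -r, neg_pos.2 hneg, Prod.ext ?_ ?_⟩
    · simp only [Prod.smul_fst, smul_eq_mul]; linarith
    · simp only [Prod.smul_snd, smul_eq_mul]; push_cast; linarith
  · refine ⟨-q', p', ⟨-y, x, by linarith⟩, r, hpos, Prod.ext ?_ ?_⟩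
    · simp only [Prod.smul_fst, smul_eq_mul]; push_cast; linarith
    · simp only [Prod.smul_snd, smul_eq_mul]; linarith

/-- The rectangle condition makes the normal non-negative: if α < 0, sliding a point of Γ to the
axis z-exponent 0 would raise the pairing, so Γ would lie on that axis; likewise for β. The height
is non-zero, because otherwise the pairing, which is non-negative on the polygon, would vanish on it
and the dimension would drop. -/
theorem exists_isSideChart {g : MvPolynomial (Fin 2) ℂ} {Γ : Set (ℝ × ℝ)}
    (hP : ContainsRectangles (newtonPolygon g)) (hdim : affineDim (newtonPolygon g) = 2)
    (hΓ : IsOuterSide (newtonPolygon g) Γ) : ∃ α β a b m, IsSideChart g Γ α β a b m := by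
  obtain ⟨⟨⟨η, hη⟩, h1⟩, hout1, hout2⟩ := hΓ
  have hη0 : η ≠ 0 := by
    rintro rfl
    have : Γ = newtonPolygon g := by
      rw [hη]; ext x; simp [face, pairing]
    rw [this, hdim] at h1
    exact absurd h1 (by norm_num)
  obtain ⟨x, hx, y, hy, hxΓ, hyΓ, hxy⟩ := exists_mem_support_of_face hη h1
  have hperp : η.1 * (((x 0 : ℤ) - y 0 : ℤ) : ℝ) + η.2 * (((x 1 : ℤ) - y 1 : ℤ) : ℝ) = 0 := by
    rw [hη] at hxΓ hyΓ
    have e := le_antisymm (hxΓ.2 _ hyΓ.1) (hyΓ.2 _ hxΓ.1)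
    simp only [pairing, expPoint] at e
    push_cast
    linarith
  obtain ⟨α, β, hcop, r, hr, hηr⟩ := exists_primitive_normal (by
    by_contra hc
    push Not at hc
    refine hxy ?_
    ext i; fin_cases i
    · have := hc.1; simp; omega
    · have := hc.2; simp; omega) hη0 hperp
  have hΓf : Γ = face (newtonPolygon g) ((α : ℝ), (β : ℝ)) := by
    rw [hη, hηr, face_smul _ hr]
  have hα : 0 ≤ α := by
    by_contra hneg
    push Not at hneg
    refine hout1 fun z hz => ?_
    rw [hΓf] at hz
    by_contra hz1
    have hz1' : 0 < z.1 := lt_of_le_of_ne (fst_nonneg_of_mem hz.1) (Ne.symm hz1)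
    have := hz.2 _ (rectangle_left hP hz.1)
    simp only [pairing] at this
    have hα' : (α : ℝ) < 0 := by exact_mod_cast hneg
    nlinarith
  have hβ : 0 ≤ β := by
    by_contra hneg
    push Not at hneg
    refine hout2 fun z hz => ?_
    rw [hΓf] at hz
    by_contra hz1
    have hz1' : 0 < z.2 := lt_of_le_of_ne (snd_nonneg_of_mem hz.1) (Ne.symm hz1)
    have := hz.2 _ (rectangle_bottom hP hz.1)
    simp only [pairing] at this
    have hα' : (β : ℝ) < 0 := by exact_mod_cast hneg
    nlinarith
  obtain ⟨a, b, hdet, hs1, hs2⟩ := exists_unimodular hcop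
  obtain ⟨m, hm⟩ : ∃ m : ℕ, α * x 0 + β * x 1 = m := ⟨(α * x 0 + β * x 1).toNat, by
    rw [Int.toNat_of_nonneg]; positivity⟩
  have hpx : pairing ((α : ℝ), (β : ℝ)) (expPoint x) = m := by
    simp only [pairing, expPoint]; exact_mod_cast hm
  rw [hΓf] at hxΓ
  have hpe : ∀ y ∈ Γ, pairing ((α : ℝ), (β : ℝ)) y = m := fun y hy => by
    rw [hΓf] at hy
    rw [← hpx]
    exact le_antisymm (hxΓ.2 _ hy.1) (hy.2 _ hxΓ.1)
  have hle : ∀ y ∈ newtonPolygon g, pairing ((α : ℝ), (β : ℝ)) y ≤ m := fun y hy => by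
    rw [← hpx]; exact hxΓ.2 _ hy
  refine ⟨α, β, a, b, m, hΓf, hα, hβ, hdet, ?_, ?_, ?_, hpe, hs1, hs2⟩
  · rintro rfl
    have hα' : (0 : ℝ) ≤ α := by exact_mod_cast hα
    have hβ' : (0 : ℝ) ≤ β := by exact_mod_cast hβ
    have := affineDim_le_one (S := newtonPolygon g) (η := ((α : ℝ), (β : ℝ))) (c := 0) (by
      intro h0
      simp only [Prod.mk_eq_zero, Int.cast_eq_zero] at h0
      rw [h0.1, h0.2] at hdet
      simp at hdet) (by
      intro y hy
      refine le_antisymm (by simpa using hle y hy) ?_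
      simp only [pairing]
      have := fst_nonneg_of_mem hy
      have := snd_nonneg_of_mem hy
      positivity)
    omega
  · intro y hy
    have := hle _ (expPoint_mem hy)
    simp only [pairing, expPoint] at this
    exact_mod_cast this
  · intro y hy
    constructor
    · intro h
      have := hpe _ h
      simp only [pairing, expPoint] at this
      exact_mod_cast this
    · intro h
      rw [hΓf]
      refine ⟨expPoint_mem hy, fun z hz => ?_⟩
      have : pairing ((α : ℝ), (β : ℝ)) (expPoint y) = m := by
        simp only [pairing, expPoint]; exact_mod_cast h
      rw [this]
      exact hle z hz

/-! ### Truncation to a side and the derivatives of the truncation -/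

/-- The exponents of `g` on the line `α i + β j = m`. -/
def sideSupport (g : MvPolynomial (Fin 2) ℂ) (α β : ℤ) (m : ℕ) : Finset (Fin 2 →₀ ℕ) :=
  g.support.filter fun x => α * x 0 + β * x 1 = m

theorem mem_sideSupport {g : MvPolynomial (Fin 2) ℂ} {α β : ℤ} {m : ℕ} {x : Fin 2 →₀ ℕ} :
    x ∈ sideSupport g α β m ↔ x ∈ g.support ∧ α * x 0 + β * x 1 = m :=
  Finset.mem_filter

theorem truncation_eq_sum {q : MvPolynomial (Fin 2) ℂ} {α β : ℤ} {m : ℕ}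
    (hle : ∀ x ∈ q.support, α * x 0 + β * x 1 ≤ m) (hne : (sideSupport q α β m).Nonempty) :
    truncation q ((α : ℝ), (β : ℝ)) =
      ∑ x ∈ sideSupport q α β m, MvPolynomial.monomial x (q.coeff x) := by
  obtain ⟨x₀, hx₀⟩ := hne
  rw [mem_sideSupport] at hx₀
  have hpair : ∀ x : Fin 2 →₀ ℕ, pairing ((α : ℝ), (β : ℝ)) (expPoint x) =
      ((α * x 0 + β * x 1 : ℤ) : ℝ) := fun x => by simp [pairing, expPoint]
  unfold truncation sideSupport
  refine Finset.sum_congr (Finset.ext fun x => ?_) fun _ _ => rfl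
  classical
  rw [Finset.mem_filter, Finset.mem_filter]
  refine and_congr_right fun hx => ?_
  constructor
  · rintro ⟨_, h⟩
    have := h _ (expPoint_mem hx₀.1)
    rw [hpair, hpair, hx₀.2] at this
    exact le_antisymm (hle x hx) (by exact_mod_cast this)
  · intro h
    refine ⟨expPoint_mem hx, fun y hy => ?_⟩
    refine (pairing_le_of_support (c := m) (fun z hz => ?_) hy).trans_eq ?_
    · rw [hpair]; exact_mod_cast hle z hz
    · rw [hpair, h]; simp

theorem evalAt_sum_monomial (S : Finset (Fin 2 →₀ ℕ)) (A : (Fin 2 →₀ ℕ) → ℂ) (p : ℂ × ℂ) :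
    evalAt (∑ x ∈ S, MvPolynomial.monomial x (A x)) p =
      ∑ x ∈ S, A x * (p.1 ^ (x 0 : ℤ) * p.2 ^ (x 1 : ℤ)) := by
  simp [evalAt, map_sum, MvPolynomial.eval_monomial, Finsupp.prod_fintype, Fin.prod_univ_two]

/-- Multiplying by the variable gives the Euler operator, which is diagonal on monomials. -/
theorem mul_evalAt_pderiv_zero (S : Finset (Fin 2 →₀ ℕ)) (A : (Fin 2 →₀ ℕ) → ℂ) (p : ℂ × ℂ) :
    p.1 * evalAt (MvPolynomial.pderiv 0 (∑ x ∈ S, MvPolynomial.monomial x (A x))) p =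
      ∑ x ∈ S, A x * x 0 * (p.1 ^ (x 0 : ℤ) * p.2 ^ (x 1 : ℤ)) := by
  simp only [map_sum, MvPolynomial.pderiv_monomial]
  rw [evalAt, map_sum, Finset.mul_sum]
  refine Finset.sum_congr rfl fun x _ => ?_
  rw [MvPolynomial.eval_monomial, Finsupp.prod_fintype _ _ (by simp), Fin.prod_univ_two]
  simp only [Matrix.cons_val_zero, Matrix.cons_val_one, Finsupp.coe_tsub, Pi.sub_apply,
    Finsupp.single_apply, zpow_natCast]
  rcases hx : x 0 with _ | n
  · simp
  · simp only [if_true, Nat.add_sub_cancel, pow_succ]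
    simp
    ring

theorem mul_evalAt_pderiv_one (S : Finset (Fin 2 →₀ ℕ)) (A : (Fin 2 →₀ ℕ) → ℂ) (p : ℂ × ℂ) :
    p.2 * evalAt (MvPolynomial.pderiv 1 (∑ x ∈ S, MvPolynomial.monomial x (A x))) p =
      ∑ x ∈ S, A x * x 1 * (p.1 ^ (x 0 : ℤ) * p.2 ^ (x 1 : ℤ)) := by
  simp only [map_sum, MvPolynomial.pderiv_monomial]
  rw [evalAt, map_sum, Finset.mul_sum]
  refine Finset.sum_congr rfl fun x _ => ?_
  rw [MvPolynomial.eval_monomial, Finsupp.prod_fintype _ _ (by simp), Fin.prod_univ_two]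
  simp only [Matrix.cons_val_zero, Matrix.cons_val_one, Finsupp.coe_tsub, Pi.sub_apply,
    Finsupp.single_apply, zpow_natCast]
  rcases hx : x 1 with _ | n
  · simp
  · simp only [if_true, Nat.add_sub_cancel, pow_succ]
    simp
    ring

section Chart

variable {g : MvPolynomial (Fin 2) ℂ} {Γ : Set (ℝ × ℝ)} {α β a b : ℤ} {m : ℕ}

theorem hasDerivAt_chartPoly (g : MvPolynomial (Fin 2) ℂ) (α β a b m : ℤ) {p : ℂ × ℂ}
    (hp : p.2 ≠ 0) :
    HasDerivAt (fun s => chartPoly g α β a b m (p.1, s))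
      (∑ x ∈ g.support, g.coeff x * p.1 ^ (m - (α * x 0 + β * x 1)) *
        (((a * x 0 + b * x 1 : ℤ) : ℂ) * p.2 ^ (a * x 0 + b * x 1 - 1))) p.2 := by
  unfold chartPoly
  refine HasDerivAt.fun_sum fun x _ => ?_
  exact (hasDerivAt_zpow (a * x 0 + b * x 1) p.2 (Or.inl hp)).const_mul
    (g.coeff x * p.1 ^ (m - (α * x 0 + β * x 1)))

theorem IsSideChart.analyticAt_chartPoly (h : IsSideChart g Γ α β a b m) {p : ℂ × ℂ}
    (hp : p.2 ≠ 0) : AnalyticAt ℂ (chartPoly g α β a b m) p :=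
  _root_.analyticAt_chartPoly h.le_height hp

theorem IsSideChart.hasDerivAt_fderiv (h : IsSideChart g Γ α β a b m) {p : ℂ × ℂ}
    (hp : p.2 ≠ 0) :
    HasDerivAt (fun s => chartPoly g α β a b m (p.1, s))
      (fderiv ℂ (chartPoly g α β a b m) p (0, 1)) p.2 := by
  have hline : HasDerivAt (fun s : ℂ => ((p.1, s) : ℂ × ℂ)) (0, 1) p.2 :=
    (hasDerivAt_const _ p.1).prodMk (hasDerivAt_id _)
  exact (h.analyticAt_chartPoly (p := (p.1, p.2)) hp).differentiableAt.hasFDerivAt.comp_hasDerivAt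
    p.2 hline

theorem IsSideChart.fderiv_chartPoly (h : IsSideChart g Γ α β a b m) {p : ℂ × ℂ}
    (hp : p.2 ≠ 0) :
    fderiv ℂ (chartPoly g α β a b m) p (0, 1) =
      ∑ x ∈ g.support, g.coeff x * p.1 ^ ((m : ℤ) - (α * x 0 + β * x 1)) *
        (((a * x 0 + b * x 1 : ℤ) : ℂ) * p.2 ^ (a * x 0 + b * x 1 - 1)) :=
  (h.hasDerivAt_fderiv hp).unique (hasDerivAt_chartPoly g α β a b m hp)

/-- At t = 0 the power of t is 0 ^ 0 = 1 on the line of the side and 0 off it. -/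
theorem IsSideChart.sum_support (_ : IsSideChart g Γ α β a b m) (A : (Fin 2 →₀ ℕ) → ℂ) :
    ∑ x ∈ g.support, g.coeff x * (0 : ℂ) ^ ((m : ℤ) - (α * x 0 + β * x 1)) * A x =
      ∑ x ∈ sideSupport g α β m, g.coeff x * A x := by
  rw [sideSupport, Finset.sum_filter]
  refine Finset.sum_congr rfl fun x _ => ?_
  split_ifs with hx
  · rw [hx]; simp
  · rw [zero_zpow _ (sub_ne_zero.2 (Ne.symm hx))]; simp

theorem IsSideChart.chartPoly_zero (h : IsSideChart g Γ α β a b m) (s : ℂ) :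
    chartPoly g α β a b m (0, s) =
      ∑ x ∈ sideSupport g α β m, g.coeff x * s ^ (a * x 0 + b * x 1) :=
  h.sum_support fun x => s ^ (a * x 0 + b * x 1)

theorem IsSideChart.fderiv_chartPoly_zero (h : IsSideChart g Γ α β a b m) {s : ℂ} (hs : s ≠ 0) :
    fderiv ℂ (chartPoly g α β a b m) (0, s) (0, 1) =
      ∑ x ∈ sideSupport g α β m,
        g.coeff x * (((a * x 0 + b * x 1 : ℤ) : ℂ) * s ^ (a * x 0 + b * x 1 - 1)) := by
  rw [h.fderiv_chartPoly (p := (0, s)) hs]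
  exact h.sum_support fun x => ((a * x 0 + b * x 1 : ℤ) : ℂ) * s ^ (a * x 0 + b * x 1 - 1)

theorem IsSideChart.exists_pair (h : IsSideChart g Γ α β a b m) (h1 : affineDim Γ = 1) :
    ∃ x ∈ sideSupport g α β m, ∃ y ∈ sideSupport g α β m, x ≠ y := by
  obtain ⟨x, hx, y, hy, hxΓ, hyΓ, hxy⟩ := exists_mem_support_of_face h.eq_face h1
  exact ⟨x, mem_sideSupport.2 ⟨hx, (h.mem_iff x hx).1 hxΓ⟩, y,
    mem_sideSupport.2 ⟨hy, (h.mem_iff y hy).1 hyΓ⟩, hxy⟩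

theorem IsSideChart.truncation_eq (h : IsSideChart g Γ α β a b m) (h1 : affineDim Γ = 1) :
    truncation g ((α : ℝ), (β : ℝ)) =
      ∑ x ∈ sideSupport g α β m, MvPolynomial.monomial x (g.coeff x) := by
  obtain ⟨x, hx, _⟩ := h.exists_pair h1
  exact truncation_eq_sum h.le_height ⟨x, hx⟩

/-- The two polynomials differ only in the constant term, whose weight 0 is below the height m of
the side. -/
theorem IsSideChart.truncation_add_C {f : MvPolynomial (Fin 2) ℂ} {ξ₀ : ℂ}
    (h : IsSideChart (f - MvPolynomial.C ξ₀) Γ α β a b m) (h1 : affineDim Γ = 1) :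
    truncation f ((α : ℝ), (β : ℝ)) = truncation (f - MvPolynomial.C ξ₀) ((α : ℝ), (β : ℝ)) := by
  have hcoeff : ∀ x : Fin 2 →₀ ℕ, x ≠ 0 → (f - MvPolynomial.C ξ₀).coeff x = f.coeff x := by
    intro x hx
    rw [MvPolynomial.coeff_sub, MvPolynomial.coeff_C, if_neg (Ne.symm hx), sub_zero]
  have hside : sideSupport f α β m = sideSupport (f - MvPolynomial.C ξ₀) α β m := by
    ext x
    rw [mem_sideSupport, mem_sideSupport, MvPolynomial.mem_support_iff,
      MvPolynomial.mem_support_iff]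
    refine and_congr_left fun hx => ?_
    have hx0 : x ≠ 0 := by
      rintro rfl
      have := h.height_ne_zero
      simp at hx
      omega
    rw [hcoeff x hx0]
  obtain ⟨x, hx, _⟩ := h.exists_pair h1
  rw [h.truncation_eq h1, truncation_eq_sum (m := m) _ ⟨x, hside ▸ hx⟩, hside]
  · refine Finset.sum_congr rfl fun x hx => ?_
    rw [hcoeff x]
    rintro rfl
    have := h.height_ne_zero
    have := (mem_sideSupport.1 hx).2
    simp at this
    omega
  · intro x hx
    by_cases hx0 : x = 0
    · subst hx0; simp
    · refine h.le_height x ?_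
      rw [MvPolynomial.mem_support_iff] at hx ⊢
      rwa [hcoeff x hx0]

theorem IsSideChart.evalAt_truncation (h : IsSideChart g Γ α β a b m) (h1 : affineDim Γ = 1)
    {t s : ℂ} (ht : t ≠ 0) (hs : s ≠ 0) :
    evalAt (truncation g ((α : ℝ), (β : ℝ))) (monomialChart α β a b t s) =
      t ^ (-(m : ℤ)) * chartPoly g α β a b m (0, s) := by
  rw [h.truncation_eq h1, evalAt_sum_monomial, h.chartPoly_zero, Finset.mul_sum]
  refine Finset.sum_congr rfl fun x hx => ?_
  rw [monomial_monomialChart ht hs, (mem_sideSupport.1 hx).2]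
  ring

theorem IsSideChart.monomial_mem (_ : IsSideChart g Γ α β a b m) {c : ℂ} (hc : c ≠ 0)
    (x : Fin 2 →₀ ℕ) : (monomialChart α β a b 1 c).1 ^ (x 0 : ℤ) *
      (monomialChart α β a b 1 c).2 ^ (x 1 : ℤ) = c ^ (a * x 0 + b * x 1) := by
  rw [monomial_monomialChart one_ne_zero hc, one_zpow, one_mul]

/-- The chain rule for the truncation along the side. -/
theorem IsSideChart.pderiv_transversal (h : IsSideChart g Γ α β a b m) (h1 : affineDim Γ = 1)
    {c : ℂ} (hc : c ≠ 0) :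
    a * ((monomialChart α β a b 1 c).1 * evalAt (MvPolynomial.pderiv 0
        (truncation g ((α : ℝ), (β : ℝ)))) (monomialChart α β a b 1 c)) +
      b * ((monomialChart α β a b 1 c).2 * evalAt (MvPolynomial.pderiv 1
        (truncation g ((α : ℝ), (β : ℝ)))) (monomialChart α β a b 1 c)) =
      c * fderiv ℂ (chartPoly g α β a b m) (0, c) (0, 1) := by
  rw [h.truncation_eq h1, mul_evalAt_pderiv_zero, mul_evalAt_pderiv_one,
    h.fderiv_chartPoly_zero hc, Finset.mul_sum, Finset.mul_sum, Finset.mul_sum,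
    ← Finset.sum_add_distrib]
  refine Finset.sum_congr rfl fun x hx => ?_
  rw [h.monomial_mem hc, zpow_sub_one₀ hc]
  push_cast
  field_simp

/-- Euler's formula for the truncation. -/
theorem IsSideChart.pderiv_euler (h : IsSideChart g Γ α β a b m) (h1 : affineDim Γ = 1)
    {c : ℂ} (hc : c ≠ 0) :
    α * ((monomialChart α β a b 1 c).1 * evalAt (MvPolynomial.pderiv 0
        (truncation g ((α : ℝ), (β : ℝ)))) (monomialChart α β a b 1 c)) +
      β * ((monomialChart α β a b 1 c).2 * evalAt (MvPolynomial.pderiv 1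
        (truncation g ((α : ℝ), (β : ℝ)))) (monomialChart α β a b 1 c)) =
      m * chartPoly g α β a b m (0, c) := by
  rw [h.truncation_eq h1, mul_evalAt_pderiv_zero, mul_evalAt_pderiv_one,
    h.chartPoly_zero, Finset.mul_sum, Finset.mul_sum, Finset.mul_sum,
    ← Finset.sum_add_distrib]
  refine Finset.sum_congr rfl fun x hx => ?_
  have hm : (α : ℂ) * x 0 + β * x 1 = m := by exact_mod_cast (mem_sideSupport.1 hx).2
  rw [h.monomial_mem hc, ← hm]
  ring

/-- Non-degeneracy of the truncation makes the roots on the side simple. -/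
theorem IsSideChart.fderiv_ne_zero (h : IsSideChart g Γ α β a b m) (h1 : affineDim Γ = 1)
    (hnd : IsNewtonNondegenerate g) {c : ℂ} (hc : c ≠ 0)
    (h0 : chartPoly g α β a b m (0, c) = 0) :
    fderiv ℂ (chartPoly g α β a b m) (0, c) (0, 1) ≠ 0 := by
  intro hF
  have htor := monomialChart_mem_torus (α := α) (β := β) (a := a) (b := b) one_ne_zero hc
  have hnd' := hnd ((α : ℝ), (β : ℝ)) (monomialChart α β a b 1 c) htor.1 htor.2
    (by rw [h.evalAt_truncation h1 one_ne_zero hc, h0, mul_zero])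
  have l1 := h.pderiv_euler h1 hc
  have l2 := h.pderiv_transversal h1 hc
  rw [h0, mul_zero] at l1
  rw [hF, mul_zero] at l2
  have hdet : (α : ℂ) * b - β * a = 1 := by exact_mod_cast h.det
  -- Euler's formula and the chain rule form a linear system of determinant 1 for z ∂_z and w ∂_w of
  -- the truncation. Its right-hand side is zero, so both partial derivatives vanish.
  rcases hnd' with h2 | h2
  · refine mul_ne_zero htor.1 h2 ?_
    linear_combination (-((monomialChart α β a b 1 c).1 * evalAt (MvPolynomial.pderiv 0
        (truncation g ((α : ℝ), (β : ℝ)))) (monomialChart α β a b 1 c))) * hdet + b * l1 - β * l2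
  · refine mul_ne_zero htor.2 h2 ?_
    linear_combination (-((monomialChart α β a b 1 c).2 * evalAt (MvPolynomial.pderiv 1
        (truncation g ((α : ℝ), (β : ℝ)))) (monomialChart α β a b 1 c))) * hdet - a * l1 + α * l2

/-- The map (i, j) ↦ (αi + βj, ai + bj) is unimodular; this is its inverse on the line of the side.
Lattice points of the line are thus parametrised by the integer ai + bj. -/
theorem IsSideChart.coord_eq (h : IsSideChart g Γ α β a b m) {i j : ℤ} (hij : α * i + β * j = m) :
    i = b * m - β * (a * i + b * j) ∧ j = α * (a * i + b * j) - a * m := by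
  have hdet := h.det
  constructor
  · rw [← hij]; linear_combination (-i) * hdet
  · rw [← hij]; linear_combination (-j) * hdet

theorem IsSideChart.coord_injOn (h : IsSideChart g Γ α β a b m) {x y : Fin 2 →₀ ℕ}
    (hx : α * x 0 + β * x 1 = m) (hy : α * y 0 + β * y 1 = m)
    (hxy : a * x 0 + b * x 1 = a * y 0 + b * y 1) : x = y := by
  have e1 := h.coord_eq hx
  have e2 := h.coord_eq hy
  rw [hxy] at e1
  ext i; fin_cases i
  · have := e1.1.trans e2.1.symm
    simpa using this
  · have := e1.2.trans e2.2.symm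
    simpa using this

/-- The lattice points of a side, in terms of the second coordinate of the chart. -/
theorem IsSideChart.exists_range (h : IsSideChart g Γ α β a b m) (h1 : affineDim Γ = 1) :
    ∃ k₀ : ℤ, 0 < latticeLength Γ ∧
      (∀ x ∈ sideSupport g α β m,
        k₀ ≤ a * x 0 + b * x 1 ∧ a * x 0 + b * x 1 ≤ k₀ + latticeLength Γ) ∧
      (∃ x ∈ sideSupport g α β m, a * x 0 + b * x 1 = k₀) ∧
      (∃ x ∈ sideSupport g α β m, a * x 0 + b * x 1 = k₀ + latticeLength Γ) ∧
      ∀ i j : ℤ, α * i + β * j = m →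
        (((i : ℝ), (j : ℝ)) ∈ Γ ↔ k₀ ≤ a * i + b * j ∧ a * i + b * j ≤ k₀ + latticeLength Γ) := by
  obtain ⟨x₁, hx₁, x₂, hx₂, hne⟩ := h.exists_pair h1
  let K : (Fin 2 →₀ ℕ) → ℤ := fun x => a * x 0 + b * x 1
  obtain ⟨y₀, hy₀, hmin⟩ := (sideSupport g α β m).exists_min_image K ⟨x₁, hx₁⟩
  obtain ⟨y₁, hy₁, hmax⟩ := (sideSupport g α β m).exists_max_image K ⟨x₁, hx₁⟩
  have hlt : K y₀ < K y₁ := by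
    by_contra hcon
    push Not at hcon
    refine hne (h.coord_injOn (mem_sideSupport.1 hx₁).2 (mem_sideSupport.1 hx₂).2 ?_)
    have a1 := hmin _ hx₁
    have a2 := hmin _ hx₂
    have a3 := hmax _ hx₁
    have a4 := hmax _ hx₂
    change K x₁ = K x₂
    omega
  have hmem : ∀ x ∈ sideSupport g α β m, expPoint x ∈ Γ := fun x hx =>
    (h.mem_iff x (mem_sideSupport.1 hx).1).2 (mem_sideSupport.1 hx).2
  have hside : ∀ x ∈ g.support, expPoint x ∈ face (newtonPolygon g) ((α : ℝ), (β : ℝ)) →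
      x ∈ sideSupport g α β m := fun x hx hxΓ =>
    mem_sideSupport.2 ⟨hx, (h.mem_iff x hx).1 (h.eq_face ▸ hxΓ)⟩
  have hpt : ∀ i j : ℤ, α * i + β * j = m →
      (((i : ℝ), (j : ℝ)) ∈ Γ ↔ K y₀ ≤ a * i + b * j ∧ a * i + b * j ≤ K y₁) := by
    intro i j hij
    constructor
    · intro hΓ
      rw [h.eq_face] at hΓ
      have u1 := pairing_le_of_mem_face (ζ := ((a : ℝ), (b : ℝ))) (c := K y₁) (by
        intro x hx hxΓ
        have := hmax x (hside x hx hxΓ)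
        simp only [pairing, expPoint]
        exact_mod_cast this) hΓ
      have u2 := pairing_le_of_mem_face (ζ := ((-a : ℝ), (-b : ℝ))) (c := -K y₀) (by
        intro x hx hxΓ
        have := hmin x (hside x hx hxΓ)
        have : (K y₀ : ℝ) ≤ a * x 0 + b * x 1 := by exact_mod_cast this
        simp only [pairing, expPoint]
        linarith) hΓ
      simp only [pairing] at u1 u2
      refine ⟨?_, by exact_mod_cast u1⟩
      have : (K y₀ : ℝ) ≤ a * i + b * j := by linarith
      exact_mod_cast this
    · rintro ⟨u1, u2⟩
      have hd : (0 : ℝ) < K y₁ - K y₀ := by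
        have : (K y₀ : ℝ) < K y₁ := by exact_mod_cast hlt
        linarith
      have m0 := hmem y₀ hy₀
      have m1 := hmem y₁ hy₁
      have e0 := h.coord_eq (mem_sideSupport.1 hy₀).2
      have e1 := h.coord_eq (mem_sideSupport.1 hy₁).2
      have e := h.coord_eq hij
      rw [h.eq_face] at m0 m1 ⊢
      -- Relative position of the lattice point between the two extreme exponents of the side.
      set θ : ℝ := ((a * i + b * j : ℤ) - K y₀) / (K y₁ - K y₀) with hθ
      have hθ0 : 0 ≤ θ := div_nonneg (by
        have : (K y₀ : ℝ) ≤ (a * i + b * j : ℤ) := by exact_mod_cast u1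
        linarith) hd.le
      have hθ1 : θ ≤ 1 := (div_le_one hd).2 (by
        have : ((a * i + b * j : ℤ) : ℝ) ≤ K y₁ := by exact_mod_cast u2
        linarith)
      have hθe : ((a * i + b * j : ℤ) : ℝ) = K y₀ + θ * (K y₁ - K y₀) := by
        rw [hθ, div_mul_cancel₀ _ hd.ne']; ring
      have hcomb : ((i : ℝ), (j : ℝ)) = (1 - θ) • expPoint y₀ + θ • expPoint y₁ := by
        have f0 : (i : ℝ) = b * m - β * (a * i + b * j : ℤ) := by exact_mod_cast e.1
        have f1 : (j : ℝ) = α * (a * i + b * j : ℤ) - a * m := by exact_mod_cast e.2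
        have g0 : (y₀ 0 : ℝ) = b * m - β * (K y₀ : ℤ) := by exact_mod_cast e0.1
        have g1 : (y₀ 1 : ℝ) = α * (K y₀ : ℤ) - a * m := by exact_mod_cast e0.2
        have k0 : (y₁ 0 : ℝ) = b * m - β * (K y₁ : ℤ) := by exact_mod_cast e1.1
        have k1 : (y₁ 1 : ℝ) = α * (K y₁ : ℤ) - a * m := by exact_mod_cast e1.2
        refine Prod.ext ?_ ?_
        · simp only [expPoint, Prod.fst_add, Prod.smul_fst, smul_eq_mul]
          rw [f0, g0, k0, hθe]; ring
        · simp only [expPoint, Prod.snd_add, Prod.smul_snd, smul_eq_mul]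
          rw [f1, g1, k1, hθe]; ring
      refine ⟨?_, fun z hz => ?_⟩
      · rw [hcomb]
        exact convex_convexHull ℝ _ m0.1 m1.1 (by linarith) hθ0 (by ring)
      · have := m0.2 z hz
        have hpe : pairing ((α : ℝ), (β : ℝ)) (expPoint y₀) = m := h.pairing_eq _ (hmem y₀ hy₀)
        rw [hpe] at this
        refine this.trans_eq ?_
        simp only [pairing]
        exact_mod_cast hij.symm
  -- The lattice points of Γ correspond to the integers between the extreme values of K, which
  -- identifies the lattice length with their difference.
  have hset : {q : ℤ × ℤ | ((q.1 : ℝ), (q.2 : ℝ)) ∈ Γ} =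
      (fun k : ℤ => ((b * m - β * k, α * k - a * m) : ℤ × ℤ)) '' (Finset.Icc (K y₀) (K y₁)) := by
    have hdet := h.det
    ext ⟨i, j⟩
    simp only [Set.mem_ofPred_eq, Set.mem_image, Finset.coe_Icc, Set.mem_Icc]
    constructor
    · intro hq
      have hij : α * i + β * j = m := by
        have := h.pairing_eq _ hq
        simp only [pairing] at this
        exact_mod_cast this
      exact ⟨a * i + b * j, (hpt i j hij).1 hq, Prod.ext (h.coord_eq hij).1.symm
        (h.coord_eq hij).2.symm⟩
    · rintro ⟨k, hk, hkq⟩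
      obtain ⟨rfl, rfl⟩ := Prod.mk.inj hkq
      refine (hpt _ _ (by linear_combination (m : ℤ) * hdet)).2 ?_
      rwa [show a * (b * m - β * k) + b * (α * k - a * m) = k by linear_combination k * hdet]
  have hlen : (latticeLength Γ : ℤ) = K y₁ - K y₀ := by
    have hinj : Function.Injective
        (fun k : ℤ => ((b * m - β * k, α * k - a * m) : ℤ × ℤ)) := by
      intro k l hkl
      obtain ⟨q1, q2⟩ := Prod.mk.inj hkl
      have hdet := h.det
      linear_combination (l - k) * hdet + a * q1 + b * q2
    rw [latticeLength, hset, Set.ncard_image_of_injective _ hinj, Set.ncard_coe_finset,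
      Int.card_Icc]
    omega
  have hlen' : K y₁ = K y₀ + latticeLength Γ := by omega
  refine ⟨K y₀, by omega, fun x hx => ⟨hmin x hx, hlen' ▸ hmax x hx⟩, ⟨y₀, hy₀, rfl⟩,
    ⟨y₁, hy₁, hlen'⟩, fun i j hij => ?_⟩
  rw [hpt i j hij, hlen']

end Chart

/-! ### The roots on a side -/

section Roots

variable {g : MvPolynomial (Fin 2) ℂ} {Γ : Set (ℝ × ℝ)} {α β a b : ℤ} {m : ℕ}

/-- The polynomial whose roots are the zeros of the truncation, in the chart of the side. -/
def sidePoly (g : MvPolynomial (Fin 2) ℂ) (α β a b : ℤ) (m : ℕ) (k₀ : ℤ) : Polynomial ℂ :=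
  ∑ x ∈ sideSupport g α β m, Polynomial.monomial (a * x 0 + b * x 1 - k₀).toNat (g.coeff x)

/-- Exponents on the line are separated by ai + bj, so at most one monomial contributes in a given
degree. The exponent need not occur in g: this is needed for zw, whose coefficient may be zero. -/
theorem IsSideChart.coeff_sidePoly (h : IsSideChart g Γ α β a b m) {k₀ : ℤ}
    (hk : ∀ x ∈ sideSupport g α β m, k₀ ≤ a * x 0 + b * x 1) {x : Fin 2 →₀ ℕ}
    (hx : α * x 0 + β * x 1 = m) {j : ℕ} (hj : a * x 0 + b * x 1 = k₀ + j) :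
    (sidePoly g α β a b m k₀).coeff j = g.coeff x := by
  rw [sidePoly, Polynomial.finsetSum_coeff]
  have : ∀ y ∈ sideSupport g α β m, y ≠ x →
      (Polynomial.monomial (a * y 0 + b * y 1 - k₀).toNat (g.coeff y)).coeff j = 0 := by
    intro y hy hyx
    rw [Polynomial.coeff_monomial, if_neg]
    intro hj'
    refine hyx (h.coord_injOn (mem_sideSupport.1 hy).2 hx ?_)
    have := hk y hy
    omega
  by_cases hxs : x ∈ sideSupport g α β m
  · rw [Finset.sum_eq_single_of_mem x hxs this, Polynomial.coeff_monomial, if_pos (by omega)]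
  · rw [Finset.sum_eq_zero fun y hy => this y hy (fun hyx => hxs (hyx ▸ hy))]
    by_contra hne
    exact hxs (mem_sideSupport.2 ⟨MvPolynomial.mem_support_iff.2 (Ne.symm hne), hx⟩)

theorem IsSideChart.chartPoly_zero_eq (h : IsSideChart g Γ α β a b m) {k₀ : ℤ}
    (hk : ∀ x ∈ sideSupport g α β m, k₀ ≤ a * x 0 + b * x 1) {s : ℂ} (hs : s ≠ 0) :
    chartPoly g α β a b m (0, s) = s ^ k₀ * (sidePoly g α β a b m k₀).eval s := by
  rw [h.chartPoly_zero, sidePoly, Polynomial.eval_finsetSum, Finset.mul_sum]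
  refine Finset.sum_congr rfl fun x hx => ?_
  have := hk x hx
  rw [Polynomial.eval_monomial, ← zpow_natCast, Int.toNat_of_nonneg (by omega),
    mul_left_comm, ← zpow_add₀ hs]
  congr 2
  ring

theorem IsSideChart.fderiv_eq_derivative (h : IsSideChart g Γ α β a b m) {k₀ : ℤ}
    (hk : ∀ x ∈ sideSupport g α β m, k₀ ≤ a * x 0 + b * x 1) {c : ℂ} (hc : c ≠ 0)
    (h0 : (sidePoly g α β a b m k₀).eval c = 0) :
    fderiv ℂ (chartPoly g α β a b m) (0, c) (0, 1) =
      c ^ k₀ * (sidePoly g α β a b m k₀).derivative.eval c := by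
  have h1 := h.hasDerivAt_fderiv (p := (0, c)) hc
  have h2 := ((hasDerivAt_zpow k₀ c (Or.inl hc)).mul
    ((sidePoly g α β a b m k₀).hasDerivAt c))
  have h3 : (fun s => chartPoly g α β a b m (0, s)) =ᶠ[𝓝 c]
      fun s => s ^ k₀ * (sidePoly g α β a b m k₀).eval s := by
    filter_upwards [isOpen_ne.mem_nhds hc] with s hs using h.chartPoly_zero_eq hk hs
  have h4 := h1.unique (h2.congr_of_eventuallyEq h3)
  rw [h4, h0, mul_zero, zero_add]

/-- The zeros of the truncation in the chart of a side: as many as the lattice length. -/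
theorem IsSideChart.exists_roots (h : IsSideChart g Γ α β a b m) (h1 : affineDim Γ = 1)
    (hnd : IsNewtonNondegenerate g) {k₀ : ℤ}
    (hk : ∀ x ∈ sideSupport g α β m,
      k₀ ≤ a * x 0 + b * x 1 ∧ a * x 0 + b * x 1 ≤ k₀ + latticeLength Γ)
    (hk0 : ∃ x ∈ sideSupport g α β m, a * x 0 + b * x 1 = k₀)
    (hk1 : ∃ x ∈ sideSupport g α β m, a * x 0 + b * x 1 = k₀ + latticeLength Γ) :
    (sidePoly g α β a b m k₀).natDegree = latticeLength Γ ∧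
    ∃ c : Fin (latticeLength Γ) → ℂ, Function.Injective c ∧ (∀ n, c n ≠ 0) ∧
      (∀ n, (sidePoly g α β a b m k₀).eval (c n) = 0) ∧
      sidePoly g α β a b m k₀ = Polynomial.C (sidePoly g α β a b m k₀).leadingCoeff *
        ∏ n, (Polynomial.X - Polynomial.C (c n)) := by
  have hkl : ∀ x ∈ sideSupport g α β m, k₀ ≤ a * x 0 + b * x 1 := fun x hx => (hk x hx).1
  set q := sidePoly g α β a b m k₀ with hq
  obtain ⟨x₀, hx₀, hx₀k⟩ := hk0
  obtain ⟨x₁, hx₁, hx₁k⟩ := hk1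
  -- The extreme coefficients belong to exponents that occur in g; hence 0 is not a root and the
  -- degree is the full lattice length.
  have hc0 : q.coeff 0 ≠ 0 := by
    rw [hq, h.coeff_sidePoly hkl (mem_sideSupport.1 hx₀).2 (by simpa using hx₀k)]
    exact MvPolynomial.mem_support_iff.1 (mem_sideSupport.1 hx₀).1
  have hcn : q.coeff (latticeLength Γ) ≠ 0 := by
    rw [hq, h.coeff_sidePoly hkl (mem_sideSupport.1 hx₁).2 hx₁k]
    exact MvPolynomial.mem_support_iff.1 (mem_sideSupport.1 hx₁).1
  have hq0 : q ≠ 0 := by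
    rintro h0
    rw [h0] at hc0
    simp at hc0
  have hdeg : q.natDegree = latticeLength Γ := by
    refine le_antisymm ?_ (Polynomial.le_natDegree_of_ne_zero hcn)
    refine Polynomial.natDegree_sum_le_of_forall_le _ _ fun x hx => ?_
    refine (Polynomial.natDegree_monomial_le _).trans ?_
    have := hk x hx
    omega
  have hne : ∀ c, q.eval c = 0 → c ≠ 0 := by
    rintro c hc rfl
    exact hc0 (by rwa [Polynomial.coeff_zero_eq_eval_zero])
  -- A multiple root would be a common zero of F(0, s) and its s-derivative, which non-degeneracy
  -- excludes.
  have hnodup : q.roots.Nodup := by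
    rw [Multiset.nodup_iff_count_le_one]
    intro c
    rw [Polynomial.count_roots]
    by_contra hcon
    push Not at hcon
    obtain ⟨r1, r2⟩ := (Polynomial.one_lt_rootMultiplicity_iff_isRoot hq0).1 hcon
    have hc := hne c r1
    refine h.fderiv_ne_zero h1 hnd hc ?_ ?_
    · rw [h.chartPoly_zero_eq hkl hc, ← hq, r1.eq_zero, mul_zero]
    · rw [h.fderiv_eq_derivative hkl hc r1, ← hq, r2.eq_zero, mul_zero]
  have hsplit : q.Splits := IsAlgClosed.splits q
  have hcard : q.roots.toFinset.card = latticeLength Γ := by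
    rw [Multiset.toFinset_card_of_nodup hnodup, ← hsplit.natDegree_eq_card_roots, hdeg]
  let E : Fin (latticeLength Γ) ≃ q.roots.toFinset := (q.roots.toFinset.equivFinOfCardEq hcard).symm
  have hE : ∀ n, q.eval (E n : ℂ) = 0 := fun n =>
    (Polynomial.mem_roots hq0).1 (Multiset.mem_toFinset.1 (E n).2)
  refine ⟨hdeg, fun n => E n, Subtype.val_injective.comp E.injective, fun n => hne _ (hE n), hE, ?_⟩
  have hprod : ∏ n, (Polynomial.X - Polynomial.C (E n : ℂ)) =
      (q.roots.map fun c => Polynomial.X - Polynomial.C c).prod := by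
    rw [E.prod_comp (fun c : q.roots.toFinset => Polynomial.X - Polynomial.C (c : ℂ)),
      Finset.prod_coe_sort q.roots.toFinset (fun c => Polynomial.X - Polynomial.C c),
      Finset.prod, Multiset.toFinset_val, hnodup.dedup]
  rw [hprod]
  exact hsplit.eq_prod_roots

end Roots

/-! ### The position of (1, 1) and the constants -/

section Constants

variable {g : MvPolynomial (Fin 2) ℂ} {Γ : Set (ℝ × ℝ)} {α β a b : ℤ} {m : ℕ}

theorem IsSideChart.eq_one_of_right_eq_zero (h : IsSideChart g Γ α β a b m) (hβ : β = 0) :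
    α = 1 ∧ a = 0 ∧ b = 1 := by
  have hdet := h.det
  rw [hβ, zero_mul, sub_zero] at hdet
  have hα : α = 1 := by
    rcases Int.eq_one_or_neg_one_of_mul_eq_one hdet with h1 | h1
    · exact h1
    · have := h.left_nonneg; omega
  exact ⟨hα, h.of_left_eq_one hα⟩

theorem IsSideChart.eq_one_of_left_eq_zero (h : IsSideChart g Γ α β a b m) (hα : α = 0) :
    β = 1 ∧ a = -1 ∧ b = 0 := by
  have hdet := h.det
  rw [hα, zero_mul, zero_sub, ← mul_neg] at hdet
  have hβ : β = 1 := by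
    rcases Int.eq_one_or_neg_one_of_mul_eq_one hdet with h1 | h1
    · exact h1
    · have := h.right_nonneg; omega
  exact ⟨hβ, h.of_right_eq_one (by omega) hβ⟩

theorem IsSideChart.mem_of_mem_polygon (h : IsSideChart g Γ α β a b m) {y : ℝ × ℝ}
    (hy : y ∈ newtonPolygon g) (hm : (m : ℝ) ≤ pairing ((α : ℝ), (β : ℝ)) y) : y ∈ Γ := by
  rw [h.eq_face]
  refine ⟨hy, fun z hz => ?_⟩
  refine (pairing_le_of_support (c := m) (fun x hx => ?_) hz).trans hm
  have := h.le_height x hx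
  simp only [pairing, expPoint]
  exact_mod_cast this

/-- The point `(1, 1)` lies on an outer side as soon as it lies on its line. -/
theorem IsSideChart.one_one_mem_iff (h : IsSideChart g Γ α β a b m) (h1 : affineDim Γ = 1)
    (hP : ContainsRectangles (newtonPolygon g)) :
    ((1 : ℝ), (1 : ℝ)) ∈ Γ ↔ α + β = m := by
  constructor
  · intro hΓ
    have := h.pairing_eq _ hΓ
    simp only [pairing, mul_one] at this
    exact_mod_cast this
  intro hm
  obtain ⟨k₀, hn, hk, ⟨x₀, hx₀, hx₀k⟩, ⟨x₁, hx₁, hx₁k⟩, hpt⟩ := h.exists_range h1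
  have hpt11 := hpt 1 1 (by linarith)
  simp only [Int.cast_one, mul_one] at hpt11
  rw [hpt11]
  have hdet := h.det
  have hα := h.left_nonneg
  have hβ := h.right_nonneg
  have e0 := h.coord_eq (mem_sideSupport.1 hx₀).2
  have e1 := h.coord_eq (mem_sideSupport.1 hx₁).2
  rw [hx₀k, ← hm] at e0
  rw [hx₁k, ← hm] at e1
  have f0 : (x₀ 1 : ℤ) = 1 - α * (a + b - k₀) := by rw [e0.2]; linear_combination hdet
  have f1 : (x₁ 0 : ℤ) = 1 - β * (k₀ + latticeLength Γ - (a + b)) := by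
    rw [e1.1]; linear_combination hdet
  constructor
  -- If (1, 1) came before the first endpoint, the z-exponent of the other endpoint would be
  -- negative unless β = 0. A vertical side on the line of (1, 1) contains (1, 0) by the rectangle
  -- condition, which contradicts the order. The other end is symmetric.
  · by_contra hcon
    push Not at hcon
    have hβ0 : β = 0 := by
      by_contra hne
      have h2 : 1 ≤ β := by omega
      have h3 : 2 ≤ k₀ + latticeLength Γ - (a + b) := by omega
      have : (0 : ℤ) ≤ x₁ 0 := Int.natCast_nonneg _
      nlinarith
    obtain ⟨hα1, ha, hb⟩ := h.eq_one_of_right_eq_zero hβ0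
    have hmem : ((1 : ℝ), (0 : ℝ)) ∈ Γ := by
      refine h.mem_of_mem_polygon (y := (1, 0)) ?_ ?_
      · have := rectangle_bottom hP (expPoint_mem (mem_sideSupport.1 hx₁).1)
        rw [hβ0, zero_mul, sub_zero] at f1
        have hc : ((x₁ 0 : ℕ) : ℝ) = 1 := by exact_mod_cast f1
        simpa [expPoint, hc] using this
      · rw [hα1, hβ0] at hm
        have : (m : ℝ) = 1 := by exact_mod_cast hm.symm
        simp [pairing, hα1, this]
    have := (hpt 1 0 (by rw [hα1, hβ0] at hm; rw [hα1, hβ0]; linarith)).1 (by simpa using hmem)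
    rw [ha, hb] at this
    rw [ha, hb] at hcon
    omega
  · by_contra hcon
    push Not at hcon
    have hα0 : α = 0 := by
      by_contra hne
      have h2 : 1 ≤ α := by omega
      have h3 : 2 ≤ a + b - k₀ := by omega
      have : (0 : ℤ) ≤ x₀ 1 := Int.natCast_nonneg _
      nlinarith
    obtain ⟨hβ1, ha, hb⟩ := h.eq_one_of_left_eq_zero hα0
    have hmem : ((0 : ℝ), (1 : ℝ)) ∈ Γ := by
      refine h.mem_of_mem_polygon (y := (0, 1)) ?_ ?_
      · have := rectangle_left hP (expPoint_mem (mem_sideSupport.1 hx₀).1)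
        rw [hα0, zero_mul, sub_zero] at f0
        have hc : ((x₀ 1 : ℕ) : ℝ) = 1 := by exact_mod_cast f0
        simpa [expPoint, hc] using this
      · rw [hα0, hβ1] at hm
        have : (m : ℝ) = 1 := by exact_mod_cast hm.symm
        simp [pairing, hβ1, this]
    have := (hpt 0 1 (by rw [hα0, hβ1] at hm; rw [hα0, hβ1]; linarith)).1 (by simpa using hmem)
    rw [ha, hb] at this
    rw [ha, hb] at hcon
    omega

theorem exists_eq_mul_of_unique_term {S : Finset (Fin 2 →₀ ℕ)} {A : (Fin 2 →₀ ℕ) → ℂ → ℂ → ℂ}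
    {x : Fin 2 →₀ ℕ} (hx : x ∈ S) {C : ℂ} (hC : C ≠ 0) {k : ℤ}
    (h0 : ∀ y ∈ S, y ≠ x → ∀ t s, A y t s = 0) (h1 : ∀ t s, A x t s = C * s ^ k) (t s : ℂ) :
    s ^ k = C⁻¹ * ∑ y ∈ S, A y t s := by
  rw [Finset.sum_eq_single_of_mem x hx fun y hy hyx => h0 y hy hyx t s, h1,
    inv_mul_cancel_left₀ hC]

/-- The endpoints differ by n(β, −α), where n is the lattice length, so one has z-exponent at least
β and the other w-exponent at least α. A further positive coordinate would raise the weight to α +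
β. So the endpoints lie on the axes, m = nαβ < α + β, and this leaves n = 1 and α = 1 or β = 1. -/
theorem IsSideChart.endpoints_of_lt (h : IsSideChart g Γ α β a b m) (h1 : affineDim Γ = 1)
    (hm : m < α + β) :
    1 ≤ α ∧ 1 ≤ β ∧ (α = 1 ∨ β = 1) ∧ (m : ℤ) = α * β ∧
      ∃ x₀ ∈ g.support, ∃ x₁ ∈ g.support, (x₀ 0 : ℤ) = β ∧ (x₀ 1 : ℤ) = 0 ∧
        (x₁ 0 : ℤ) = 0 ∧ (x₁ 1 : ℤ) = α := by
  obtain ⟨k₀, hn, hk, ⟨x₀, hx₀, hx₀k⟩, ⟨x₁, hx₁, hx₁k⟩, -⟩ := h.exists_range h1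
  have hdet := h.det
  have hm0 := h.height_ne_zero
  have hα : 1 ≤ α := by
    by_contra hcon
    have := h.eq_one_of_left_eq_zero (by have := h.left_nonneg; omega)
    omega
  have hβ : 1 ≤ β := by
    by_contra hcon
    have := h.eq_one_of_right_eq_zero (by have := h.right_nonneg; omega)
    omega
  obtain ⟨hs0, hl0⟩ := mem_sideSupport.1 hx₀
  obtain ⟨hs1, hl1⟩ := mem_sideSupport.1 hx₁
  have e0 := h.coord_eq hl0
  have e1 := h.coord_eq hl1
  rw [hx₀k] at e0
  rw [hx₁k] at e1
  have d0 : (x₀ 0 : ℤ) = x₁ 0 + latticeLength Γ * β := by rw [e0.1, e1.1]; ring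
  have d1 : (x₁ 1 : ℤ) = x₀ 1 + latticeLength Γ * α := by rw [e0.2, e1.2]; ring
  have hn1 : (1 : ℤ) ≤ latticeLength Γ := by omega
  have p0 : (0 : ℤ) ≤ x₁ 0 := Int.natCast_nonneg _
  have p1 : (0 : ℤ) ≤ x₀ 1 := Int.natCast_nonneg _
  have q0 : β ≤ x₀ 0 := by nlinarith
  have q1 : α ≤ x₁ 1 := by nlinarith
  have z0 : (x₀ 1 : ℤ) = 0 := by nlinarith
  have z1 : (x₁ 0 : ℤ) = 0 := by nlinarith
  rw [z1, zero_add] at d0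
  rw [z0, zero_add] at d1
  have hprod : α * β < α + β := by
    rw [z0, d0] at hl0
    nlinarith [mul_pos (show 0 < α by omega) (show 0 < β by omega)]
  have hone : α = 1 ∨ β = 1 := by
    by_contra hcon
    push Not at hcon
    have : 2 ≤ α := by omega
    have : 2 ≤ β := by omega
    nlinarith
  have hn2 : (latticeLength Γ : ℤ) = 1 := by
    rw [z0, d0] at hl0
    have : α * β * latticeLength Γ < α + β := by linarith
    by_contra hcon
    have h2 : (2 : ℤ) ≤ latticeLength Γ := by omega
    have h3 : α ≤ α * β := le_mul_of_one_le_right (by omega) hβ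
    have h4 : β ≤ α * β := le_mul_of_one_le_left (by omega) hα
    have h5 : α * β * 2 ≤ α * β * latticeLength Γ := mul_le_mul_of_nonneg_left h2 (by omega)
    omega
  rw [hn2, one_mul] at d0 d1
  rw [z0, d0, mul_zero, add_zero] at hl0
  exact ⟨hα, hβ, hone, hl0.symm, x₀, hs0, x₁, hs1, d0, z0, z1, d1⟩

/-- If `(1, 1)` lies beyond the line of the side, then `f` is linear in one of the variables and
the residue form is constant. -/
theorem IsSideChart.residue_const (h : IsSideChart g Γ α β a b m) (h1 : affineDim Γ = 1)
    (hm : m < α + β) :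
    ∃ C : ℂ, ∀ p : ℂ × ℂ, p.2 ≠ 0 →
      p.2 ^ (a + b - 1) = C * fderiv ℂ (chartPoly g α β a b m) p (0, 1) := by
  obtain ⟨hα, hβ, hone, hmm, x₀, hs0, x₁, hs1, d0, z0, z1, d1⟩ := h.endpoints_of_lt h1 hm
  -- For α = 1 the weight bound i + βj ≤ β leaves w as the only monomial with j ≥ 1. The s-exponent
  -- is j, so a single term survives in ∂F/∂s. For β = 1 the same holds with z.
  by_cases hα1 : α = 1
  · obtain ⟨ha, hb⟩ := h.of_left_eq_one hα1
    subst ha hb hα1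
    have hmβ : (m : ℤ) = β := by rw [hmm, one_mul]
    have hx1 : g.coeff x₁ ≠ 0 := MvPolynomial.mem_support_iff.1 hs1
    refine ⟨(g.coeff x₁)⁻¹, fun p hp => ?_⟩
    rw [h.fderiv_chartPoly hp]
    refine exists_eq_mul_of_unique_term (A := fun x t s => g.coeff x *
      t ^ ((m : ℤ) - (1 * x 0 + β * x 1)) * (((0 * x 0 + 1 * x 1 : ℤ) : ℂ) *
        s ^ (0 * (x 0 : ℤ) + 1 * x 1 - 1))) hs1 hx1 ?_ ?_ p.1 p.2
    · intro y hy hyx t s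
      have hle := h.le_height y hy
      have hy1 : y 1 = 0 := by
        by_contra hne
        have hy1 : (1 : ℤ) ≤ y 1 := by omega
        have hy0 : (0 : ℤ) ≤ y 0 := Int.natCast_nonneg _
        have hy1' : (y 1 : ℤ) = 1 := by
          by_contra hne'
          have h2 := mul_le_mul_of_nonneg_left (show (2 : ℤ) ≤ y 1 by omega) (by omega : 0 ≤ β)
          omega
        refine hyx (Finsupp.ext fun i => ?_)
        fin_cases i
        · have : (y 0 : ℤ) = x₁ 0 := by rw [hy1'] at hle; omega
          exact_mod_cast this
        · have : (y 1 : ℤ) = x₁ 1 := by omega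
          exact_mod_cast this
      simp [hy1]
    · intro t s
      simp only [z1, d1, hmβ]
      simp
  · have hβ1 := hone.resolve_left hα1
    obtain ⟨ha, hb⟩ := h.of_right_eq_one hα1 hβ1
    subst ha hb hβ1
    have hmα : (m : ℤ) = α := by rw [hmm, mul_one]
    have hx0 : -g.coeff x₀ ≠ 0 := neg_ne_zero.2 (MvPolynomial.mem_support_iff.1 hs0)
    refine ⟨(-g.coeff x₀)⁻¹, fun p hp => ?_⟩
    rw [h.fderiv_chartPoly hp]
    refine exists_eq_mul_of_unique_term (A := fun x t s => g.coeff x *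
      t ^ ((m : ℤ) - (α * x 0 + 1 * x 1)) * (((-1 * x 0 + 0 * x 1 : ℤ) : ℂ) *
        s ^ (-1 * (x 0 : ℤ) + 0 * x 1 - 1))) hs0 hx0 ?_ ?_ p.1 p.2
    · intro y hy hyx t s
      have hle := h.le_height y hy
      have hy1 : y 0 = 0 := by
        by_contra hne
        have hy1 : (1 : ℤ) ≤ y 0 := by omega
        have hy0 : (0 : ℤ) ≤ y 1 := Int.natCast_nonneg _
        have hy1' : (y 0 : ℤ) = 1 := by
          by_contra hne'
          have h2 := mul_le_mul_of_nonneg_left (show (2 : ℤ) ≤ y 0 by omega) (by omega : 0 ≤ α)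
          omega
        refine hyx (Finsupp.ext fun i => ?_)
        fin_cases i
        · have : (y 0 : ℤ) = x₀ 0 := by omega
          exact_mod_cast this
        · have : (y 1 : ℤ) = x₀ 1 := by rw [hy1'] at hle; omega
          exact_mod_cast this
      simp [hy1]
    · intro t s
      simp only [z0, d0, hmα]
      simp

/-- Here z = t⁻¹ and w = s, so p is F(0, ·) and the exponent a + b − 1 is 0. -/
theorem IsSideChart.vertical_constant (h : IsSideChart g Γ α β a b m) (h1 : affineDim Γ = 1)
    (hβ : β = 0) {c t : ℂ} (hc : c ≠ 0) :
    evalAt (MvPolynomial.pderiv 1 (truncation g ((α : ℝ), (β : ℝ))))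
      (1, (monomialChart α β a b t c).2) =
        fderiv ℂ (chartPoly g α β a b m) (0, c) (0, 1) / c ^ (a + b - 1) := by
  have hl := h.pderiv_transversal h1 hc
  obtain ⟨hα, ha, hb⟩ := h.eq_one_of_right_eq_zero hβ
  subst hβ hα ha hb
  simp only [monomialChart] at hl ⊢
  simp only [Int.cast_zero, zero_mul, zero_add, Int.cast_one, one_mul, one_zpow, zpow_one,
    zpow_zero, neg_zero, sub_self, div_one] at hl ⊢
  exact mul_left_cancel₀ hc hl

/-- Here z = s⁻¹ and w = t⁻¹. The minus sign and the factor s^(−2) come from dz = −s^(−2) ds. -/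
theorem IsSideChart.horizontal_constant (h : IsSideChart g Γ α β a b m) (h1 : affineDim Γ = 1)
    (hα : α = 0) {c t : ℂ} (hc : c ≠ 0) :
    evalAt (MvPolynomial.pderiv 0 (truncation g ((α : ℝ), (β : ℝ))))
      ((monomialChart α β a b t c).1, 1) =
        -(fderiv ℂ (chartPoly g α β a b m) (0, c) (0, 1) / c ^ (a + b - 1)) := by
  have hl := h.pderiv_transversal h1 hc
  obtain ⟨hβ, ha, hb⟩ := h.eq_one_of_left_eq_zero hα
  subst hβ hα ha hb
  simp only [monomialChart] at hl ⊢
  simp only [Int.cast_zero, zero_mul, add_zero, one_mul, one_zpow, mul_one,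
    zpow_zero, neg_zero, Int.cast_neg, Int.cast_one, neg_mul] at hl ⊢
  have h2 : c ^ (-1 - 1 : ℤ) = (c ^ 2)⁻¹ := by
    rw [show (-1 - 1 : ℤ) = -(2 : ℕ) by norm_num, zpow_neg, zpow_natCast]
  rw [h2, div_inv_eq_mul]
  rw [zpow_neg_one] at hl ⊢
  field_simp at hl ⊢
  linear_combination -hl

/-- The constants on an oblique side through `(1, 1)`. -/
theorem IsSideChart.oblique_constant (h : IsSideChart g Γ α β a b m)
    (hm : α + β = m) (hα : α ≠ 0) (hβ : β ≠ 0) (hmem : ((1 : ℝ), (1 : ℝ)) ∈ Γ) {k₀ : ℤ}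
    (hn : 0 < latticeLength Γ)
    (hk : ∀ x ∈ sideSupport g α β m,
      k₀ ≤ a * x 0 + b * x 1 ∧ a * x 0 + b * x 1 ≤ k₀ + latticeLength Γ)
    (hk0 : ∃ x ∈ sideSupport g α β m, a * x 0 + b * x 1 = k₀)
    (hk1 : ∃ x ∈ sideSupport g α β m, a * x 0 + b * x 1 = k₀ + latticeLength Γ)
    (hpt : ∀ i j : ℤ, α * i + β * j = m →
      (((i : ℝ), (j : ℝ)) ∈ Γ ↔ k₀ ≤ a * i + b * j ∧ a * i + b * j ≤ k₀ + latticeLength Γ))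
    (hdeg : (sidePoly g α β a b m k₀).natDegree = latticeLength Γ)
    {c κ : Fin (latticeLength Γ) → ℂ} (hinj : Function.Injective c) (hc : ∀ n, c n ≠ 0)
    (hroot : ∀ n, (sidePoly g α β a b m k₀).eval (c n) = 0) (hκ0 : ∀ n, κ n ≠ 0)
    (hκ : ∀ n, κ n = c n ^ (a + b - 1) /
      fderiv ℂ (chartPoly g α β a b m) (0, c n) (0, 1)) :
    ∃ s : ℂ, s ≠ 0 ∧
      s ^ 2 = g.coeff (expo 1 1) ^ 2 - 4 * g.coeff (expo 2 0) * g.coeff (expo 0 2) ∧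
      ∀ n, κ n = if (n : ℕ) = 0 then -s⁻¹ else s⁻¹ := by
  have hkl : ∀ x ∈ sideSupport g α β m, k₀ ≤ a * x 0 + b * x 1 := fun x hx => (hk x hx).1
  have hdet := h.det
  have hα1 : 1 ≤ α := by have := h.left_nonneg; omega
  have hβ1 : 1 ≤ β := by have := h.right_nonneg; omega
  obtain ⟨x₀, hx₀, hx₀k⟩ := hk0
  obtain ⟨x₁, hx₁, hx₁k⟩ := hk1
  have e0 := h.coord_eq (mem_sideSupport.1 hx₀).2
  have e1 := h.coord_eq (mem_sideSupport.1 hx₁).2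
  rw [hx₀k, ← hm] at e0
  rw [hx₁k, ← hm] at e1
  have f0 : (x₀ 1 : ℤ) = 1 - α * (a + b - k₀) := by rw [e0.2]; linear_combination hdet
  have f1 : (x₁ 0 : ℤ) = 1 - β * (k₀ + latticeLength Γ - (a + b)) := by
    rw [e1.1]; linear_combination hdet
  have hr := (hpt 1 1 (by linarith)).1 (by simpa using hmem)
  rw [mul_one, mul_one] at hr
  -- Exponents are non-negative and α, β ≥ 1, so each endpoint is at most one lattice step from (1,
  -- 1); the lattice length is therefore at most 2.
  have g0 : a + b - k₀ ≤ 1 := by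
    by_contra hcon
    push Not at hcon
    have : (0 : ℤ) ≤ x₀ 1 := Int.natCast_nonneg _
    nlinarith
  have g1 : k₀ + latticeLength Γ - (a + b) ≤ 1 := by
    by_contra hcon
    push Not at hcon
    have : (0 : ℤ) ≤ x₁ 0 := Int.natCast_nonneg _
    nlinarith
  set q := sidePoly g α β a b m k₀ with hq
  have hexpo0 : ∀ i j : ℕ, (expo i j) 0 = i := fun i j => by simp [expo]
  have hexpo1 : ∀ i j : ℕ, (expo i j) 1 = j := fun i j => by simp [expo]
  have hcoeff11 : ∀ j : ℕ, a + b = k₀ + j → q.coeff j = g.coeff (expo 1 1) := by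
    intro j hj
    refine h.coeff_sidePoly hkl ?_ ?_
    · rw [hexpo0, hexpo1]; push_cast; linarith
    · rw [hexpo0, hexpo1]; push_cast; linarith
  have hκinv : ∀ n, (κ n)⁻¹ = c n ^ (k₀ - (a + b - 1)) * q.derivative.eval (c n) := by
    intro n
    rw [hκ n, inv_div, h.fderiv_eq_derivative hkl (hc n) (hroot n), ← hq,
      zpow_sub₀ (hc n) k₀ (a + b - 1)]
    generalize c n ^ (a + b - 1) = y
    ring
  have hn2 : latticeLength Γ = 1 ∨ latticeLength Γ = 2 := by omega
  -- the claim reduces to a statement about the inverse constants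
  suffices hmain : (∀ n, (κ n)⁻¹ ^ 2 =
      g.coeff (expo 1 1) ^ 2 - 4 * g.coeff (expo 2 0) * g.coeff (expo 0 2)) ∧
      ∀ n n', n ≠ n' → (κ n)⁻¹ = -(κ n')⁻¹ by
    refine ⟨-(κ ⟨0, hn⟩)⁻¹, neg_ne_zero.2 (inv_ne_zero (hκ0 _)), ?_, fun n => ?_⟩
    · rw [neg_sq, hmain.1]
    · split_ifs with h0
      · rw [inv_neg, inv_inv, neg_neg]
        congr 1
        exact Fin.ext h0
      · rw [← hmain.2 n ⟨0, hn⟩ (fun he => h0 (by rw [he])), inv_inv]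
  rcases hn2 with hn2 | hn2
  -- If z² and w² both occurred, then α = β = 1 and the side would have lattice length 2. So here
  -- the discriminant is the square of the coefficient of zw.
  · have hprod : g.coeff (expo 2 0) * g.coeff (expo 0 2) = 0 := by
      by_contra hne
      have n0 := h.le_height _ (MvPolynomial.mem_support_iff.2 (left_ne_zero_of_mul hne))
      have n1 := h.le_height _ (MvPolynomial.mem_support_iff.2 (right_ne_zero_of_mul hne))
      rw [hexpo0, hexpo1] at n0 n1
      push_cast at n0 n1
      have hαβ : α = β := by omega
      rw [hαβ, ← mul_sub] at hdet
      have hβ' : β = 1 := by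
        rcases Int.eq_one_or_neg_one_of_mul_eq_one hdet with h2 | h2 <;> omega
      have r0 := hk (expo 2 0) (mem_sideSupport.2
        ⟨MvPolynomial.mem_support_iff.2 (left_ne_zero_of_mul hne), by
          rw [hexpo0, hexpo1]; push_cast; omega⟩)
      have r1 := hk (expo 0 2) (mem_sideSupport.2
        ⟨MvPolynomial.mem_support_iff.2 (right_ne_zero_of_mul hne), by
          rw [hexpo0, hexpo1]; push_cast; omega⟩)
      rw [hexpo0, hexpo1] at r0 r1
      push_cast at r0 r1
      rw [hβ', one_mul] at hdet
      omega
    refine ⟨fun n => ?_, fun n n' hnn => absurd (Fin.ext (by omega)) hnn⟩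
    have hq1 : q = Polynomial.C (q.coeff 1) * Polynomial.X + Polynomial.C (q.coeff 0) :=
      Polynomial.eq_X_add_C_of_natDegree_le_one (by rw [hdeg, hn2])
    have hd : q.derivative.eval (c n) = q.coeff 1 := by
      conv_lhs => rw [hq1]
      simp
    have hz : q.coeff 1 * c n + q.coeff 0 = 0 := by
      have := hroot n
      rw [hq1] at this
      simpa using this
    rw [mul_assoc, hprod, mul_zero, sub_zero, hκinv n, hd]
    -- The point (1, 1) is one of the two endpoints. The inverse constant is minus the coefficient
    -- of zw if it is the first, and that coefficient if it is the last.
    rcases (show a + b = k₀ + (0 : ℕ) ∨ a + b = k₀ + (1 : ℕ) by push_cast; omega) with hj | hj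
    · rw [← hcoeff11 0 hj, show k₀ - (a + b - 1) = 1 by push_cast at hj; omega, zpow_one]
      linear_combination (q.coeff 1 * c n - q.coeff 0) * hz
    · rw [← hcoeff11 1 hj, show k₀ - (a + b - 1) = 0 by push_cast at hj; omega, zpow_zero, one_mul]
  -- Now (1, 1) is the midpoint, α = β = 1 and q is quadratic. The inverse constants are q'(c) at
  -- its two roots: opposite numbers whose square is the discriminant.
  · have hk1 : a + b = k₀ + (1 : ℕ) := by push_cast; omega
    rw [hn2] at f1
    push_cast at f1 hk1
    have hα' : α = 1 := by
      have : (0 : ℤ) ≤ x₀ 1 := Int.natCast_nonneg _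
      rw [hk1] at f0
      nlinarith
    have hβ' : β = 1 := by
      have : (0 : ℤ) ≤ x₁ 0 := Int.natCast_nonneg _
      rw [hk1] at f1
      nlinarith
    obtain ⟨ha, hb⟩ := h.of_left_eq_one hα'
    have hc0 : q.coeff 0 = g.coeff (expo 2 0) := by
      refine h.coeff_sidePoly hkl ?_ ?_
      · rw [hexpo0, hexpo1]; push_cast; omega
      · rw [hexpo0, hexpo1, ha, hb]; push_cast; omega
    have hc2 : q.coeff 2 = g.coeff (expo 0 2) := by
      refine h.coeff_sidePoly hkl ?_ ?_
      · rw [hexpo0, hexpo1]; push_cast; omega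
      · rw [hexpo0, hexpo1, ha, hb]; push_cast; omega
    have hc1 := hcoeff11 1 (by exact_mod_cast hk1)
    have hqe : q = Polynomial.C (q.coeff 0) + Polynomial.C (q.coeff 1) * Polynomial.X +
        Polynomial.C (q.coeff 2) * Polynomial.X ^ 2 := by
      conv_lhs => rw [q.as_sum_range_C_mul_X_pow, hdeg, hn2]
      simp [Finset.sum_range_succ]
    have hd : ∀ x, q.derivative.eval x = q.coeff 1 + 2 * q.coeff 2 * x := by
      intro x
      conv_lhs => rw [hqe]
      simp
      ring
    have hz : ∀ n, q.coeff 0 + q.coeff 1 * c n + q.coeff 2 * c n ^ 2 = 0 := by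
      intro n
      have := hroot n
      rw [hqe] at this
      simpa using this
    have hinv : ∀ n, (κ n)⁻¹ = q.coeff 1 + 2 * q.coeff 2 * c n := by
      intro n
      rw [hκinv n, hd, show k₀ - (a + b - 1) = 0 by omega, zpow_zero, one_mul]
    refine ⟨fun n => ?_, fun n n' hnn => ?_⟩
    · rw [hinv, ← hc0, ← hc1, ← hc2]
      linear_combination 4 * q.coeff 2 * hz n
    · rw [hinv, hinv]
      have hsub : c n - c n' ≠ 0 := sub_ne_zero.2 (hinj.ne hnn)
      have : (c n - c n') * (q.coeff 1 + q.coeff 2 * (c n + c n')) = 0 := by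
        linear_combination hz n - hz n'
      linear_combination 2 * (mul_eq_zero.1 this).resolve_left hsub

end Constants

/-! ### Branch systems of a side -/

theorem zpow_mem_Icc_of_mem {M x : ℝ} (hM : 1 ≤ M) (h : x ∈ Set.Icc M⁻¹ M) (n : ℤ) :
    x ^ n ∈ Set.Icc (M ^ n.natAbs)⁻¹ (M ^ n.natAbs) := by
  have hM0 : 0 < M := by linarith
  have hx : 0 < x := (inv_pos.2 hM0).trans_le h.1
  have key : x ^ n.natAbs ∈ Set.Icc (M ^ n.natAbs)⁻¹ (M ^ n.natAbs) := by
    refine ⟨?_, pow_le_pow_left₀ hx.le h.2 _⟩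
    rw [← inv_pow]
    exact pow_le_pow_left₀ (inv_nonneg.2 hM0.le) h.1 _
  rcases Int.natAbs_eq n with hn | hn
  · have : x ^ n = x ^ n.natAbs := by conv_lhs => rw [hn, zpow_natCast]
    rwa [this]
  · have : x ^ n = (x ^ n.natAbs)⁻¹ := by conv_lhs => rw [hn, zpow_neg, zpow_natCast]
    rw [this]
    exact ⟨inv_anti₀ (pow_pos hx _) key.2,
      inv_le_of_inv_le₀ (pow_pos hM0 _) key.1⟩

theorem eventually_forall_mem_ball {Q : ℂ × ℂ → Prop} (h : ∀ᶠ p in 𝓝 (0 : ℂ × ℂ), Q p) :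
    ∀ᶠ ε in 𝓝[>] (0 : ℝ), ∀ p ∈ ball (0 : ℂ × ℂ) ε, Q p := by
  obtain ⟨r, hr, hQ⟩ := Metric.eventually_nhds_iff_ball.1 h
  filter_upwards [Ioo_mem_nhdsGT hr] with ε hε p hp
  exact hQ p (ball_subset_ball hε.2.le hp)

/-- A complete system of normal branches that belong to one side. -/
structure IsBranchSystem (g : MvPolynomial (Fin 2) ℂ) (Γ : Set (ℝ × ℝ)) (α β a b : ℤ) (m : ℕ)
    (c κ : Fin (latticeLength Γ) → ℂ) (υ σ : Fin (latticeLength Γ) → ℂ × ℂ → ℂ) (M ε : ℝ) :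
    Prop where
  chart : IsSideChart g Γ α β a b m
  dim : affineDim Γ = 1
  branch : ∀ n, NormalBranch (chartPoly g α β a b m) (c n) m (a + b - 1) (m - α - β - 1) (κ n) ε
    (υ n) (σ n)
  one_le : 1 ≤ M
  left_mem : ∀ n, ∀ p ∈ ball (0 : ℂ × ℂ) ε, ‖υ n p‖ ∈ Set.Icc M⁻¹ M
  right_mem : ∀ n, ∀ p ∈ ball (0 : ℂ × ℂ) ε, ‖σ n p‖ ∈ Set.Icc M⁻¹ M
  separated : ∀ n n', n ≠ n' → ∀ p ∈ ball (0 : ℂ × ℂ) ε, ∀ p' ∈ ball (0 : ℂ × ℂ) ε,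
    σ n p ≠ σ n' p'
  factor : ∃ k₀ : ℤ, ∃ A : ℂ, A ≠ 0 ∧ ∀ s : ℂ, s ≠ 0 →
    chartPoly g α β a b m (0, s) = s ^ k₀ * (A * ∏ n, (s - c n))
  root_ne_zero : ∀ n, c n ≠ 0
  const_ne_zero : ∀ n, κ n ≠ 0
  const_eq_one : ((1 : ℝ), (1 : ℝ)) ∉ Γ → ∀ n, κ n = 1
  const_eq : ((1 : ℝ), (1 : ℝ)) ∈ Γ → ∀ n, κ n = c n ^ (a + b - 1) /
    fderiv ℂ (chartPoly g α β a b m) (0, c n) (0, 1)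
  const_oblique : ((1 : ℝ), (1 : ℝ)) ∈ Γ → α ≠ 0 → β ≠ 0 → ∃ s : ℂ, s ≠ 0 ∧
      s ^ 2 = g.coeff (expo 1 1) ^ 2 - 4 * g.coeff (expo 2 0) * g.coeff (expo 0 2) ∧
      ∀ n, κ n = if (n : ℕ) = 0 then -s⁻¹ else s⁻¹

section System

variable {g : MvPolynomial (Fin 2) ℂ} {Γ : Set (ℝ × ℝ)} {α β a b : ℤ} {m : ℕ}
  {c κ : Fin (latticeLength Γ) → ℂ} {υ σ : Fin (latticeLength Γ) → ℂ × ℂ → ℂ} {M ε : ℝ}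

theorem IsBranchSystem.mono (h : IsBranchSystem g Γ α β a b m c κ υ σ M ε) {ε' : ℝ}
    (hε : ε' ≤ ε) : IsBranchSystem g Γ α β a b m c κ υ σ M ε' where
  chart := h.chart
  dim := h.dim
  branch n := (h.branch n).mono hε
  one_le := h.one_le
  left_mem n p hp := h.left_mem n p (ball_subset_ball hε hp)
  right_mem n p hp := h.right_mem n p (ball_subset_ball hε hp)
  separated n n' hn p hp p' hp' :=
    h.separated n n' hn p (ball_subset_ball hε hp) p' (ball_subset_ball hε hp')
  factor := h.factor
  root_ne_zero := h.root_ne_zero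
  const_ne_zero := h.const_ne_zero
  const_eq_one := h.const_eq_one
  const_eq := h.const_eq
  const_oblique := h.const_oblique

/-- One normal branch per root, shrunk to a common radius: there are finitely many, each continuous
at the origin with non-zero values, and distinct roots have disjoint neighbourhoods. The exponent e
is below −1 only if m < α + β, where `IsSideChart.residue_const` applies, and e = −1 exactly when
(1, 1) ∈ Γ. -/
theorem IsSideChart.exists_isBranchSystem (h : IsSideChart g Γ α β a b m) (h1 : affineDim Γ = 1)
    (hP : ContainsRectangles (newtonPolygon g)) (hnd : IsNewtonNondegenerate g) :
    ∃ c κ υ σ M, ∃ ε > 0, IsBranchSystem g Γ α β a b m c κ υ σ M ε := by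
  obtain ⟨k₀, hn, hk, hk0, hk1, hpt⟩ := h.exists_range h1
  have hkl : ∀ x ∈ sideSupport g α β m, k₀ ≤ a * x 0 + b * x 1 := fun x hx => (hk x hx).1
  obtain ⟨hdeg, c, hinj, hc, hroot, hfac⟩ := h.exists_roots h1 hnd hk hk0 hk1
  have h0 : ∀ n, chartPoly g α β a b m (0, c n) = 0 := fun n => by
    rw [h.chartPoly_zero_eq hkl (hc n), hroot, mul_zero]
  have h11 := h.one_one_mem_iff h1 hP
  have he : -1 ≤ (m : ℤ) - α - β - 1 ∨ ∃ C : ℂ, ∀ p : ℂ × ℂ, p.2 ≠ 0 →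
      p.2 ^ (a + b - 1) = C * fderiv ℂ (chartPoly g α β a b m) p (0, 1) := by
    by_cases hm : m < α + β
    · exact Or.inr (h.residue_const h1 hm)
    · left; omega
  have hex := fun n => exists_normalBranch h.height_ne_zero
    (fun p hp => h.analyticAt_chartPoly hp) (hc n) (h0 n)
    (h.fderiv_ne_zero h1 hnd (hc n) (h0 n)) (a + b - 1) (m - α - β - 1) he
  choose κ hκ0 hκ1 hκ2 ε₀ hε₀ υ σ hbr using hex
  have hz : ∀ n, (0 : ℂ × ℂ) ∈ ball (0 : ℂ × ℂ) (ε₀ n) := fun n => mem_ball_self (hε₀ n)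
  have hσ0 : ∀ n, σ n 0 = c n := fun n => (hbr n).right_zero 0 (hz n)
  have hυc : ∀ n, ContinuousAt (υ n) 0 := fun n => ((hbr n).contDiffAt_left 0 (hz n)).continuousAt
  have hσc : ∀ n, ContinuousAt (σ n) 0 := fun n => ((hbr n).contDiffAt_right 0 (hz n)).continuousAt
  have hbd : ∀ x : ℂ, x ≠ 0 → ∀ᶠ M in atTop, ‖x‖ ∈ Set.Ioo M⁻¹ M := fun x hx =>
    ((tendsto_inv_atTop_zero (𝕜 := ℝ)).eventually (gt_mem_nhds (norm_pos_iff.2 hx))).and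
      (eventually_gt_atTop ‖x‖)
  obtain ⟨M, hM1, hMυ, hMσ⟩ := ((eventually_ge_atTop (1 : ℝ)).and
    ((eventually_all.2 fun n => hbd _ ((hbr n).left_ne_zero 0 (hz n))).and
      (eventually_all.2 fun n => hbd _ ((hbr n).right_ne_zero 0 (hz n))))).exists
  have E1 : ∀ᶠ ε in 𝓝[>] (0 : ℝ), ∀ n, ε ≤ ε₀ n := eventually_all.2 fun n => by
    filter_upwards [Ioo_mem_nhdsGT (hε₀ n)] with ε hε using hε.2.le
  have E2 : ∀ᶠ ε in 𝓝[>] (0 : ℝ), ∀ n, ∀ p ∈ ball (0 : ℂ × ℂ) ε, ‖υ n p‖ ∈ Set.Icc M⁻¹ M :=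
    eventually_all.2 fun n => eventually_forall_mem_ball
      (((hυc n).norm.eventually (Ioo_mem_nhds (hMυ n).1 (hMυ n).2)).mono
        fun _ hp => Set.Ioo_subset_Icc_self hp)
  have E3 : ∀ᶠ ε in 𝓝[>] (0 : ℝ), ∀ n, ∀ p ∈ ball (0 : ℂ × ℂ) ε, ‖σ n p‖ ∈ Set.Icc M⁻¹ M :=
    eventually_all.2 fun n => eventually_forall_mem_ball
      (((hσc n).norm.eventually (Ioo_mem_nhds (hMσ n).1 (hMσ n).2)).mono
        fun _ hp => Set.Ioo_subset_Icc_self hp)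
  have E4 : ∀ᶠ ε in 𝓝[>] (0 : ℝ), ∀ n n', n ≠ n' → ∀ p ∈ ball (0 : ℂ × ℂ) ε,
      ∀ p' ∈ ball (0 : ℂ × ℂ) ε, σ n p ≠ σ n' p' := by
    refine eventually_all.2 fun n => eventually_all.2 fun n' => ?_
    by_cases hnn : n = n'
    · exact Eventually.of_forall fun ε hne => absurd hnn hne
    obtain ⟨U, V, hU, hV, hnU, hnV, hUV⟩ := t2_separation (hinj.ne hnn)
    have e1 := eventually_forall_mem_ball
      ((hσc n).eventually (hU.mem_nhds (by rwa [hσ0])))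
    have e2 := eventually_forall_mem_ball
      ((hσc n').eventually (hV.mem_nhds (by rwa [hσ0])))
    filter_upwards [e1, e2] with ε f1 f2 _ p hp p' hp' heq
    exact Set.disjoint_left.1 hUV (f1 p hp) (heq ▸ f2 p' hp')
  obtain ⟨ε, hε, hε1, hε2, hε3, hε4⟩ :=
    ((eventually_mem_nhdsWithin (a := (0 : ℝ)) (s := Set.Ioi 0)).and
      (E1.and (E2.and (E3.and E4)))).exists
  have hκe : ((1 : ℝ), (1 : ℝ)) ∈ Γ → ∀ n, κ n = c n ^ (a + b - 1) /
      fderiv ℂ (chartPoly g α β a b m) (0, c n) (0, 1) := fun hΓ n => by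
    refine hκ2 n ?_
    have := h11.1 hΓ
    omega
  refine ⟨c, κ, υ, σ, M, ε, hε, h, h1, fun n => (hbr n).mono (hε1 n), hM1, hε2, hε3, hε4,
    ⟨k₀, (sidePoly g α β a b m k₀).leadingCoeff, ?_, fun s hs => ?_⟩, hc, hκ0,
    fun hΓ n => hκ1 n ?_, hκe, fun hΓ hα hβ => ?_⟩
  · rw [Polynomial.leadingCoeff_ne_zero]
    rintro hq
    rw [hq, Polynomial.natDegree_zero] at hdeg
    omega
  · rw [h.chartPoly_zero_eq hkl hs]
    conv_lhs => rw [hfac]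
    simp [Polynomial.eval_prod]
  · intro hcon
    exact hΓ (h11.2 (by omega))
  · exact h.oblique_constant (h11.1 hΓ) hα hβ hΓ hn hk hk0 hk1 hpt hdeg hinj hc hroot hκ0 (hκe hΓ)

theorem IsBranchSystem.chartPoly_root (h : IsBranchSystem g Γ α β a b m c κ υ σ M ε)
    (n : Fin (latticeLength Γ)) : chartPoly g α β a b m (0, c n) = 0 := by
  obtain ⟨k₀, A, -, hA⟩ := h.factor
  rw [hA _ (h.root_ne_zero n), Finset.prod_eq_zero (Finset.mem_univ n) (sub_self _), mul_zero,
    mul_zero]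

theorem IsBranchSystem.isNormalizingEmbedding {f : MvPolynomial (Fin 2) ℂ} {ξ₀ : ℂ}
    (h : IsBranchSystem (f - MvPolynomial.C ξ₀) Γ α β a b m c κ υ σ M ε)
    (n : Fin (latticeLength Γ)) :
    IsNormalizingEmbedding f ξ₀ Γ α β ε (κ n)
      (fun p => branchMap α β a b (υ n) (σ n) (p - (ξ₀, 0)))
      (fun p => branchHat α β a b (υ n) (σ n) (p - (ξ₀, 0))) ∧
    ∀ V ⊆ puncturedBidisc ξ₀ ε ε, IsOpen V →
      IsOpen ((fun p => branchMap α β a b (υ n) (σ n) (p - (ξ₀, 0))) '' V) := by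
  refine isNormalizingEmbedding_branch h.chart.det h.chart.left_nonneg h.chart.right_nonneg ?_
    (h.const_ne_zero n) (h.branch n) ?_ ?_
  · intro u v huv
    have := h.chart.pairing_eq _ huv
    simp only [pairing] at this
    exact_mod_cast this
  · have hM : 0 < M := zero_lt_one.trans_le h.one_le
    have key : ∀ i j : ℤ, ∀ p ∈ ball (0 : ℂ × ℂ) ε,
        (M ^ i.natAbs)⁻¹ * (M ^ j.natAbs)⁻¹ ≤ ‖υ n p ^ i * σ n p ^ j‖ := by
      intro i j p hp
      rw [norm_mul, norm_zpow, norm_zpow]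
      exact mul_le_mul (zpow_mem_Icc_of_mem h.one_le (h.left_mem n p hp) i).1
        (zpow_mem_Icc_of_mem h.one_le (h.right_mem n p hp) j).1 (by positivity) (by positivity)
    refine ⟨min ((M ^ (-α).natAbs)⁻¹ * (M ^ a.natAbs)⁻¹) ((M ^ (-β).natAbs)⁻¹ * (M ^ b.natAbs)⁻¹),
      by positivity, fun p hp => ⟨(min_le_left _ _).trans (key _ _ p hp),
        (min_le_right _ _).trans (key _ _ p hp)⟩⟩
  · intro t ht
    rw [h.chart.truncation_add_C h.dim, h.chart.evalAt_truncation h.dim ht (h.root_ne_zero n),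
      h.chartPoly_root, mul_zero]

theorem IsBranchSystem.isNormalizingConstant {f : MvPolynomial (Fin 2) ℂ} {ξ₀ : ℂ}
    (h : IsBranchSystem (f - MvPolynomial.C ξ₀) Γ α β a b m c κ υ σ M ε) :
    IsNormalizingConstant f ξ₀ Γ α β ε κ
      (fun n p => branchHat α β a b (υ n) (σ n) (p - (ξ₀, 0))) := by
  have hcoeff : ∀ i j : ℕ, i + j ≠ 0 →
      (f - MvPolynomial.C ξ₀).coeff (expo i j) = f.coeff (expo i j) := by
    intro i j hij
    rw [MvPolynomial.coeff_sub, MvPolynomial.coeff_C, if_neg, sub_zero]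
    intro h0
    have e0 := DFunLike.congr_fun h0 0
    have e1 := DFunLike.congr_fun h0 1
    simp [expo] at e0 e1
    omega
  have hfd : ((1 : ℝ), (1 : ℝ)) ∈ Γ → ∀ n, κ n *
      (fderiv ℂ (chartPoly (f - MvPolynomial.C ξ₀) α β a b m) (0, c n) (0, 1) /
        c n ^ (a + b - 1)) = 1 := by
    intro hΓ n
    have h0 := h.const_ne_zero n
    rw [h.const_eq hΓ n] at h0 ⊢
    obtain ⟨h2, h3⟩ := div_ne_zero_iff.1 h0
    field_simp
  have hhat : ∀ n, ∀ ξ ∈ ball ξ₀ ε, ∃ t, branchHat α β a b (υ n) (σ n) ((ξ, 0) - (ξ₀, 0)) =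
      monomialChart α β a b t (c n) := by
    intro n ξ hξ
    have hp : ((ξ - ξ₀, 0) : ℂ × ℂ) ∈ ball (0 : ℂ × ℂ) ε :=
      mk_mem_ball_zero.2 ⟨mem_ball_iff_norm.1 hξ, by simpa using pos_of_mem_ball hξ⟩
    refine ⟨υ n (ξ - ξ₀, 0), ?_⟩
    rw [Prod.mk_sub_mk, sub_zero, branchHat, (h.branch n).right_zero _ hp]
  refine ⟨h.const_eq_one, fun hΓ hα hβ => ?_, fun hΓ hβ n ξ hξ => ?_, fun hΓ hα n ξ hξ => ?_⟩
  · have := h.const_oblique hΓ hα hβ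
    rwa [hcoeff 1 1 (by norm_num), hcoeff 2 0 (by norm_num), hcoeff 0 2 (by norm_num)] at this
  · obtain ⟨t, ht⟩ := hhat n ξ hξ
    simp only [ht]
    rw [h.chart.truncation_add_C h.dim, h.chart.vertical_constant h.dim hβ (h.root_ne_zero n)]
    exact hfd hΓ n
  · obtain ⟨t, ht⟩ := hhat n ξ hξ
    simp only [ht]
    rw [h.chart.truncation_add_C h.dim, h.chart.horizontal_constant h.dim hα (h.root_ne_zero n),
      mul_neg, hfd hΓ n]

end System

/-! ### Finiteness of the sides and disjointness of the branches -/

/-- For x ≤ 1 the power x^|d| is at most x, so a two-sided bound on x^d bounds x from below whatever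
the sign of d. -/
theorem inv_le_of_zpow_mem_Icc {B x : ℝ} (hB : 1 ≤ B) (hx : 0 < x) {d : ℤ} (hd : d ≠ 0)
    (h : x ^ d ∈ Set.Icc B⁻¹ B) : B⁻¹ ≤ x := by
  by_contra hcon
  push Not at hcon
  have hB0 : 0 < B := by linarith
  have hx1 : x ≤ 1 := hcon.le.trans (inv_le_one_of_one_le₀ hB)
  rcases lt_or_gt_of_ne hd with h0 | h0
  · have h1 : x ^ (-d) ≤ x := by
      simpa using zpow_le_zpow_right_of_le_one₀ hx hx1 (show 1 ≤ -d by omega)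
    have h2 : B⁻¹ ≤ x ^ (-d) := by
      rw [zpow_neg]
      exact inv_anti₀ (zpow_pos hx _) h.2
    linarith
  · have h1 : x ^ d ≤ x := by
      simpa using zpow_le_zpow_right_of_le_one₀ hx hx1 (show 1 ≤ d by omega)
    linarith [h.1]

theorem mul_mem_Icc_inv {A B x y : ℝ} (hA : 1 ≤ A) (hB : 1 ≤ B) (hx : x ∈ Set.Icc A⁻¹ A)
    (hy : y ∈ Set.Icc B⁻¹ B) : x * y ∈ Set.Icc (A * B)⁻¹ (A * B) := by
  have hA0 : 0 < A := by linarith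
  have hB0 : 0 < B := by linarith
  have hx0 : 0 < x := (inv_pos.2 hA0).trans_le hx.1
  have hy0 : 0 < y := (inv_pos.2 hB0).trans_le hy.1
  rw [mul_inv]
  exact ⟨mul_le_mul hx.1 hy.1 (inv_pos.2 hB0).le hx0.le, mul_le_mul hx.2 hy.2 hy0.le hA0.le⟩

section Sides

variable {g : MvPolynomial (Fin 2) ℂ} {Γ Γ' : Set (ℝ × ℝ)} {α β a b α' β' a' b' : ℤ} {m m' : ℕ}
  {c κ : Fin (latticeLength Γ) → ℂ} {υ σ : Fin (latticeLength Γ) → ℂ × ℂ → ℂ} {M ε : ℝ}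
  {c' κ' : Fin (latticeLength Γ') → ℂ} {υ' σ' : Fin (latticeLength Γ') → ℂ × ℂ → ℂ} {M' ε' : ℝ}

/-- Proportional primitive non-negative vectors divide each other coordinatewise, so they are equal,
and the normal determines the side. -/
theorem IsSideChart.eq_of_det_eq_zero (h : IsSideChart g Γ α β a b m)
    (h' : IsSideChart g Γ' α' β' a' b' m') (hd : α * β' - β * α' = 0) : Γ = Γ' := by
  have hc := h.isCoprime
  have hc' := h'.isCoprime
  have e1 : α = α' := Int.dvd_antisymm h.left_nonneg h'.left_nonneg
    (hc.dvd_of_dvd_mul_left ⟨β', by linarith⟩)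
    (hc'.dvd_of_dvd_mul_right ⟨β, by linarith⟩)
  have e2 : β = β' := Int.dvd_antisymm h.right_nonneg h'.right_nonneg
    (hc.symm.dvd_of_dvd_mul_left ⟨α', by linarith⟩)
    (hc'.symm.dvd_of_dvd_mul_right ⟨α, by linarith⟩)
  rw [h.eq_face, h'.eq_face, e1, e2]

/-- Two distinct exponents on a side determine its line and hence its normal, so sides inject into
pairs of exponents. -/
theorem finite_outerSides (hP : ContainsRectangles (newtonPolygon g))
    (hdim : affineDim (newtonPolygon g) = 2) : {Γ | IsOuterSide (newtonPolygon g) Γ}.Finite := by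
  have hex : ∀ Γ, ∃ q : (Fin 2 →₀ ℕ) × (Fin 2 →₀ ℕ), IsOuterSide (newtonPolygon g) Γ →
      q.1 ∈ g.support ∧ q.2 ∈ g.support ∧ expPoint q.1 ∈ Γ ∧ expPoint q.2 ∈ Γ ∧ q.1 ≠ q.2 := by
    intro Γ
    by_cases hΓ : IsOuterSide (newtonPolygon g) Γ
    · obtain ⟨⟨⟨η, hη⟩, h1⟩, -⟩ := hΓ
      obtain ⟨x, hx, y, hy, h2⟩ := exists_mem_support_of_face hη h1
      exact ⟨(x, y), fun _ => ⟨hx, hy, h2⟩⟩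
    · exact ⟨0, fun h => absurd h hΓ⟩
  choose q hq using hex
  refine Set.Finite.of_finite_image (f := q)
    ((g.support ×ˢ g.support).finite_toSet.subset ?_) ?_
  · rintro _ ⟨Γ, hΓ, rfl⟩
    have := hq Γ hΓ
    exact Finset.mem_product.2 ⟨this.1, this.2.1⟩
  · intro Γ hΓ Γ' hΓ' hqq
    obtain ⟨x0, y0, x1, y1, hxy⟩ := hq Γ hΓ
    obtain ⟨-, -, x2, y2, -⟩ := hq Γ' hΓ'
    rw [← hqq] at x2 y2
    obtain ⟨α, β, a, b, m, h⟩ := exists_isSideChart hP hdim hΓ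
    obtain ⟨α', β', a', b', m', h'⟩ := exists_isSideChart hP hdim hΓ'
    have f1 := h.coord_eq ((h.mem_iff _ x0).1 x1)
    have f2 := h.coord_eq ((h.mem_iff _ y0).1 y1)
    have g1 := (h'.mem_iff _ x0).1 x2
    have g2 := (h'.mem_iff _ y0).1 y2
    have hne : a * (q Γ).1 0 + b * (q Γ).1 1 - (a * (q Γ).2 0 + b * (q Γ).2 1) ≠ 0 := fun h0 =>
      hxy (h.coord_injOn ((h.mem_iff _ x0).1 x1) ((h.mem_iff _ y0).1 y1) (sub_eq_zero.1 h0))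
    refine h.eq_of_det_eq_zero h' ((mul_eq_zero.1 ?_).resolve_left hne)
    linear_combination g1 - g2 - α' * (f1.1 - f2.1) - β' * (f1.2 - f2.2)

theorem IsBranchSystem.branchMap_ne (h : IsBranchSystem g Γ α β a b m c κ υ σ M ε)
    {n n' : Fin (latticeLength Γ)} (hn : n ≠ n') {p p' : ℂ × ℂ} (hp : p ∈ ball (0 : ℂ × ℂ) ε)
    (hp' : p' ∈ ball (0 : ℂ × ℂ) ε) (hp2 : p.2 ≠ 0) (hp2' : p'.2 ≠ 0) :
    branchMap α β a b (υ n) (σ n) p ≠ branchMap α β a b (υ n') (σ n') p' := by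
  intro heq
  have e1 := (branchMap_coord h.chart.det (h.branch n) hp hp2).2
  have e2 := (branchMap_coord h.chart.det (h.branch n') hp' hp2').2
  rw [heq] at e1
  exact h.separated n n' hn p hp p' hp' (e1.symm.trans e2)

/-- At a common point the coordinate s' of Γ' equals t^d s^j in the chart of Γ, with d = αβ' − βα' ≠
0. Since s and s' stay in fixed annuli, ‖t‖ is bounded below; but ‖t‖ ≤ M ‖u‖, which is too small
once δ is below the threshold. -/
theorem IsBranchSystem.eventually_branchMap_ne (h : IsBranchSystem g Γ α β a b m c κ υ σ M ε)
    (h' : IsBranchSystem g Γ' α' β' a' b' m' c' κ' υ' σ' M' ε') (hΓ : Γ ≠ Γ') :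
    ∀ᶠ δ in 𝓝[>] (0 : ℝ), δ ≤ ε → δ ≤ ε' → ∀ n n', ∀ p ∈ ball (0 : ℂ × ℂ) δ,
      ∀ p' ∈ ball (0 : ℂ × ℂ) δ, p.2 ≠ 0 → p'.2 ≠ 0 →
        branchMap α β a b (υ n) (σ n) p ≠ branchMap α' β' a' b' (υ' n') (σ' n') p' := by
  have hd : α * β' - β * α' ≠ 0 := fun h0 => hΓ (h.chart.eq_of_det_eq_zero h'.chart h0)
  set j : ℤ := a * -β' + b * α' with hj
  have hM := h.one_le
  have hB : 1 ≤ M' * M ^ (-j).natAbs := one_le_mul_of_one_le_of_one_le h'.one_le (one_le_pow₀ hM)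
  have hM0 : 0 < M := by linarith
  filter_upwards [Ioo_mem_nhdsGT (show 0 < (M' * M ^ (-j).natAbs)⁻¹ * M⁻¹ by positivity)] with
    δ hδ hδ1 hδ2 n n' p hp p' hp' hp2 hp2' heq
  have hpε := ball_subset_ball hδ1 hp
  have hpε' := ball_subset_ball hδ2 hp'
  have ht := (h.branch n).left_coord_ne_zero hpε hp2
  have hs := (h.branch n).right_ne_zero p hpε
  have e1 := (branchMap_coord h'.chart.det (h'.branch n') hpε' hp2').2
  rw [← heq, branchMap, monomial_monomialChart ht hs, ← hj,
    show -(α * -β' + β * α') = α * β' - β * α' by ring] at e1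
  have e2 : ‖p.2 * υ n p‖ ^ (α * β' - β * α') = ‖σ' n' p'‖ * ‖σ n p‖ ^ (-j) := by
    rw [← e1, norm_mul (_ ^ _), norm_zpow, norm_zpow, mul_assoc, ← zpow_add₀ (norm_ne_zero_iff.2 hs),
      add_neg_cancel, zpow_zero, mul_one]
  have e3 := mul_mem_Icc_inv h'.one_le (one_le_pow₀ hM) (h'.right_mem n' p' hpε')
    (zpow_mem_Icc_of_mem hM (h.right_mem n p hpε) (-j))
  rw [← e2] at e3
  have e4 := inv_le_of_zpow_mem_Icc hB (norm_pos_iff.2 ht) hd e3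
  have e5 : ‖p.2 * υ n p‖ < (M' * M ^ (-j).natAbs)⁻¹ := by
    have hp2δ : ‖p.2‖ < δ := (mk_mem_ball_zero.1 (show (p.1, p.2) ∈ _ from hp)).2
    calc ‖p.2 * υ n p‖ = ‖p.2‖ * ‖υ n p‖ := norm_mul _ _
      _ ≤ ‖p.2‖ * M := by gcongr; exact (h.left_mem n p hpε).2
      _ < (M' * M ^ (-j).natAbs)⁻¹ * M⁻¹ * M := by gcongr; exact hp2δ.trans hδ.2
      _ = _ := by field_simp
  linarith

end Sides

/-! ### Covering near the end of one side -/

section Cover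

variable {g : MvPolynomial (Fin 2) ℂ} {Γ : Set (ℝ × ℝ)} {α β a b : ℤ} {m : ℕ}
  {c κ : Fin (latticeLength Γ) → ℂ} {υ σ : Fin (latticeLength Γ) → ℂ × ℂ → ℂ} {M ε : ℝ}

/-- On the compact annulus with discs about the roots removed, F(0, s) has no zeros, while ‖t‖^m E
vanishes at t = 0. Compactness extends the strict inequality between them uniformly to small t. -/
theorem IsBranchSystem.exists_root_near (h : IsBranchSystem g Γ α β a b m c κ υ σ M ε) {r : ℝ}
    (hr : 0 < r) {K : ℝ} (hK : 0 < K) (E : ℝ) :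
    ∃ ρ > 0, ∀ t s : ℂ, ‖t‖ < ρ → ‖s‖ ∈ Set.Icc K⁻¹ K →
      ‖chartPoly g α β a b m (t, s)‖ ≤ ‖t‖ ^ m * E → ∃ n, ‖s - c n‖ < r := by
  obtain ⟨k₀, A, hA, hfac⟩ := h.factor
  have hcpt : IsCompact {s : ℂ | ‖s‖ ∈ Set.Icc K⁻¹ K ∧ ∀ n, r ≤ ‖s - c n‖} := by
    refine Metric.isCompact_of_isClosed_isBounded ?_ ?_
    · have heq : {s : ℂ | ‖s‖ ∈ Set.Icc K⁻¹ K ∧ ∀ n, r ≤ ‖s - c n‖} =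
          (fun s => ‖s‖) ⁻¹' Set.Icc K⁻¹ K ∩ ⋂ n, {s | r ≤ ‖s - c n‖} := by
        ext s; simp
      rw [heq]
      exact (isClosed_Icc.preimage continuous_norm).inter
        (isClosed_iInter fun n => isClosed_le continuous_const (by fun_prop))
    · exact (isBounded_iff_forall_norm_le.2 ⟨K, fun s hs => hs.1.2⟩)
  have hev : ∀ s ∈ {s : ℂ | ‖s‖ ∈ Set.Icc K⁻¹ K ∧ ∀ n, r ≤ ‖s - c n‖},
      ∀ᶠ z : ℂ × ℂ in 𝓝 ((0 : ℂ), s), ‖z.1‖ ^ m * E < ‖chartPoly g α β a b m (z.1, z.2)‖ := by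
    rintro s ⟨hs, hsc⟩
    have hs0 : s ≠ 0 := norm_pos_iff.1 ((inv_pos.2 hK).trans_le hs.1)
    have hF : ContinuousAt (fun z : ℂ × ℂ => ‖chartPoly g α β a b m z‖) (0, s) :=
      (h.chart.analyticAt_chartPoly (p := (0, s)) hs0).continuousAt.norm
    have hl : ContinuousAt (fun z : ℂ × ℂ => ‖z.1‖ ^ m * E) (0, s) := by fun_prop
    refine hl.eventually_lt hF ?_
    simp only [norm_zero, zero_pow h.chart.height_ne_zero, zero_mul]
    rw [norm_pos_iff, hfac s hs0]
    refine mul_ne_zero (zpow_ne_zero _ hs0) (mul_ne_zero hA (Finset.prod_ne_zero_iff.2 ?_))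
    exact fun n _ => norm_pos_iff.1 (hr.trans_le (hsc n))
  obtain ⟨ρ, hρ, hball⟩ := Metric.eventually_nhds_iff_ball.1
    (hcpt.eventually_forall_of_forall_eventually
      (P := fun t s => ‖t‖ ^ m * E < ‖chartPoly g α β a b m (t, s)‖) hev)
  refine ⟨ρ, hρ, fun t s ht hs hle => ?_⟩
  by_contra hcon
  push Not at hcon
  exact absurd (hball t (mem_ball_zero_iff.2 ht) s ⟨hs, hcon⟩) (not_lt.2 hle)

/-- The branches of a side cover the points of a level set near the corresponding end. -/
theorem IsBranchSystem.exists_cover (h : IsBranchSystem g Γ α β a b m c κ υ σ M ε) (hε : 0 < ε)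
    {K : ℝ} (hK : 0 < K) :
    ∃ ρ > 0, ∀ t s : ℂ, t ≠ 0 → ‖t‖ < ρ → ‖s‖ ∈ Set.Icc K⁻¹ K →
      ‖evalAt g (monomialChart α β a b t s)‖ < ε → ∃ n, ∃ p ∈ ball (0 : ℂ × ℂ) ε, p.2 ≠ 0 ∧
        p.1 = evalAt g (monomialChart α β a b t s) ∧
        branchMap α β a b (υ n) (σ n) p = monomialChart α β a b t s := by
  choose r hr hcov using fun n => (h.branch n).cover ε hε le_rfl
  obtain ⟨r₀, hr₀, hr₁⟩ : ∃ r₀ > 0, ∀ n, r₀ ≤ r n := by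
    have : ∀ᶠ x in 𝓝[>] (0 : ℝ), ∀ n, x ≤ r n := eventually_all.2 fun n => by
      filter_upwards [Ioo_mem_nhdsGT (hr n)] with x hx using hx.2.le
    obtain ⟨x, hx, hx'⟩ :=
      ((eventually_mem_nhdsWithin (a := (0 : ℝ)) (s := Set.Ioi 0)).and this).exists
    exact ⟨x, hx, hx'⟩
  obtain ⟨ρ, hρ, hroot⟩ := h.exists_root_near hr₀ hK ε
  refine ⟨min ρ r₀, lt_min hρ hr₀, fun t s ht htρ hs hη => ?_⟩
  have hs0 : s ≠ 0 := norm_pos_iff.1 ((inv_pos.2 hK).trans_le hs.1)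
  set η := evalAt g (monomialChart α β a b t s) with hηdef
  have hF : chartPoly g α β a b m (t, s) = t ^ m * η := by
    rw [hηdef, evalAt_monomialChart g (m := m) ht hs0, ← zpow_natCast, ← mul_assoc,
      ← zpow_add₀ ht]
    simp
  obtain ⟨n, hn⟩ := hroot t s (htρ.trans_le (min_le_left _ _)) hs (by
    rw [hF, norm_mul, norm_pow]; gcongr)
  obtain ⟨u, hu, hu0, e1, e2⟩ := hcov n η (mem_ball_zero_iff.2 hη) t s ht
    (htρ.trans_le ((min_le_right _ _).trans (hr₁ n))) (hn.trans_le (hr₁ n)) hF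
  refine ⟨n, (η, u), mk_mem_ball_zero.2 ⟨hη, mem_ball_zero_iff.1 hu⟩, hu0, rfl, ?_⟩
  simp only [branchMap]
  rw [e1, e2]

end Cover

/-! ### Dominant monomials where the polynomial is small -/

section Dominance

variable {g : MvPolynomial (Fin 2) ℂ}

/-- The modulus of the monomial with exponent vector `x`. -/
def monomialNorm (p : ℂ × ℂ) (x : Fin 2 →₀ ℕ) : ℝ := ‖p.1‖ ^ x 0 * ‖p.2‖ ^ x 1

/-- Where a polynomial with a constant term is small, two of its monomials are comparable and
dominate the others. -/
theorem exists_dominant_pair (h0 : (0 : Fin 2 →₀ ℕ) ∈ g.support) :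
    ∃ ε > 0, ∃ K : ℝ, 1 ≤ K ∧ ∀ p, ‖evalAt g p‖ < ε → ∃ v ∈ g.support, ∃ x ∈ g.support, v ≠ x ∧
      (∀ y ∈ g.support, monomialNorm p y ≤ monomialNorm p v) ∧
      monomialNorm p v ≤ K * monomialNorm p x := by
  obtain ⟨y₀, hy₀, hmin⟩ := g.support.exists_min_image (fun y => ‖g.coeff y‖) ⟨0, h0⟩
  set δ := ‖g.coeff y₀‖ with hδ
  have hδ0 : 0 < δ := norm_pos_iff.2 (MvPolynomial.mem_support_iff.1 hy₀)
  set A := ∑ y ∈ g.support, ‖g.coeff y‖ with hA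
  have hAδ : δ ≤ A := Finset.single_le_sum (f := fun y => ‖g.coeff y‖)
    (fun y _ => norm_nonneg _) hy₀
  have hA0 : 0 < A := hδ0.trans_le hAδ
  -- If every other monomial were below δ / (2A) times the largest one, the leading term, at least δ
  -- times that maximum, would exceed the rest by half of this. The constant monomial makes the
  -- maximum at least 1, so ‖g‖ ≥ δ / 2.
  refine ⟨δ / 2, by positivity, 2 * A / δ, ?_, fun p hp => ?_⟩
  · rw [le_div_iff₀ hδ0]; linarith
  obtain ⟨v, hv, hmax⟩ := g.support.exists_max_image (monomialNorm p) ⟨0, h0⟩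
  have hv1 : 1 ≤ monomialNorm p v := by
    have := hmax 0 h0
    simpa [monomialNorm] using this
  refine ⟨v, hv, ?_⟩
  by_contra hcon
  push Not at hcon
  have hsmall : ∀ x ∈ g.support.erase v, ‖g.coeff x‖ * monomialNorm p x ≤
      ‖g.coeff x‖ * (monomialNorm p v * δ / (2 * A)) := by
    intro x hx
    obtain ⟨hxv, hx⟩ := Finset.mem_erase.1 hx
    have := hcon x hx hxv.symm hmax
    gcongr
    rw [le_div_iff₀ (by positivity)]
    rw [div_mul_eq_mul_div, div_lt_iff₀ hδ0] at this
    linarith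
  have hterm : ∀ x : Fin 2 →₀ ℕ, ‖g.coeff x * (p.1 ^ (x 0 : ℤ) * p.2 ^ (x 1 : ℤ))‖ =
      ‖g.coeff x‖ * monomialNorm p x := by
    intro x; simp [monomialNorm]
  have hrest : ‖∑ x ∈ g.support.erase v, g.coeff x * (p.1 ^ (x 0 : ℤ) * p.2 ^ (x 1 : ℤ))‖ ≤
      monomialNorm p v * δ / 2 := by
    calc _ ≤ ∑ x ∈ g.support.erase v, ‖g.coeff x‖ * (monomialNorm p v * δ / (2 * A)) := by
          refine (norm_sum_le _ _).trans (Finset.sum_le_sum fun x hx => ?_)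
          rw [hterm]
          exact hsmall x hx
      _ ≤ A * (monomialNorm p v * δ / (2 * A)) := by
          rw [← Finset.sum_mul]
          gcongr
          exact Finset.sum_le_sum_of_subset_of_nonneg (Finset.erase_subset _ _)
            fun y _ _ => norm_nonneg _
      _ = _ := by field_simp
  have hlead : δ * monomialNorm p v ≤
      ‖g.coeff v * (p.1 ^ (v 0 : ℤ) * p.2 ^ (v 1 : ℤ))‖ := by
    rw [hterm]
    gcongr
    exact hmin v hv
  rw [evalAt_eq_sum, ← Finset.add_sum_erase _ _ hv] at hp
  have := norm_sub_le_norm_add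
    (g.coeff v * (p.1 ^ (v 0 : ℤ) * p.2 ^ (v 1 : ℤ)))
    (∑ x ∈ g.support.erase v, g.coeff x * (p.1 ^ (x 0 : ℤ) * p.2 ^ (x 1 : ℤ)))
  nlinarith

/-- If z = 0, both monomials are non-zero and hence pure powers of w. They are comparable within K
although ‖w‖ > K, so the exponents agree, against v ≠ x. The case w = 0 is the same. -/
theorem mem_torus_of_dominant {p : ℂ × ℂ} {K : ℝ} (hK : 1 ≤ K) (hp : K < ‖p.1‖ ∨ K < ‖p.2‖)
    {v x : Fin 2 →₀ ℕ} (hvx : v ≠ x) (h0 : 1 ≤ monomialNorm p v)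
    (hle : monomialNorm p x ≤ monomialNorm p v)
    (hKx : monomialNorm p v ≤ K * monomialNorm p x) : p ∈ torus := by
  have hx0 : 0 < monomialNorm p x := by
    by_contra hcon
    nlinarith
  have key : ∀ (y : ℝ) (i j : ℕ), K < y → y ^ i ≤ y ^ j → y ^ j ≤ K * y ^ i → i = j := by
    intro y i j hy h1 h2
    have hy1 : 1 < y := hK.trans_lt hy
    have hij := (pow_le_pow_iff_right₀ hy1).1 h1
    by_contra hne
    have : y ^ (i + 1) ≤ y ^ j := pow_le_pow_right₀ hy1.le (by omega)
    rw [pow_succ] at this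
    nlinarith [pow_pos (zero_lt_one.trans hy1) i]
  unfold monomialNorm at *
  constructor
  · intro hz
    rw [hz, norm_zero] at hp h0 hle hKx hx0
    have hv : v 0 = 0 := by
      by_contra hne
      rw [zero_pow hne, zero_mul] at h0
      linarith
    have hx : x 0 = 0 := by
      by_contra hne
      rw [zero_pow hne, zero_mul] at hx0
      exact lt_irrefl _ hx0
    rw [hv, hx, pow_zero, one_mul, one_mul] at hle hKx
    refine hvx (Finsupp.ext fun i => ?_)
    fin_cases i
    · exact hv.trans hx.symm
    · exact (key _ _ _ (hp.resolve_left (by linarith)) hle hKx).symm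
  · intro hz
    rw [hz, norm_zero] at hp h0 hle hKx hx0
    have hv : v 1 = 0 := by
      by_contra hne
      rw [zero_pow hne, mul_zero] at h0
      linarith
    have hx : x 1 = 0 := by
      by_contra hne
      rw [zero_pow hne, mul_zero] at hx0
      exact lt_irrefl _ hx0
    rw [hv, hx, pow_zero, mul_one, mul_one] at hle hKx
    refine hvx (Finsupp.ext fun i => ?_)
    fin_cases i
    · exact (key _ _ _ (hp.resolve_right (by linarith)) hle hKx).symm
    · exact hv.trans hx.symm

end Dominance

/-! ### From dominant monomials to outer sides -/

section OuterSide

variable {g : MvPolynomial (Fin 2) ℂ}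

theorem expPoint_injective : Function.Injective expPoint := by
  intro x y h
  simp only [expPoint, Prod.mk.injEq, Nat.cast_inj] at h
  ext i
  fin_cases i
  · exact h.1
  · exact h.2

/-- The positive component of η keeps the side off the axes: a side on the axis of z-exponent 0
would have normal (η₁, 0) with η₁ > 0, so no exponent could have positive z-exponent and the polygon
would be flat. The other axis is symmetric. -/
theorem isOuterSide_of_direction (hdim : affineDim (newtonPolygon g) = 2) {v x : Fin 2 →₀ ℕ}
    (hv : v ∈ g.support) (hx : x ∈ g.support) (hvx : v ≠ x) {η : ℤ × ℤ}
    (hη : η.1 * ((v 0 : ℤ) - x 0) + η.2 * ((v 1 : ℤ) - x 1) = 0)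
    (hmax : ∀ y ∈ g.support, η.1 * y 0 + η.2 * y 1 ≤ η.1 * v 0 + η.2 * v 1)
    (hpos : 0 < η.1 ∨ 0 < η.2) :
    ∃ Γ, IsOuterSide (newtonPolygon g) Γ ∧ expPoint v ∈ Γ ∧ expPoint x ∈ Γ := by
  set ζ : ℝ × ℝ := ((η.1 : ℝ), (η.2 : ℝ)) with hζ
  have hpair : ∀ y : Fin 2 →₀ ℕ, pairing ζ (expPoint y) = ((η.1 * y 0 + η.2 * y 1 : ℤ) : ℝ) :=
    fun y => by simp [pairing, expPoint, hζ]
  have hle : ∀ y ∈ newtonPolygon g, pairing ζ y ≤ pairing ζ (expPoint v) := fun y hy =>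
    pairing_le_of_support (fun x hx => by
      rw [hpair, hpair]; exact_mod_cast hmax x hx) hy
  have hvΓ : expPoint v ∈ face (newtonPolygon g) ζ := ⟨expPoint_mem hv, hle⟩
  have hxv : pairing ζ (expPoint x) = pairing ζ (expPoint v) := by
    rw [hpair, hpair]
    have : η.1 * x 0 + η.2 * x 1 = η.1 * v 0 + η.2 * v 1 := by linarith
    exact_mod_cast this
  have hxΓ : expPoint x ∈ face (newtonPolygon g) ζ :=
    ⟨expPoint_mem hx, fun y hy => (hle y hy).trans hxv.ge⟩
  have hζ0 : ζ ≠ 0 := by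
    intro h0
    simp only [hζ, Prod.mk_eq_zero, Int.cast_eq_zero] at h0
    omega
  have hflat : ∀ ω : ℝ × ℝ, ω ≠ 0 → ¬ ∀ y ∈ newtonPolygon g, pairing ω y = 0 := fun ω hω h0 => by
    have := affineDim_le_one hω h0
    omega
  refine ⟨_, ⟨⟨⟨ζ, rfl⟩, le_antisymm ?_ ?_⟩, fun hax => ?_, fun hax => ?_⟩, hvΓ, hxΓ⟩
  · exact affineDim_le_one hζ0 fun y hy => le_antisymm (hle y hy.1) (hy.2 _ (expPoint_mem hv))
  · exact affineDim_pos hvΓ hxΓ (expPoint_injective.ne hvx)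
  · have v0 : v 0 = 0 := by have := hax hvΓ; simpa [expPoint] using this
    have x0 : x 0 = 0 := by have := hax hxΓ; simpa [expPoint] using this
    have hne : (v 1 : ℤ) - x 1 ≠ 0 := fun h1 => hvx (Finsupp.ext fun i => by
      fin_cases i
      · exact v0.trans x0.symm
      · show v 1 = x 1
        omega)
    rw [v0, x0, sub_self, mul_zero, zero_add] at hη
    have h2 := (mul_eq_zero.1 hη).resolve_right hne
    have h1 : 0 < η.1 := hpos.resolve_right (by omega)
    refine hflat (1, 0) (by simp) fun y hy => le_antisymm ?_ ?_
    · refine pairing_le_of_support (fun z hz => ?_) hy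
      have := hmax z hz
      rw [v0, h2, Nat.cast_zero] at this
      have hz0 : (z 0 : ℤ) ≤ 0 := by nlinarith
      have : z 0 = 0 := by omega
      simp [pairing, expPoint, this]
    · simpa [pairing] using fst_nonneg_of_mem hy
  · have v0 : v 1 = 0 := by have := hax hvΓ; simpa [expPoint] using this
    have x0 : x 1 = 0 := by have := hax hxΓ; simpa [expPoint] using this
    have hne : (v 0 : ℤ) - x 0 ≠ 0 := fun h1 => hvx (Finsupp.ext fun i => by
      fin_cases i
      · show v 0 = x 0
        omega
      · exact v0.trans x0.symm)
    rw [v0, x0, sub_self, mul_zero, add_zero] at hη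
    have h2 := (mul_eq_zero.1 hη).resolve_right hne
    have h1 : 0 < η.2 := hpos.resolve_left (by omega)
    refine hflat (0, 1) (by simp) fun y hy => le_antisymm ?_ ?_
    · refine pairing_le_of_support (fun z hz => ?_) hy
      have := hmax z hz
      rw [v0, h2, Nat.cast_zero] at this
      have hz0 : (z 1 : ℤ) ≤ 0 := by nlinarith
      have : z 1 = 0 := by omega
      simp [pairing, expPoint, this]
    · simpa [pairing] using snd_nonneg_of_mem hy

/-- With d = v − x write λ = yη + rd, where η is d rotated by a right angle in the sense that makes
y ≥ 0. Near-maximality at both points gives 0 ≤ r ≤ C, so a large λ has large y. Then the integral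
covector η itself must be maximal at v, and a large positive component of λ must come from η. -/
theorem exists_direction {lam : ℝ × ℝ} {C D : ℝ} (hC : 0 ≤ C) (hD : 1 ≤ D)
    (hsupp : ∀ y ∈ g.support, (y 0 : ℝ) ≤ D ∧ (y 1 : ℝ) ≤ D) {v x : Fin 2 →₀ ℕ}
    (hv : v ∈ g.support) (hx : x ∈ g.support) (hvx : v ≠ x)
    (hmax : ∀ y ∈ g.support, pairing lam (expPoint y) ≤ pairing lam (expPoint v))
    (hCx : pairing lam (expPoint v) ≤ C + pairing lam (expPoint x))
    (hlarge : (2 * C * D ^ 2 + 1) * D + C * D < lam.1 ∨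
      (2 * C * D ^ 2 + 1) * D + C * D < lam.2) :
    ∃ η : ℤ × ℤ, η.1 * ((v 0 : ℤ) - x 0) + η.2 * ((v 1 : ℤ) - x 1) = 0 ∧
      (∀ y ∈ g.support, η.1 * y 0 + η.2 * y 1 ≤ η.1 * v 0 + η.2 * v 1) ∧
      (0 < η.1 ∨ 0 < η.2) := by
  have hdiff : ∀ y ∈ g.support, ∀ z ∈ g.support,
      |(y 0 : ℝ) - z 0| ≤ D ∧ |(y 1 : ℝ) - z 1| ≤ D := by
    intro y hy z hz
    have h1 := hsupp y hy
    have h2 := hsupp z hz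
    have h3 : ∀ i, (0 : ℝ) ≤ y i := fun i => Nat.cast_nonneg _
    have h4 : ∀ i, (0 : ℝ) ≤ z i := fun i => Nat.cast_nonneg _
    constructor <;> rw [abs_le] <;> constructor <;> linarith [h3 0, h3 1, h4 0, h4 1]
  set d₁ : ℤ := (v 0 : ℤ) - x 0 with hd₁
  set d₂ : ℤ := (v 1 : ℤ) - x 1 with hd₂
  have e₁ : (d₁ : ℝ) = (v 0 : ℝ) - x 0 := by rw [hd₁]; push_cast; ring
  have e₂ : (d₂ : ℝ) = (v 1 : ℝ) - x 1 := by rw [hd₂]; push_cast; ring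
  have hN1 : (1 : ℤ) ≤ d₁ ^ 2 + d₂ ^ 2 := by
    by_contra hcon
    have h1 : d₁ = 0 := by nlinarith [sq_nonneg d₁, sq_nonneg d₂]
    have h2 : d₂ = 0 := by nlinarith [sq_nonneg d₁, sq_nonneg d₂]
    refine hvx (Finsupp.ext fun i => ?_)
    fin_cases i
    · show v 0 = x 0
      omega
    · show v 1 = x 1
      omega
  have hN : (1 : ℝ) ≤ (d₁ : ℝ) ^ 2 + (d₂ : ℝ) ^ 2 := by exact_mod_cast hN1
  set N : ℝ := (d₁ : ℝ) ^ 2 + (d₂ : ℝ) ^ 2 with hNdef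
  have hN0 : 0 < N := by linarith
  set r : ℝ := (lam.1 * d₁ + lam.2 * d₂) / N with hr
  have hrN : r * N = lam.1 * d₁ + lam.2 * d₂ := div_mul_cancel₀ _ hN0.ne'
  have hmx := hmax x hx
  simp only [pairing, expPoint] at hmx hCx hmax
  have hr0 : 0 ≤ r := div_nonneg (by rw [e₁, e₂]; linarith) hN0.le
  have hrC : r ≤ C := by
    have : r * N ≤ C := by rw [hrN, e₁, e₂]; linarith
    nlinarith
  obtain ⟨y, η₁, η₂, hy0, hη, hl1, hl2, hb1, hb2⟩ : ∃ (y : ℝ) (η₁ η₂ : ℤ), 0 ≤ y ∧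
      η₁ * d₁ + η₂ * d₂ = 0 ∧ lam.1 = y * η₁ + r * d₁ ∧ lam.2 = y * η₂ + r * d₂ ∧
      |(η₁ : ℝ)| ≤ D ∧ |(η₂ : ℝ)| ≤ D := by
    set y₀ : ℝ := (lam.2 * d₁ - lam.1 * d₂) / N with hy₀
    have hyN : y₀ * N = lam.2 * d₁ - lam.1 * d₂ := div_mul_cancel₀ _ hN0.ne'
    have hl1 : lam.1 = y₀ * -d₂ + r * d₁ := by
      refine mul_right_cancel₀ hN0.ne' ?_
      linear_combination (d₂ : ℝ) * hyN - (d₁ : ℝ) * hrN + lam.1 * hNdef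
    have hl2 : lam.2 = y₀ * d₁ + r * d₂ := by
      refine mul_right_cancel₀ hN0.ne' ?_
      linear_combination -(d₁ : ℝ) * hyN - (d₂ : ℝ) * hrN + lam.2 * hNdef
    have hb := hdiff v hv x hx
    rw [← e₁, ← e₂] at hb
    rcases le_total 0 y₀ with h0 | h0
    · refine ⟨y₀, -d₂, d₁, h0, by ring, by push_cast; exact hl1, hl2, ?_, hb.1⟩
      rw [Int.cast_neg, abs_neg]; exact hb.2
    · refine ⟨-y₀, d₂, -d₁, by linarith, by ring, by linarith, by push_cast; linarith, hb.2, ?_⟩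
      rw [Int.cast_neg, abs_neg]; exact hb.1
  have hb := hdiff v hv x hx
  rw [← e₁, ← e₂] at hb
  have hrd : ∀ d : ℝ, |d| ≤ D → r * d ≤ C * D := fun d hd => by
    calc r * d ≤ r * D := mul_le_mul_of_nonneg_left ((le_abs_self d).trans hd) hr0
      _ ≤ C * D := mul_le_mul_of_nonneg_right hrC (by linarith)
  have hyη : ∀ e : ℝ, |e| ≤ D → y * e ≤ y * D := fun e he =>
    mul_le_mul_of_nonneg_left ((le_abs_self e).trans he) hy0
  have hCD : 0 ≤ C * D ^ 2 := by positivity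
  -- The size of λ was chosen so that y exceeds the largest possible contribution of rd, at most
  -- 2CD², to a difference of exponents.
  have hy : 2 * C * D ^ 2 + 1 < y := by
    have hD0 : 0 < D := by linarith
    refine lt_of_mul_lt_mul_right ?_ hD0.le
    rcases hlarge with hl | hl
    · linarith [hrd _ hb.1, hyη _ hb1]
    · linarith [hrd _ hb.2, hyη _ hb2]
  have hLD : 0 < (2 * C * D ^ 2 + 1) * D := by
    refine mul_pos ?_ (by linarith); linarith
  refine ⟨(η₁, η₂), hη, fun z hz => ?_, ?_⟩
  · by_contra hcon
    push Not at hcon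
    -- Integrality: an exponent that beats v for η does so by at least 1, which costs y and cannot
    -- be made up by rd.
    have h1 : (η₁ * ((v 0 : ℤ) - z 0) + η₂ * ((v 1 : ℤ) - z 1) : ℤ) ≤ -1 := by
      simp only at hcon
      linarith
    have h2 : (η₁ : ℝ) * ((v 0 : ℝ) - z 0) + η₂ * ((v 1 : ℝ) - z 1) ≤ -1 := by exact_mod_cast h1
    have h3 := hmax z hz
    have h4 : 0 ≤ y * ((η₁ : ℝ) * ((v 0 : ℝ) - z 0) + η₂ * ((v 1 : ℝ) - z 1)) +
        r * (d₁ * ((v 0 : ℝ) - z 0) + d₂ * ((v 1 : ℝ) - z 1)) := by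
      rw [hl1, hl2] at h3
      linarith
    have h5 : y * ((η₁ : ℝ) * ((v 0 : ℝ) - z 0) + η₂ * ((v 1 : ℝ) - z 1)) ≤ y * -1 :=
      mul_le_mul_of_nonneg_left h2 hy0
    have h6 : ∀ s t : ℝ, |s| ≤ D → |t| ≤ D → s * t ≤ D ^ 2 := fun s t hs ht => by
      calc s * t ≤ |s * t| := le_abs_self _
        _ = |s| * |t| := abs_mul s t
        _ ≤ D * D := mul_le_mul hs ht (abs_nonneg t) (by linarith)
        _ = D ^ 2 := by ring
    have h7 := hdiff v hv z hz
    have h8 : r * (d₁ * ((v 0 : ℝ) - z 0) + d₂ * ((v 1 : ℝ) - z 1)) ≤ r * (2 * D ^ 2) := by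
      refine mul_le_mul_of_nonneg_left ?_ hr0
      linarith [h6 _ _ hb.1 h7.1, h6 _ _ hb.2 h7.2]
    have h9 : r * (2 * D ^ 2) ≤ C * (2 * D ^ 2) := mul_le_mul_of_nonneg_right hrC (by positivity)
    linarith
  · have hpos : ∀ e : ℝ, 0 < y * e → 0 < e := fun e he => pos_of_mul_pos_right he hy0
    rcases hlarge with hl | hl
    · left
      have := hpos η₁ (by linarith [hrd _ hb.1])
      exact_mod_cast this
    · right
      have := hpos η₂ (by linarith [hrd _ hb.2])
      exact_mod_cast this

/-- Where two monomials are comparable and dominate the others far from the origin, their exponents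
lie on a common outer side. -/
theorem exists_outerSide_of_dominant (hdim : affineDim (newtonPolygon g) = 2) {K : ℝ}
    (hK : 1 ≤ K) : ∃ L : ℝ, ∀ p ∈ torus, ∀ v ∈ g.support, ∀ x ∈ g.support, v ≠ x →
      (∀ y ∈ g.support, monomialNorm p y ≤ monomialNorm p v) →
      monomialNorm p v ≤ K * monomialNorm p x → L < ‖p.1‖ ∨ L < ‖p.2‖ →
      ∃ Γ, IsOuterSide (newtonPolygon g) Γ ∧ expPoint v ∈ Γ ∧ expPoint x ∈ Γ := by
  obtain ⟨D, hD1, hD⟩ : ∃ D : ℝ, 1 ≤ D ∧ ∀ y ∈ g.support, (y 0 : ℝ) ≤ D ∧ (y 1 : ℝ) ≤ D := by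
    have h1 : ∀ᶠ D in atTop, ∀ y ∈ g.support, (y 0 : ℝ) ≤ D ∧ (y 1 : ℝ) ≤ D :=
      (eventually_all_finset _).2 fun y _ => (eventually_ge_atTop _).and (eventually_ge_atTop _)
    exact ((eventually_ge_atTop 1).and h1).exists
  set C := Real.log K with hC
  have hC0 : 0 ≤ C := Real.log_nonneg hK
  refine ⟨Real.exp ((2 * C * D ^ 2 + 1) * D + C * D), fun p hp v hv x hx hvx hmax hKx hL => ?_⟩
  have h1 : 0 < ‖p.1‖ := norm_pos_iff.2 hp.1
  have h2 : 0 < ‖p.2‖ := norm_pos_iff.2 hp.2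
  have hpos : ∀ y, 0 < monomialNorm p y := fun y => by unfold monomialNorm; positivity
  have hlog : ∀ y, Real.log (monomialNorm p y) =
      pairing (Real.log ‖p.1‖, Real.log ‖p.2‖) (expPoint y) := fun y => by
    rw [monomialNorm, Real.log_mul (pow_pos h1 _).ne' (pow_pos h2 _).ne', Real.log_pow,
      Real.log_pow]
    simp only [pairing, expPoint]
    ring
  obtain ⟨η, e1, e2, e3⟩ := exists_direction (lam := (Real.log ‖p.1‖, Real.log ‖p.2‖)) hC0 hD1 hD
    hv hx hvx (fun y hy => by
      rw [← hlog, ← hlog]; exact Real.log_le_log (hpos y) (hmax y hy)) (by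
      rw [← hlog, ← hlog, hC, ← Real.log_mul (by linarith) (hpos x).ne']
      exact Real.log_le_log (hpos v) hKx)
    (hL.imp (fun h => (Real.lt_log_iff_exp_lt h1).2 h) fun h => (Real.lt_log_iff_exp_lt h2).2 h)
  exact isOuterSide_of_direction hdim hv hx hvx e1 e2 e3

end OuterSide

section Chart

variable {g : MvPolynomial (Fin 2) ℂ} {Γ : Set (ℝ × ℝ)} {α β a b : ℤ} {m : ℕ}

/-- Monomials of one side carry the same power of t, so their ratio is a power of ‖s‖ with non-zero
exponent. It lies between 1 and K, which bounds ‖s‖ and its inverse. -/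
theorem IsSideChart.norm_mem_Icc (h : IsSideChart g Γ α β a b m) {K : ℝ} (hK : 1 ≤ K)
    {t s : ℂ} (ht : t ≠ 0) (hs : s ≠ 0) {v x : Fin 2 →₀ ℕ} (hv : v ∈ g.support)
    (hx : x ∈ g.support) (hvΓ : expPoint v ∈ Γ) (hxΓ : expPoint x ∈ Γ) (hvx : v ≠ x)
    (hle : monomialNorm (monomialChart α β a b t s) x ≤
      monomialNorm (monomialChart α β a b t s) v)
    (hKx : monomialNorm (monomialChart α β a b t s) v ≤
      K * monomialNorm (monomialChart α β a b t s) x) : ‖s‖ ∈ Set.Icc K⁻¹ K := by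
  have hmono : ∀ y : Fin 2 →₀ ℕ, y ∈ g.support → expPoint y ∈ Γ →
      monomialNorm (monomialChart α β a b t s) y =
        ‖t‖ ^ (-(m : ℤ)) * ‖s‖ ^ (a * y 0 + b * y 1) := by
    intro y hy hyΓ
    have := monomial_monomialChart (α := α) (β := β) (a := a) (b := b) ht hs (y 0) (y 1)
    rw [(h.mem_iff y hy).1 hyΓ] at this
    rw [← norm_zpow, ← norm_zpow, ← norm_mul, ← this]
    simp [monomialNorm]
  have hj : a * v 0 + b * v 1 - (a * x 0 + b * x 1) ≠ 0 := fun h0 =>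
    hvx (h.coord_injOn ((h.mem_iff v hv).1 hvΓ) ((h.mem_iff x hx).1 hxΓ) (sub_eq_zero.1 h0))
  have ht0 : 0 < ‖t‖ := norm_pos_iff.2 ht
  have hs0 : 0 < ‖s‖ := norm_pos_iff.2 hs
  set j : ℤ := a * v 0 + b * v 1 - (a * x 0 + b * x 1) with hjdef
  have hv' : monomialNorm (monomialChart α β a b t s) v =
      monomialNorm (monomialChart α β a b t s) x * ‖s‖ ^ j := by
    rw [hmono v hv hvΓ, hmono x hx hxΓ, mul_assoc, ← zpow_add₀ hs0.ne']
    congr 2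
    rw [hjdef]; ring
  have hx0 : 0 < monomialNorm (monomialChart α β a b t s) x := by
    rw [hmono x hx hxΓ]; positivity
  rw [hv'] at hle hKx
  have h1 : 1 ≤ ‖s‖ ^ j := by
    by_contra hcon
    push Not at hcon
    nlinarith
  have h2 : ‖s‖ ^ j ≤ K := by
    by_contra hcon
    push Not at hcon
    nlinarith
  have hK0 : 0 < K := by linarith
  have h3 : ‖s‖ ^ j ∈ Set.Icc K⁻¹ K := ⟨(inv_le_one_of_one_le₀ hK).trans h1, h2⟩
  have h4 : ‖s‖⁻¹ ^ j ∈ Set.Icc K⁻¹ K := by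
    rw [inv_zpow]
    exact ⟨inv_anti₀ (by linarith) h2, (inv_le_one_of_one_le₀ h1).trans hK⟩
  exact ⟨inv_le_of_zpow_mem_Icc hK hs0 hj h3,
    (inv_le_inv₀ hK0 hs0).1 (inv_le_of_zpow_mem_Icc hK (inv_pos.2 hs0) hj h4)⟩

theorem norm_zpow_neg_mul_le {K ρ : ℝ} (hK : 1 ≤ K) (hρ : 0 < ρ) {t s : ℂ} (hs : ‖s‖ ∈ Set.Icc K⁻¹ K)
    {α : ℤ} (hα : 0 ≤ α) (a : ℤ) (ht : ρ ≤ ‖t‖) :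
    ‖t ^ (-α) * s ^ a‖ ≤ ρ ^ (-α) * K ^ a.natAbs := by
  rw [norm_mul, norm_zpow, norm_zpow, zpow_neg, zpow_neg]
  have := (zpow_mem_Icc_of_mem hK hs a).2
  have h2 : ρ ^ α ≤ ‖t‖ ^ α := zpow_le_zpow_left₀ hα hρ.le ht
  have h3 := zpow_pos hρ α
  gcongr

end Chart

/-- The branches of all outer sides cover the level sets near infinity. -/
theorem exists_branch_cover {g : MvPolynomial (Fin 2) ℂ}
    (hP : ContainsRectangles (newtonPolygon g)) (hdim : affineDim (newtonPolygon g) = 2)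
    {α β a b : Set (ℝ × ℝ) → ℤ} {m : Set (ℝ × ℝ) → ℕ}
    {c κ : (Γ : Set (ℝ × ℝ)) → Fin (latticeLength Γ) → ℂ}
    {υ σ : (Γ : Set (ℝ × ℝ)) → Fin (latticeLength Γ) → ℂ × ℂ → ℂ} {M : Set (ℝ × ℝ) → ℝ} :
    ∃ ε₀ > 0, ∀ ε, 0 < ε → ε ≤ ε₀ →
      (∀ Γ, IsOuterSide (newtonPolygon g) Γ →
        IsBranchSystem g Γ (α Γ) (β Γ) (a Γ) (b Γ) (m Γ) (c Γ) (κ Γ) (υ Γ) (σ Γ) (M Γ) ε) →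
      ∃ R > 0, ∀ p, ‖evalAt g p‖ < ε → R ≤ normC2 p →
        ∃ Γ, IsOuterSide (newtonPolygon g) Γ ∧ ∃ n, ∃ q ∈ ball (0 : ℂ × ℂ) ε, q.2 ≠ 0 ∧
          q.1 = evalAt g p ∧ branchMap (α Γ) (β Γ) (a Γ) (b Γ) (υ Γ n) (σ Γ n) q = p := by
  have h0 := zero_mem_support hP hdim
  obtain ⟨ε₀, hε₀, K, hK, hdom⟩ := exists_dominant_pair h0
  have hK0 : 0 < K := by linarith
  obtain ⟨L, hL⟩ := exists_outerSide_of_dominant hdim hK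
  refine ⟨ε₀, hε₀, fun ε hε hεε₀ hsys => ?_⟩
  have hcov : ∀ Γ, ∃ ρ > 0, IsOuterSide (newtonPolygon g) Γ → ∀ t s : ℂ, t ≠ 0 → ‖t‖ < ρ →
      ‖s‖ ∈ Set.Icc K⁻¹ K → ‖evalAt g (monomialChart (α Γ) (β Γ) (a Γ) (b Γ) t s)‖ < ε →
      ∃ n, ∃ p ∈ ball (0 : ℂ × ℂ) ε, p.2 ≠ 0 ∧
        p.1 = evalAt g (monomialChart (α Γ) (β Γ) (a Γ) (b Γ) t s) ∧
        branchMap (α Γ) (β Γ) (a Γ) (b Γ) (υ Γ n) (σ Γ n) p =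
          monomialChart (α Γ) (β Γ) (a Γ) (b Γ) t s := by
    intro Γ
    by_cases hΓ : IsOuterSide (newtonPolygon g) Γ
    · obtain ⟨ρ, hρ, h⟩ := (hsys Γ hΓ).exists_cover hε hK0
      exact ⟨ρ, hρ, fun _ => h⟩
    · exact ⟨1, one_pos, fun h => absurd h hΓ⟩
  choose ρ hρ hcov using hcov
  -- R exceeds K for the torus argument, L for the existence of the side, and the size that z and w
  -- can reach with ‖t‖ ≥ ρ Γ and s in the annulus. A larger point must therefore have ‖t‖ < ρ Γ.
  -- Only finitely many sides enter.
  obtain ⟨R, hRK, hRL, hRΓ⟩ : ∃ R : ℝ, K < R ∧ L < R ∧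
      ∀ Γ ∈ {Γ | IsOuterSide (newtonPolygon g) Γ},
        ρ Γ ^ (-α Γ) * K ^ (a Γ).natAbs < R ∧ ρ Γ ^ (-β Γ) * K ^ (b Γ).natAbs < R :=
    ((eventually_gt_atTop K).and ((eventually_gt_atTop L).and
      ((eventually_all_finite (finite_outerSides hP hdim)).2 fun Γ _ =>
        (eventually_gt_atTop _).and (eventually_gt_atTop _)))).exists
  -- If both coordinates are at most R, the Euclidean norm is at most √2 R < 2R.
  refine ⟨2 * R, by linarith, fun p hp hpR => ?_⟩
  have hbig : R < ‖p.1‖ ∨ R < ‖p.2‖ := by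
    by_contra hcon
    push Not at hcon
    have h1 : normC2 p ≤ Real.sqrt (R ^ 2 + R ^ 2) :=
      Real.sqrt_le_sqrt (add_le_add (pow_le_pow_left₀ (norm_nonneg _) hcon.1 2)
        (pow_le_pow_left₀ (norm_nonneg _) hcon.2 2))
    have h2 : Real.sqrt (R ^ 2 + R ^ 2) < 2 * R := by
      rw [Real.sqrt_lt' (by linarith)]
      nlinarith
    linarith
  obtain ⟨v, hv, x, hx, hvx, hmax, hKx⟩ := hdom p (hp.trans_le hεε₀)
  have hv1 : 1 ≤ monomialNorm p v := by
    have := hmax 0 h0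
    simpa [monomialNorm] using this
  have hpt : p ∈ torus := mem_torus_of_dominant hK
    (hbig.imp hRK.trans hRK.trans) hvx hv1 (hmax x hx) hKx
  obtain ⟨Γ, hΓ, hvΓ, hxΓ⟩ := hL p hpt v hv x hx hvx hmax hKx
    (hbig.imp hRL.trans hRL.trans)
  have hch := (hsys Γ hΓ).chart
  set t := p.1 ^ (-b Γ) * p.2 ^ a Γ with ht
  set s := p.1 ^ (-β Γ) * p.2 ^ α Γ with hs
  have hps : monomialChart (α Γ) (β Γ) (a Γ) (b Γ) t s = p :=
    monomialChart_inverse hch.det hpt.1 hpt.2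
  have ht0 : t ≠ 0 := mul_ne_zero (zpow_ne_zero _ hpt.1) (zpow_ne_zero _ hpt.2)
  have hs0 : s ≠ 0 := mul_ne_zero (zpow_ne_zero _ hpt.1) (zpow_ne_zero _ hpt.2)
  have hsI : ‖s‖ ∈ Set.Icc K⁻¹ K := hch.norm_mem_Icc hK ht0 hs0 hv hx hvΓ hxΓ hvx
    (by rw [hps]; exact hmax x hx) (by rw [hps]; exact hKx)
  have htρ : ‖t‖ < ρ Γ := by
    by_contra hcon
    push Not at hcon
    have h1 := norm_zpow_neg_mul_le hK (hρ Γ) hsI hch.left_nonneg (a Γ) hcon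
    have h2 := norm_zpow_neg_mul_le hK (hρ Γ) hsI hch.right_nonneg (b Γ) hcon
    have e1 : t ^ (-α Γ) * s ^ a Γ = p.1 := congrArg Prod.fst hps
    have e2 : t ^ (-β Γ) * s ^ b Γ = p.2 := congrArg Prod.snd hps
    rw [e1] at h1
    rw [e2] at h2
    have := hRΓ Γ hΓ
    rcases hbig with h | h <;> linarith [this.1, this.2]
  obtain ⟨n, q, hq, hq2, hq1, hqp⟩ := hcov Γ hΓ t s ht0 htρ hsI (by rw [hps]; exact hp)
  exact ⟨Γ, hΓ, n, q, hq, hq2, by rw [hq1, hps], by rw [hqp, hps]⟩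

/-! ### Uniqueness of the embeddings and assembly -/

/-- The punctured disc is the image of a half-plane under the exponential map. -/
theorem isPreconnected_puncturedBidisc (ξ₀ : ℂ) (ε δ : ℝ) :
    IsPreconnected (puncturedBidisc ξ₀ ε δ) := by
  refine (convex_ball ξ₀ ε).isPreconnected.prod ?_
  rcases le_or_gt δ 0 with hδ | hδ
  · rw [ball_eq_empty.2 hδ, Set.empty_sdiff]
    exact isPreconnected_empty
  have heq : ball (0 : ℂ) δ \ {0} = Complex.exp '' {z | z.re < Real.log δ} := by
    ext u
    simp only [Set.mem_sdiff, mem_ball_zero_iff, Set.mem_singleton_iff, Set.mem_image,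
      Set.mem_ofPred_eq]
    constructor
    · rintro ⟨hu, hu0⟩
      refine ⟨Complex.log u, ?_, Complex.exp_log hu0⟩
      rw [Complex.log_re]
      exact Real.log_lt_log (norm_pos_iff.2 hu0) hu
    · rintro ⟨z, hz, rfl⟩
      exact ⟨by rw [Complex.norm_exp]; exact (Real.lt_log_iff_exp_lt hδ).1 hz, Complex.exp_ne_zero z⟩
  rw [heq]
  exact (convex_halfSpace_re_lt _).isPreconnected.image _ Complex.continuous_exp.continuousOn

section Uniqueness

variable {f : MvPolynomial (Fin 2) ℂ} {ξ₀ : ℂ} {Γ : Set (ℝ × ℝ)} {α β : ℤ} {ε : ℝ} {κ : ℂ}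
  {J Jhat : ℂ × ℂ → ℂ × ℂ}

/-- Along the embedding the monomial z^i w^j is u^(−(αi + βj)) times the same monomial of `Jhat`,
which has a non-zero limit at u = 0. Two-sided bounds as u → 0 force the exponent to vanish. -/
theorem IsNormalizingEmbedding.weight_eq_zero (h : IsNormalizingEmbedding f ξ₀ Γ α β ε κ J Jhat)
    (hε : 0 < ε) {i j : ℤ} {B : ℝ} (hB : 1 ≤ B) {δ : ℝ} (hδ : 0 < δ) (hδε : δ ≤ ε)
    (hb : ∀ p ∈ puncturedBidisc ξ₀ ε δ, ‖(J p).1 ^ i * (J p).2 ^ j‖ ∈ Set.Icc B⁻¹ B) :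
    α * i + β * j = 0 := by
  by_contra hd
  have h0 : ((ξ₀, 0) : ℂ × ℂ) ∈ ball ξ₀ ε ×ˢ ball (0 : ℂ) ε :=
    ⟨mem_ball_self hε, mem_ball_self hε⟩
  have hT := h.hat_mapsTo_torus h0
  have hc : ContinuousAt Jhat (ξ₀, 0) :=
    (h.hat_holomorphic.differentiableAt ((isOpen_ball.prod isOpen_ball).mem_nhds h0)).continuousAt
  let φ : ℂ → ℝ := fun u => ‖(Jhat (ξ₀, u)).1 ^ i * (Jhat (ξ₀, u)).2 ^ j‖
  have hcu : ContinuousAt (fun u : ℂ => Jhat (ξ₀, u)) 0 :=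
    ContinuousAt.comp (g := Jhat) (f := fun u : ℂ => ((ξ₀, u) : ℂ × ℂ)) hc (by fun_prop)
  have hφ : ContinuousAt φ 0 :=
    ((hcu.fst.zpow₀ i (Or.inl hT.1)).mul (hcu.snd.zpow₀ j (Or.inl hT.2))).norm
  have hφ0 : 0 < φ 0 := norm_pos_iff.2 (mul_ne_zero (zpow_ne_zero _ hT.1) (zpow_ne_zero _ hT.2))
  obtain ⟨A, hA1, hA2, hA3⟩ : ∃ A : ℝ, 1 ≤ A ∧ A⁻¹ < φ 0 ∧ φ 0 < A :=
    ((eventually_ge_atTop 1).and (((tendsto_inv_atTop_zero (𝕜 := ℝ)).eventually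
      (gt_mem_nhds hφ0)).and (eventually_gt_atTop (φ 0)))).exists
  have hBA : 0 < (B * A)⁻¹ := by positivity
  have hev : ∀ᶠ u in 𝓝[≠] (0 : ℂ), φ u ∈ Set.Ioo A⁻¹ A ∧ ‖u‖ < (B * A)⁻¹ ∧ ‖u‖ < δ :=
    nhdsWithin_le_nhds ((hφ.eventually (Ioo_mem_nhds hA2 hA3)).and
      ((continuous_norm.tendsto' (0 : ℂ) 0 norm_zero |>.eventually (gt_mem_nhds hBA)).and
        (continuous_norm.tendsto' (0 : ℂ) 0 norm_zero |>.eventually (gt_mem_nhds hδ))))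
  obtain ⟨u, ⟨hu1, hu2, hu3⟩, hu0⟩ := (hev.and self_mem_nhdsWithin).exists
  have hu0 : u ≠ 0 := hu0
  have hp : (ξ₀, u) ∈ puncturedBidisc ξ₀ ε δ :=
    mem_puncturedBidisc.2 ⟨by simpa using hε, hu3, hu0⟩
  have hpε : (ξ₀, u) ∈ puncturedBidisc ξ₀ ε ε :=
    mem_puncturedBidisc.2 ⟨by simpa using hε, hu3.trans_le hδε, hu0⟩
  have hφu : φ u = ‖u‖ ^ (α * i + β * j) * ‖(J (ξ₀, u)).1 ^ i * (J (ξ₀, u)).2 ^ j‖ := by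
    simp only [φ]
    rw [h.hat_eq _ hpε, ← norm_zpow, ← norm_mul]
    simp only [mul_zpow, ← zpow_mul]
    rw [zpow_add₀ hu0]
    congr 1
    ring
  have hX := hb _ hp
  set X := ‖(J (ξ₀, u)).1 ^ i * (J (ξ₀, u)).2 ^ j‖ with hXdef
  have hX0 : 0 < X := (inv_pos.2 (by linarith)).trans_le hX.1
  have hXinv : X⁻¹ ∈ Set.Icc B⁻¹ B :=
    ⟨inv_anti₀ hX0 hX.2, inv_le_of_inv_le₀ (by linarith) hX.1⟩
  have hmem := mul_mem_Icc_inv hB hA1 hXinv (Set.Ioo_subset_Icc_self hu1)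
  rw [hφu, mul_left_comm, inv_mul_cancel₀ hX0.ne', mul_one] at hmem
  have := inv_le_of_zpow_mem_Icc (one_le_mul_of_one_le_of_one_le hB hA1) (norm_pos_iff.2 hu0) hd
    hmem
  linarith

end Uniqueness

theorem mem_image_branchMap_iff {ξ₀ : ℂ} {α β a b : ℤ} {υ σ : ℂ × ℂ → ℂ} {ε : ℝ} {x : ℂ × ℂ} :
    x ∈ (fun p => branchMap α β a b υ σ (p - (ξ₀, 0))) '' puncturedBidisc ξ₀ ε ε ↔
      ∃ q ∈ ball (0 : ℂ × ℂ) ε, q.2 ≠ 0 ∧ branchMap α β a b υ σ q = x := by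
  constructor
  · rintro ⟨p, hp, rfl⟩
    rw [mem_puncturedBidisc] at hp
    exact ⟨p - (ξ₀, 0), sub_mem_ball_iff.2 ⟨hp.1, hp.2.1⟩, by simpa using hp.2.2, rfl⟩
  · rintro ⟨q, hq, hq2, rfl⟩
    have hq' : ((q.1, q.2) : ℂ × ℂ) ∈ ball (0 : ℂ × ℂ) ε := hq
    rw [mk_mem_ball_zero] at hq'
    refine ⟨q + (ξ₀, 0), mem_puncturedBidisc.2 ⟨by simpa using hq'.1, by simpa using hq'.2,
      by simpa using hq2⟩, ?_⟩
    simp only [add_sub_cancel_right]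

section Assembly

variable {f : MvPolynomial (Fin 2) ℂ} {ξ₀ : ℂ} {α β a b : Set (ℝ × ℝ) → ℤ}
  {m : Set (ℝ × ℝ) → ℕ} {c κ : (Γ : Set (ℝ × ℝ)) → Fin (latticeLength Γ) → ℂ}
  {υ σ : (Γ : Set (ℝ × ℝ)) → Fin (latticeLength Γ) → ℂ × ℂ → ℂ} {M : Set (ℝ × ℝ) → ℝ} {ε : ℝ}

/-- The embeddings of a side are the only ones, up to a change of the coordinate `u`. -/
theorem existsUnique_branch
    (hsys : ∀ Γ, IsOuterSide (newtonPolygon (f - MvPolynomial.C ξ₀)) Γ →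
      IsBranchSystem (f - MvPolynomial.C ξ₀) Γ (α Γ) (β Γ) (a Γ) (b Γ) (m Γ) (c Γ) (κ Γ) (υ Γ)
        (σ Γ) (M Γ) ε)
    {J : (Γ : Set (ℝ × ℝ)) → Fin (latticeLength Γ) → ℂ × ℂ → ℂ × ℂ}
    (hJ : ∀ Γ n, J Γ n =
      fun p => branchMap (α Γ) (β Γ) (a Γ) (b Γ) (υ Γ n) (σ Γ n) (p - (ξ₀, 0)))
    (hdisj : ∀ Γ₁ Γ₂, IsOuterSide (newtonPolygon (f - MvPolynomial.C ξ₀)) Γ₁ →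
      IsOuterSide (newtonPolygon (f - MvPolynomial.C ξ₀)) Γ₂ →
      ∀ (n₁ : Fin (latticeLength Γ₁)) (n₂ : Fin (latticeLength Γ₂)),
        (Γ₁ ≠ Γ₂ ∨ (n₁ : ℕ) ≠ n₂) →
        Disjoint (J Γ₁ n₁ '' puncturedBidisc ξ₀ ε ε) (J Γ₂ n₂ '' puncturedBidisc ξ₀ ε ε))
    {R : ℝ} (hcov : ∀ p : ℂ × ℂ, evalAt f p ∈ ball ξ₀ ε → R ≤ normC2 p →
      ∃ Γ, IsOuterSide (newtonPolygon (f - MvPolynomial.C ξ₀)) Γ ∧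
        ∃ n : Fin (latticeLength Γ), p ∈ J Γ n '' puncturedBidisc ξ₀ ε ε)
    {Γ : Set (ℝ × ℝ)} (hΓ : IsOuterSide (newtonPolygon (f - MvPolynomial.C ξ₀)) Γ)
    {ε' : ℝ} (hε' : 0 < ε') (hεε' : ε' ≤ ε) {κ' : ℂ} {J' Jhat' : ℂ × ℂ → ℂ × ℂ}
    (h' : IsNormalizingEmbedding f ξ₀ Γ (α Γ) (β Γ) ε' κ' J' Jhat') :
    ∃! n, ∃ δ > 0, δ ≤ ε' ∧
      J' '' puncturedBidisc ξ₀ ε' δ ⊆ J Γ n '' puncturedBidisc ξ₀ ε ε := by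
  have hmono : ∀ δ ≤ ε', puncturedBidisc ξ₀ ε' δ ⊆ puncturedBidisc ξ₀ ε' ε' := fun δ hδ p hp => by
    rw [mem_puncturedBidisc] at hp ⊢
    exact ⟨hp.1, hp.2.1.trans_le hδ, hp.2.2⟩
  have hpoint : ∀ δ > 0, (ξ₀, ((δ / 2 : ℝ) : ℂ)) ∈ puncturedBidisc ξ₀ ε' δ := fun δ hδ => by
    refine mem_puncturedBidisc.2 ⟨by simpa using hε', ?_, ?_⟩
    · simp only [Complex.norm_real, Real.norm_eq_abs]
      rw [abs_of_pos (half_pos hδ)]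
      linarith
    · simpa using hδ.ne'
  -- For u this small the competing map stays outside the ball of radius R, where the known images
  -- cover.
  obtain ⟨δ₀, hδ₀, hlarge⟩ := h'.tendsto_infty R
  set δ := min δ₀ ε' with hδdef
  have hδ : 0 < δ := lt_min hδ₀ hε'
  have hδε' : δ ≤ ε' := min_le_right _ _
  let I := {i : (Γ : Set (ℝ × ℝ)) × Fin (latticeLength Γ) //
    IsOuterSide (newtonPolygon (f - MvPolynomial.C ξ₀)) i.1}
  let U : I → Set (ℂ × ℂ) := fun i => J i.1.1 i.1.2 '' puncturedBidisc ξ₀ ε ε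
  have hU : ∀ i, IsOpen (U i) := fun i => by
    simp only [U, hJ]
    exact ((hsys _ i.2).isNormalizingEmbedding i.1.2).2 _ subset_rfl (isOpen_puncturedBidisc _ _ _)
  have hUd : ∀ i j, i ≠ j → Disjoint (U i) (U j) := by
    rintro ⟨⟨Γ₁, n₁⟩, h₁⟩ ⟨⟨Γ₂, n₂⟩, h₂⟩ hij
    refine hdisj Γ₁ Γ₂ h₁ h₂ n₁ n₂ ?_
    by_contra hcon
    push Not at hcon
    obtain ⟨rfl, h3⟩ := hcon
    obtain rfl := Fin.ext h3
    exact hij rfl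
  have hcovU : J' '' puncturedBidisc ξ₀ ε' δ ⊆ ⋃ i, U i := by
    rintro _ ⟨p, hp, rfl⟩
    have hp' := hmono δ hδε' hp
    have hp1 : evalAt f (J' p) ∈ ball ξ₀ ε := by
      rw [h'.eval_eq p hp', mem_ball_iff_norm]
      exact (mem_puncturedBidisc.1 hp).1.trans_le hεε'
    obtain ⟨Γ', hΓ', n, hn⟩ := hcov (J' p) hp1
      (hlarge p hp' ((mem_puncturedBidisc.1 hp).2.1.trans_le (min_le_left _ _))).le
    exact Set.mem_iUnion.2 ⟨⟨⟨Γ', n⟩, hΓ'⟩, hn⟩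
  have hconn : IsPreconnected (J' '' puncturedBidisc ξ₀ ε' δ) :=
    (isPreconnected_puncturedBidisc ξ₀ ε' δ).image _
      (h'.embedding.1.continuousOn.mono (hmono δ hδε'))
  have hx := Set.mem_image_of_mem J' (hpoint δ hδ)
  obtain ⟨i, hi⟩ := Set.mem_iUnion.1 (hcovU hx)
  -- A connected set covered by pairwise disjoint open images lies in one of them.
  have hsub : J' '' puncturedBidisc ξ₀ ε' δ ⊆ U i := by
    refine hconn.subset_left_of_subset_union (hU i)
      (isOpen_iUnion fun j : {j // j ≠ i} => hU j.1) ?_ ?_ ⟨_, hx, hi⟩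
    · exact Set.disjoint_iUnion_right.2 fun j => hUd i j.1 (Ne.symm j.2)
    · intro y hy
      obtain ⟨j, hj⟩ := Set.mem_iUnion.1 (hcovU hy)
      by_cases hji : j = i
      · exact Or.inl (hji ▸ hj)
      · exact Or.inr (Set.mem_iUnion.2 ⟨⟨j, hji⟩, hj⟩)
  obtain ⟨⟨Γ', n⟩, hΓ'⟩ := i
  have hs' := hsys Γ' hΓ'
  -- The coordinate s' of Γ' is bounded above and below on the image, so its weight for the normal
  -- of Γ vanishes. This weight is the determinant of the two normals up to sign.
  have hsides : Γ = Γ' := by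
    refine (hsys Γ hΓ).chart.eq_of_det_eq_zero hs'.chart ?_
    have hw := h'.weight_eq_zero hε' (i := -β Γ') (j := α Γ') hs'.one_le hδ hδε' fun p hp => by
      have hmem := hsub (Set.mem_image_of_mem J' hp)
      simp only [U, hJ] at hmem
      obtain ⟨q, hq, hq2, hqe⟩ := mem_image_branchMap_iff.1 hmem
      rw [← hqe, (branchMap_coord hs'.chart.det (hs'.branch n) hq hq2).2]
      exact hs'.right_mem n q hq
    linarith
  subst hsides
  refine ⟨n, ⟨δ, hδ, hδε', hsub⟩, ?_⟩
  rintro n' ⟨δ', hδ', hδε'', hsub'⟩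
  by_contra hne
  have hd := hdisj Γ Γ hΓ hΓ n' n (Or.inr fun h => hne (Fin.ext h))
  have hmin : 0 < min δ δ' := lt_min hδ hδ'
  have hpt := hpoint _ hmin
  rw [mem_puncturedBidisc] at hpt
  exact Set.disjoint_left.1 hd
    (hsub' (Set.mem_image_of_mem J' (mem_puncturedBidisc.2
      ⟨hpt.1, hpt.2.1.trans_le (min_le_right _ _), hpt.2.2⟩)))
    (hsub (Set.mem_image_of_mem J' (mem_puncturedBidisc.2
      ⟨hpt.1, hpt.2.1.trans_le (min_le_left _ _), hpt.2.2⟩)))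

end Assembly

/-- Normal branches of all outer sides on a common polydisc, with disjoint images. -/
theorem exists_isBranchSystem {g : MvPolynomial (Fin 2) ℂ} (hnd : IsNewtonNondegenerate g)
    (hP : ContainsRectangles (newtonPolygon g)) (hdim : affineDim (newtonPolygon g) = 2) :
    ∃ (α β a b : Set (ℝ × ℝ) → ℤ) (m : Set (ℝ × ℝ) → ℕ)
      (c κ : (Γ : Set (ℝ × ℝ)) → Fin (latticeLength Γ) → ℂ)
      (υ σ : (Γ : Set (ℝ × ℝ)) → Fin (latticeLength Γ) → ℂ × ℂ → ℂ) (M : Set (ℝ × ℝ) → ℝ),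
      ∀ᶠ ε in 𝓝[>] (0 : ℝ),
        (∀ Γ, IsOuterSide (newtonPolygon g) Γ →
          IsBranchSystem g Γ (α Γ) (β Γ) (a Γ) (b Γ) (m Γ) (c Γ) (κ Γ) (υ Γ) (σ Γ) (M Γ) ε) ∧
        ∀ Γ₁, IsOuterSide (newtonPolygon g) Γ₁ → ∀ Γ₂, IsOuterSide (newtonPolygon g) Γ₂ → Γ₁ ≠ Γ₂ →
          ∀ n₁ n₂, ∀ p ∈ ball (0 : ℂ × ℂ) ε, ∀ p' ∈ ball (0 : ℂ × ℂ) ε, p.2 ≠ 0 → p'.2 ≠ 0 →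
            branchMap (α Γ₁) (β Γ₁) (a Γ₁) (b Γ₁) (υ Γ₁ n₁) (σ Γ₁ n₁) p ≠
              branchMap (α Γ₂) (β Γ₂) (a Γ₂) (b Γ₂) (υ Γ₂ n₂) (σ Γ₂ n₂) p' := by
  have hex : ∀ Γ, ∃ (α β a b : ℤ) (m : ℕ) (c κ : Fin (latticeLength Γ) → ℂ)
      (υ σ : Fin (latticeLength Γ) → ℂ × ℂ → ℂ) (M : ℝ), ∃ ε > 0,
      IsOuterSide (newtonPolygon g) Γ → IsBranchSystem g Γ α β a b m c κ υ σ M ε := by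
    intro Γ
    by_cases hΓ : IsOuterSide (newtonPolygon g) Γ
    · obtain ⟨α, β, a, b, m, h⟩ := exists_isSideChart hP hdim hΓ
      obtain ⟨c, κ, υ, σ, M, ε, hε, hs⟩ := h.exists_isBranchSystem hΓ.1.2 hP hnd
      exact ⟨α, β, a, b, m, c, κ, υ, σ, M, ε, hε, fun _ => hs⟩
    -- Arbitrary data for sets that are not outer sides, so that the choice can run over all sets.
    · exact ⟨0, 0, 0, 0, 0, 0, 0, 0, 0, 0, 1, one_pos, fun h => absurd h hΓ⟩
  choose α β a b m c κ υ σ M ε₀ hε₀ hsys using hex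
  have hfin := finite_outerSides hP hdim
  refine ⟨α, β, a, b, m, c, κ, υ, σ, M, ?_⟩
  have E1 : ∀ᶠ ε in 𝓝[>] (0 : ℝ), ∀ Γ ∈ {Γ | IsOuterSide (newtonPolygon g) Γ}, ε ≤ ε₀ Γ :=
    (eventually_all_finite hfin).2 fun Γ _ => by
      filter_upwards [Ioo_mem_nhdsGT (hε₀ Γ)] with ε hε using hε.2.le
  have E2 := (eventually_all_finite hfin).2 fun Γ₁ h₁ => (eventually_all_finite hfin).2
    fun Γ₂ h₂ => eventually_imp_distrib_left.2 fun hne : Γ₁ ≠ Γ₂ =>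
      (hsys Γ₁ h₁).eventually_branchMap_ne (hsys Γ₂ h₂) hne
  filter_upwards [E1, E2] with ε e1 e2
  exact ⟨fun Γ hΓ => (hsys Γ hΓ).mono (e1 Γ hΓ), fun Γ₁ h₁ Γ₂ h₂ hne =>
    e2 Γ₁ h₁ Γ₂ h₂ hne (e1 Γ₁ h₁) (e1 Γ₂ h₂)⟩

end

theorem mainTheorem1 (f : MvPolynomial (Fin 2) ℂ) (ξ₀ : ℂ)
    (hnd : IsNewtonNondegenerate (f - MvPolynomial.C ξ₀))
    (hrect : ContainsRectangles (newtonPolygon (f - MvPolynomial.C ξ₀)))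
    (hdim : affineDim (newtonPolygon (f - MvPolynomial.C ξ₀)) = 2) :
    ∃ ε > (0 : ℝ), ∃ R > (0 : ℝ),
      ∃ (κ : (Γ : Set (ℝ × ℝ)) → Fin (latticeLength Γ) → ℂ)
        (J Jhat : (Γ : Set (ℝ × ℝ)) → Fin (latticeLength Γ) → ℂ × ℂ → ℂ × ℂ),
        -- the embeddings that belong to one side, with their normal forms and extensions
        (∀ Γ, IsOuterSide (newtonPolygon (f - MvPolynomial.C ξ₀)) Γ →
          ∃ α β : ℤ,
            IsPrimitiveOuterNormal (newtonPolygon (f - MvPolynomial.C ξ₀)) Γ α β ∧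
            (∀ n, IsNormalizingEmbedding f ξ₀ Γ α β ε (κ Γ n) (J Γ n) (Jhat Γ n)) ∧
            IsNormalizingConstant f ξ₀ Γ α β ε (κ Γ) (Jhat Γ) ∧
            -- there are no others, up to a change of the coordinate `u` near `u = 0`
            (∀ (ε' : ℝ) (κ' : ℂ) (J' Jhat' : ℂ × ℂ → ℂ × ℂ), 0 < ε' → ε' ≤ ε →
              IsNormalizingEmbedding f ξ₀ Γ α β ε' κ' J' Jhat' →
              ∃! n, ∃ δ > 0, δ ≤ ε' ∧
                J' '' puncturedBidisc ξ₀ ε' δ ⊆ J Γ n '' puncturedBidisc ξ₀ ε ε)) ∧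
        -- the images of all embeddings are pairwise disjoint
        (∀ Γ₁ Γ₂, IsOuterSide (newtonPolygon (f - MvPolynomial.C ξ₀)) Γ₁ →
          IsOuterSide (newtonPolygon (f - MvPolynomial.C ξ₀)) Γ₂ →
          ∀ (n₁ : Fin (latticeLength Γ₁)) (n₂ : Fin (latticeLength Γ₂)),
            (Γ₁ ≠ Γ₂ ∨ (n₁ : ℕ) ≠ n₂) →
            Disjoint (J Γ₁ n₁ '' puncturedBidisc ξ₀ ε ε) (J Γ₂ n₂ '' puncturedBidisc ξ₀ ε ε)) ∧
        -- they cover the preimage of the disc outside the ball of radius `R`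
        (∀ p : ℂ × ℂ, evalAt f p ∈ ball ξ₀ ε → R ≤ normC2 p →
          ∃ Γ, IsOuterSide (newtonPolygon (f - MvPolynomial.C ξ₀)) Γ ∧
            ∃ n : Fin (latticeLength Γ), p ∈ J Γ n '' puncturedBidisc ξ₀ ε ε) := by
  obtain ⟨α, β, a, b, m, c, κ, υ, σ, M, hev⟩ := exists_isBranchSystem hnd hrect hdim
  obtain ⟨ε₀, hε₀, hcov⟩ := exists_branch_cover (g := f - MvPolynomial.C ξ₀) hrect hdim
    (α := α) (β := β) (a := a) (b := b) (m := m) (c := c) (κ := κ) (υ := υ) (σ := σ) (M := M)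
  obtain ⟨ε, hε, hsys, hne⟩ := (Filter.Eventually.and (Ioo_mem_nhdsGT hε₀) hev).exists
  obtain ⟨R, hR, hcov⟩ := hcov ε hε.1 hε.2.le hsys
  let J : (Γ : Set (ℝ × ℝ)) → Fin (latticeLength Γ) → ℂ × ℂ → ℂ × ℂ := fun Γ n p =>
    branchMap (α Γ) (β Γ) (a Γ) (b Γ) (υ Γ n) (σ Γ n) (p - (ξ₀, 0))
  have hdisj : ∀ Γ₁ Γ₂, IsOuterSide (newtonPolygon (f - MvPolynomial.C ξ₀)) Γ₁ →
      IsOuterSide (newtonPolygon (f - MvPolynomial.C ξ₀)) Γ₂ →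
      ∀ (n₁ : Fin (latticeLength Γ₁)) (n₂ : Fin (latticeLength Γ₂)),
        (Γ₁ ≠ Γ₂ ∨ (n₁ : ℕ) ≠ n₂) →
        Disjoint (J Γ₁ n₁ '' puncturedBidisc ξ₀ ε ε) (J Γ₂ n₂ '' puncturedBidisc ξ₀ ε ε) := by
    intro Γ₁ Γ₂ h₁ h₂ n₁ n₂ hor
    rw [Set.disjoint_left]
    intro x hx hx'
    obtain ⟨q, hq, hq2, rfl⟩ := mem_image_branchMap_iff.1 hx
    obtain ⟨q', hq', hq2', heq⟩ := mem_image_branchMap_iff.1 hx'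
    by_cases hΓ : Γ₁ = Γ₂
    · subst hΓ
      refine (hsys Γ₁ h₁).branchMap_ne (n := n₂) (n' := n₁) (fun h => ?_) hq' hq hq2' hq2 heq
      exact hor.elim (fun h' => h' rfl) fun h' => h' (congrArg Fin.val h.symm)
    · exact hne Γ₁ h₁ Γ₂ h₂ hΓ n₁ n₂ q hq q' hq' hq2 hq2' heq.symm
  have hcov' : ∀ p : ℂ × ℂ, evalAt f p ∈ ball ξ₀ ε → R ≤ normC2 p →
      ∃ Γ, IsOuterSide (newtonPolygon (f - MvPolynomial.C ξ₀)) Γ ∧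
        ∃ n : Fin (latticeLength Γ), p ∈ J Γ n '' puncturedBidisc ξ₀ ε ε := by
    intro p hp hpR
    obtain ⟨Γ, hΓ, n, q, hq, hq2, -, hqp⟩ := hcov p
      (by rw [evalAt_sub_C]; exact mem_ball_iff_norm.1 hp) hpR
    exact ⟨Γ, hΓ, n, mem_image_branchMap_iff.2 ⟨q, hq, hq2, hqp⟩⟩
  refine ⟨ε, hε.1, R, hR, κ, J,
    fun Γ n p => branchHat (α Γ) (β Γ) (a Γ) (b Γ) (υ Γ n) (σ Γ n) (p - (ξ₀, 0)),
    fun Γ hΓ => ⟨α Γ, β Γ, ⟨(hsys Γ hΓ).chart.isCoprime, (hsys Γ hΓ).chart.eq_face⟩,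
      fun n => ((hsys Γ hΓ).isNormalizingEmbedding n).1, (hsys Γ hΓ).isNormalizingConstant, ?_⟩,
    hdisj, hcov'⟩
  intro ε' κ' J' Jhat' hε' hεε' h'
  exact existsUnique_branch hsys (fun _ _ => rfl) hdisj hcov' hΓ hε' hεε' h'
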